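/- **Setting.** Let $d\ge 2$, $p\ge 1$ and let $\Omega\subset\mathbb R^d$ be a bounded polyhedral open set with $\Omega=\operatorname{int}\overline\Omega$ (for instance a polygonally bounded Lipschitz domain). Let $\mathcal T_0,\dots,\mathcal T_L$ be conforming simplicial meshes of $\overline\Omega$ such that each cell of $\mathcal T_{\ell-1}$ is a union of cells of $\mathcal T_\ell$. Let $h_\ell$ be the largest diameter of a cell of $\mathcal T_\ell$, and assume that for fixed constants $\rho,\kappa,c_{\rm ref}>0$ every $T\in\mathcal T_\ell$ contains a ball of radius $\rho\operatorname{diam}T$, $\operatorname{diam}T\ge\kappa h_\ell$, and $h_\ell\ge c_{\rm ref}h_{\ell-1}$. Let $\mathcal F_\ell$ be the set of $(d-1)$-dimensional faces of $\mathcal T_\ell$, $\Sigma_\ell$ their union, $$\langle\lambda,\mu\rangle_\ell=\sum_{T\in\mathcal T_\ell}\frac{|T|}{|\partial T|}\int_{\partial T}\lambda\mu\,d\sigma,\qquad \|\mu\|_\ell^2=\langle\mu,\mu\rangle_\ell,$$ let $M_\ell$ be the space of functions on the faces (multivalued where faces meet) that are polynomials of degree $\le p$ on every $F\in\mathcal F_\ell$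 and vanish on the faces $F\subset\partial\Omega$, let $\overline V^c_\ell=\{w\in H^1_0(\Omega): w|_T\in\mathcal P_1\ \forall T\in\mathcal T_\ell\}$, and let $\gamma_\ell$ be the trace on $\Sigma_\ell$. For $\lambda\in M_\ell$ the local solver $(\mathcal U_\ell\lambda,\mathcal Q_\ell\lambda)$ is given on each cell $T$ by the solution $u\in V_T$, $q\in W_T$ of $$\int_T q\cdot r-\int_T u\,\nabla\!\cdot r=-\int_{\partial T}\lambda\, r\cdot\nu,\qquad \int_{\partial T}(q\cdot\nu+\tau_\ell u)v-\int_T q\cdot\nabla v=\tau_\ell\int_{\partial T}\lambda v$$ for all $r\in W_T$, $v\in V_T$, where $V_T\subset\mathcal P_p$, $W_T$ is a space of polynomial vector fields, and $\tau_\ell\ge0$. Consider the assumptions * (LS2) $\|\mathcal Q_\ell\mu\|_0\le C_2h_\ell^{-1}\|\mu\|_\ell$ and $\|\mathcal U_\ell\mu\|_0\le C_2\|\mu\|_\ell$ for all $\mu\in M_\ell$, $0\le\ell\le L$; * (LS4) $\mathcal Q_\ell\gamma_\ell w=-\nabla w$ and $\mathcal U_\ell\gamma_\ell w=w$ for all $w\in\overline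 V^c_\ell$, $0\le\ell\le L$; * (IA1) $\|I_\ell\lambda\|_\ell\le C\|\lambda\|_{\ell-1}$ for all $\lambda\in M_{\ell-1}$; * (IA2) $I_\ell\gamma_{\ell-1}w=\gamma_\ell w$ for all $w\in\overline V^c_{\ell-1}$. **Operators.** Lagrange nodes are those of the principal lattice of degree $p$, and $\langle\!\langle\lambda(x)\rangle\!\rangle$ is the mean of the values at $x$ of $\lambda$ from all faces sharing $x$. * $I^0_\ell\lambda=\gamma_\ell\,\mathcal U^c_{\ell-1}\lambda$, where $\mathcal U^c_{\ell-1}\lambda$ is the continuous function which on each cell of $\mathcal T_{\ell-1}$ is the polynomial of degree $\le p$ with the following values at the Lagrange nodes $x$ of the cell: $0$ if $x$ lies on a face contained in $\partial\Omega$; otherwise $\langle\!\langle\lambda(x)\rangle\!\rangle$ if $x$ is on the boundary of a face, $\lambda(x)$ if $x$ is in the interior of a face, and $(\mathcal U_{\ell-1}\lambda)(x)$ if $x$ is in the interior of the cell. * $I^1_\ell,I^2_\ell,I^3_\ell$ leave $\lambda$ unchanged on those faces of $\mathcal T_\ell$ that are contained in faces of $\mathcal T_{\ell-1}$. On a new face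 $F$, enclosed in the coarse cell $T$: $I^1_\ell\lambda$ is the affine function whose value at each vertex $a$ of $F$ is the mean of the values $\lambda(a)$ from the coarse faces sharing $a$ (either from all of them, or from those of $T$ only; if $a$ is in the interior of a coarse face, this is $\lambda(a)$); $I^2_\ell\lambda=\mathcal U_{\ell-1}\lambda|_T$; $I^3_\ell\lambda$ is the polynomial of degree $\le p$ which at the Lagrange nodes of $F$ has the values of $I^1_\ell\lambda$ on $\partial F$ and those of $\mathcal U_{\ell-1}\lambda|_T$ in the interior of $F$. For $I^1_\ell$ and $I^3_\ell$ it is assumed that all vertices of $\mathcal T_\ell$ lie on $\Sigma_{\ell-1}$ (as for regular refinement and for bisection). **Lemma.** All four operators map $M_{\ell-1}$ to $M_\ell$, and for $1\le\ell\le L$: 1. $I^1_\ell$ satisfies (IA1), with a constant $C$ depending only on $d,p,\rho,\kappa,c_{\rm ref}$. 2. If (LS2) holds, then $I^0_\ell$, $I^2_\ell$ and $I^3_\ell$ satisfy (IA1), with a constant $C$ depending only on $d,p,\rho,\kappa,c_{\rm ref}$ and $C_2$. 3. $I^1_\ell$ satisfies (IA2). 4. If (LS4) holds, then $I^0_\ell$,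 $I^2_\ell$ and $I^3_\ell$ satisfy (IA2). -/

import Mathlib

noncomputable section

namespace HDG

open MeasureTheory Filter Topology
open scoped Classical

/-- The Euclidean space `ℝ^d`. -/
abbrev E (d : ℕ) : Type := EuclideanSpace ℝ (Fin d)

/-- The closed simplex with vertex set `s`. -/
def hull {d : ℕ} (s : Finset (E d)) : Set (E d) := convexHull ℝ (s : Set (E d))

/-! ### Meshes -/

/-- A regular (conforming) simplicial mesh in `ℝ^d`: a finite geometric simplicial complex in which
every simplex is a face of a `d`-dimensional one. Simplices are given by their vertex sets. -/
structure Mesh (d : ℕ) where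
  complex : Geometry.SimplicialComplex ℝ (E d)
  finite : complex.faces.Finite
  pure : ∀ s ∈ complex.faces, ∃ T ∈ complex.faces, s ⊆ T ∧ T.card = d + 1

namespace Mesh

variable {d : ℕ}

/-- The cells `T ∈ 𝒯`, i.e. the `d`-dimensional simplices. -/
def cells (M : Mesh d) : Finset (Finset (E d)) :=
  M.finite.toFinset.filter fun s => s.card = d + 1

/-- The set `ℱ` of all faces, i.e. of the `(d-1)`-dimensional simplices. -/
def sides (M : Mesh d) : Finset (Finset (E d)) :=
  M.finite.toFinset.filter fun s => s.card = d

/-- The set `ℱ^T` of the faces of the cell `T`. -/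
def sidesOf (M : Mesh d) (T : Finset (E d)) : Finset (Finset (E d)) :=
  M.sides.filter fun F => F ⊆ T

/-- The mesh size `h`: the largest diameter of a cell. -/
def size (M : Mesh d) : ℝ :=
  sSup ((fun T => Metric.diam (hull T)) '' (M.cells : Set (Finset (E d))))

end Mesh

/-- `M 0, …, M L` is a hierarchy of successively refined meshes of the bounded open set `Ω`
(which is the interior of its closure), with shape regularity constant `ρ`,
quasi-uniformity constant `κ` and refinement constant `c`. -/
structure IsMeshHierarchy {d : ℕ} (Ω : Set (E d)) (L : ℕ) (M : ℕ → Mesh d) (ρ κ c : ℝ) :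
    Prop where
  isOpen : IsOpen Ω
  interior_closure : interior (closure Ω) = Ω
  cover : ∀ ℓ ≤ L, (⋃ T ∈ (M ℓ).cells, hull T) = closure Ω
  refines : ∀ ℓ < L, ∀ T ∈ (M ℓ).cells,
    hull T = ⋃ K ∈ (M (ℓ + 1)).cells.filter (fun K => hull K ⊆ hull T), hull K
  shape_regular : ∀ ℓ ≤ L, ∀ T ∈ (M ℓ).cells,
    ∃ z, Metric.closedBall z (ρ * Metric.diam (hull T)) ⊆ hull T
  quasi_uniform : ∀ ℓ ≤ L, ∀ T ∈ (M ℓ).cells, κ * (M ℓ).size ≤ Metric.diam (hull T)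
  not_too_fast : ∀ ℓ < L, c * (M ℓ).size ≤ (M (ℓ + 1)).size

/-- All vertices of the fine mesh `M'` lie on the skeleton of the coarse mesh `M`. This holds for
regular (red) refinement and for bisection. -/
def VerticesOnSkeleton {d : ℕ} (M M' : Mesh d) : Prop :=
  ∀ T ∈ M'.cells, ∀ v ∈ T, ∃ F ∈ M.sides, v ∈ hull F

/-! ### Polynomials and functions on the skeleton -/

/-- The value at the point `x` of a polynomial in `d` variables. -/
def ev {d : ℕ} (P : MvPolynomial (Fin d) ℝ) (x : E d) : ℝ := MvPolynomial.eval (fun i => x i) P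

/-- The space `𝒫_p` of polynomials of total degree at most `p`. -/
abbrev Poly (d p : ℕ) : Submodule ℝ (MvPolynomial (Fin d) ℝ) :=
  MvPolynomial.restrictTotalDegree (Fin d) ℝ p

/-- A function on the skeleton: `lam F x` is the value at `x ∈ F` of the function on the face `F`;
the values of different faces at a common point are unrelated. Values outside of `F` are
irrelevant. -/
abbrev Skel (d : ℕ) : Type := Finset (E d) → E d → ℝ

/-- The space `M_ℓ`: polynomials of degree at most `p` on every face, zero on faces in `∂Ω`. -/
def skeletonSpace {d : ℕ} (p : ℕ) (Ω : Set (E d)) (M : Mesh d) : Set (Skel d) :=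
  {lam | ∀ F ∈ M.sides,
    (∃ P ∈ Poly d p, ∀ x ∈ hull F, lam F x = ev P x) ∧
    (hull F ⊆ frontier Ω → ∀ x ∈ hull F, lam F x = 0)}

/-- The integral over a face with respect to the surface measure. -/
def sideInt {d : ℕ} (F : Finset (E d)) (f : E d → ℝ) : ℝ := ∫ x in hull F, f x ∂μHE[d - 1]

/-- The inner product `⟨lam, mu⟩_ℓ = ∑_T |T| / |∂T| ∫_{∂T} lam mu dσ`. -/
def skelInner {d : ℕ} (M : Mesh d) (lam mu : Skel d) : ℝ :=
  ∑ T ∈ M.cells, volume.real (hull T) / (∑ F ∈ M.sidesOf T, sideInt F fun _ => 1) *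
    ∑ F ∈ M.sidesOf T, sideInt F fun x => lam F x * mu F x

/-- The norm `‖lam‖_ℓ`. -/
def skelNorm {d : ℕ} (M : Mesh d) (lam : Skel d) : ℝ := √(skelInner M lam lam)

/-! ### Local solvers -/

/-- The data of an HDG method of degree `p` on all levels: the local spaces `V_T ⊆ 𝒫_p` and `W_T`
and the penalty coefficients `τ_ℓ`. -/
structure Method (d p : ℕ) where
  V : ℕ → Finset (E d) → Submodule ℝ (MvPolynomial (Fin d) ℝ)
  W : ℕ → Finset (E d) → Submodule ℝ (Fin d → MvPolynomial (Fin d) ℝ)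
  τ : ℕ → ℝ
  V_le : ∀ ℓ T, V ℓ T ≤ Poly d p
  τ_nonneg : ∀ ℓ, 0 ≤ τ ℓ

/-- The outward unit normal of the cell `T` on its face `F`. -/
def normal {d : ℕ} (T F : Finset (E d)) : E d :=
  Classical.epsilon fun n => ‖n‖ = 1 ∧ (∀ a ∈ F, ∀ b ∈ F, inner ℝ n (a - b) = 0) ∧
    ∀ a ∈ F, ∀ v ∈ T \ F, inner ℝ n (v - a) < 0

/-- The normal component `q · ν` on the face `F` of `T`. -/
def normalFlux {d : ℕ} (T F : Finset (E d)) (q : Fin d → MvPolynomial (Fin d) ℝ) (x : E d) : ℝ :=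
  ∑ i, ev (q i) x * normal T F i

/-- `(u, q) = s` solves the local problem on the cell `T` with boundary data `lam`. -/
def IsLocalSolution {d : ℕ} (M : Mesh d) (T : Finset (E d))
    (V : Submodule ℝ (MvPolynomial (Fin d) ℝ)) (W : Submodule ℝ (Fin d → MvPolynomial (Fin d) ℝ))
    (τ : ℝ) (lam : Skel d)
    (s : MvPolynomial (Fin d) ℝ × (Fin d → MvPolynomial (Fin d) ℝ)) : Prop :=
  s.1 ∈ V ∧ s.2 ∈ W ∧
  (∀ r ∈ W,
    (∫ x in hull T, ∑ i, ev (s.2 i) x * ev (r i) x) -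
      (∫ x in hull T, ev s.1 x * ∑ i, ev (MvPolynomial.pderiv i (r i)) x) =
    -∑ F ∈ M.sidesOf T, sideInt F fun x => lam F x * normalFlux T F r x) ∧
  (∀ v ∈ V,
    (∑ F ∈ M.sidesOf T, sideInt F fun x =>
        (normalFlux T F s.2 x + τ * ev s.1 x) * ev v x) -
      (∫ x in hull T, ∑ i, ev (s.2 i) x * ev (MvPolynomial.pderiv i v) x) =
    τ * ∑ F ∈ M.sidesOf T, sideInt F fun x => lam F x * ev v x)

/-- The solution `(u_T, q_T)` of the local problem on `T` (zero if there is none). -/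
def localSolution {d p : ℕ} (S : Method d p) (ℓ : ℕ) (M : Mesh d) (lam : Skel d)
    (T : Finset (E d)) : MvPolynomial (Fin d) ℝ × (Fin d → MvPolynomial (Fin d) ℝ) :=
  if h : ∃ s, IsLocalSolution M T (S.V ℓ T) (S.W ℓ T) (S.τ ℓ) lam s then h.choose else 0

/-- The local solver `𝒰_ℓ lam`, as the family of its polynomials on the cells. -/
def solU {d p : ℕ} (S : Method d p) (ℓ : ℕ) (M : Mesh d) (lam : Skel d) (T : Finset (E d)) :
    MvPolynomial (Fin d) ℝ := (localSolution S ℓ M lam T).1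

/-- The local solver `𝒬_ℓ lam`, as the family of its polynomial vector fields on the cells. -/
def solQ {d p : ℕ} (S : Method d p) (ℓ : ℕ) (M : Mesh d) (lam : Skel d) (T : Finset (E d)) :
    Fin d → MvPolynomial (Fin d) ℝ := (localSolution S ℓ M lam T).2

/-- The norm of `L²(Ω)` of a piecewise polynomial function. -/
def bulkNorm {d : ℕ} (M : Mesh d) (u : Finset (E d) → MvPolynomial (Fin d) ℝ) : ℝ :=
  √(∑ T ∈ M.cells, ∫ x in hull T, ev (u T) x ^ 2)

/-- The norm of `L²(Ω; ℝ^d)` of a piecewise polynomial vector field. -/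
def bulkNormVec {d : ℕ} (M : Mesh d) (q : Finset (E d) → Fin d → MvPolynomial (Fin d) ℝ) : ℝ :=
  √(∑ T ∈ M.cells, ∫ x in hull T, ∑ i, ev (q T i) x ^ 2)

/-! ### Conforming linear finite elements -/

/-- `w ∈ H¹₀(Ω)`: on `Ω`, `w` is the limit in `L²`, and the gradients converge in `L²`, of a
sequence of smooth functions with compact support in `Ω`. -/
def MemH10 {d : ℕ} (Ω : Set (E d)) (w : E d → ℝ) : Prop :=
  MemLp w 2 (volume.restrict Ω) ∧
  ∃ (g : E d → E d) (φ : ℕ → E d → ℝ), MemLp g 2 (volume.restrict Ω) ∧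
    (∀ n, ContDiff ℝ (⊤ : ℕ∞) (φ n) ∧ HasCompactSupport (φ n) ∧ tsupport (φ n) ⊆ Ω) ∧
    Tendsto (fun n => eLpNorm (φ n - w) 2 (volume.restrict Ω)) atTop (𝓝 0) ∧
    Tendsto (fun n => eLpNorm (gradient (φ n) - g) 2 (volume.restrict Ω)) atTop (𝓝 0)

/-- The space `V̄ᶜ_ℓ` of functions in `H¹₀(Ω)` that are affine on every (closed) cell. -/
def conformingP1 {d : ℕ} (Ω : Set (E d)) (M : Mesh d) : Set (E d → ℝ) :=
  {w | MemH10 Ω w ∧ ∀ T ∈ M.cells, ∃ P ∈ Poly d 1, ∀ x ∈ hull T, w x = ev P x}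

/-- The trace operator `γ_ℓ` on the skeleton. -/
def trace {d : ℕ} (w : E d → ℝ) : Skel d := fun _ x => w x

/-! ### Assumptions on the local solvers and on injection operators -/

/-- (LS2) with the constant `C` on the levels `0, …, L`: boundedness of the local solvers. -/
def LS2 {d p : ℕ} (Ω : Set (E d)) (L : ℕ) (M : ℕ → Mesh d) (S : Method d p) (C : ℝ) : Prop :=
  ∀ ℓ ≤ L, ∀ mu ∈ skeletonSpace p Ω (M ℓ),
    bulkNormVec (M ℓ) (solQ S ℓ (M ℓ) mu) ≤ C * (M ℓ).size⁻¹ * skelNorm (M ℓ) mu ∧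
    bulkNorm (M ℓ) (solU S ℓ (M ℓ) mu) ≤ C * skelNorm (M ℓ) mu

/-- (LS4) on the levels `0, …, L`: `𝒬_ℓ γ_ℓ w = -∇w` and `𝒰_ℓ γ_ℓ w = w` for all conforming
piecewise linear functions `w`. -/
def LS4 {d p : ℕ} (Ω : Set (E d)) (L : ℕ) (M : ℕ → Mesh d) (S : Method d p) : Prop :=
  ∀ ℓ ≤ L, ∀ w ∈ conformingP1 Ω (M ℓ), ∀ T ∈ (M ℓ).cells,
    (∀ x ∈ interior (hull T), ∀ i,
      ev (solQ S ℓ (M ℓ) (trace w) T i) x = -(gradient w x) i) ∧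
    (∀ x ∈ hull T, ev (solU S ℓ (M ℓ) (trace w) T) x = w x)

/-- (IA1) with the constant `C`, for an operator `I` from the skeleton of the coarse mesh `M` to
that of the fine mesh `M'`. -/
def IA1 {d : ℕ} (p : ℕ) (Ω : Set (E d)) (M M' : Mesh d) (I : Skel d → Skel d) (C : ℝ) : Prop :=
  ∀ lam ∈ skeletonSpace p Ω M, skelNorm M' (I lam) ≤ C * skelNorm M lam

/-- (IA2), as an identity on every face of the fine mesh `M'`. -/
def IA2 {d : ℕ} (Ω : Set (E d)) (M M' : Mesh d) (I : Skel d → Skel d) : Prop :=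
  ∀ w ∈ conformingP1 Ω M, ∀ F ∈ M'.sides, ∀ x ∈ hull F, I (trace w) F x = trace w F x

/-! ### Lagrange interpolation on a simplex -/

/-- The barycentric coordinates of the point `x` with respect to the simplex `s`. -/
def bary {d : ℕ} (s : Finset (E d)) (x : E d) : E d → ℝ :=
  Classical.epsilon fun b => ∑ v ∈ s, b v = 1 ∧ ∑ v ∈ s, b v • v = x

/-- The node of the principal lattice of degree `p` with multi-index `k`, i.e. the point with the
barycentric coordinates `k v / p`. -/
def node {d : ℕ} (s : Finset (E d)) (p : ℕ) (k : E d → ℕ) : E d :=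
  ∑ v ∈ s, ((k v : ℝ) / p) • v

/-- The Lagrange basis function of degree `p` belonging to the node with multi-index `k`. -/
def lagrangeBasis {d : ℕ} (s : Finset (E d)) (p : ℕ) (k : E d → ℕ) (x : E d) : ℝ :=
  ∏ v ∈ s, ∏ j ∈ Finset.range (k v), ((p : ℝ) * bary s x v - j) / (j + 1)

/-- The Lagrange interpolant of degree `p` on the simplex `s` with the prescribed nodal values. -/
def interp {d : ℕ} (s : Finset (E d)) (p : ℕ) (val : E d → ℝ) (x : E d) : ℝ :=
  ∑ k ∈ s.piAntidiag p, val (node s p k) * lagrangeBasis s p k x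

/-- The (relative) boundary of the simplex `s`. -/
def relBoundary {d : ℕ} (s : Finset (E d)) : Set (E d) := ⋃ v ∈ s, hull (s.erase v)

/-! ### Injection operators -/

/-- The arithmetic mean at `x` of the values of `lam` from all faces in `A` that contain `x`. -/
def avg {d : ℕ} (A : Finset (Finset (E d))) (lam : Skel d) (x : E d) : ℝ :=
  (∑ F ∈ A.filter (fun F => x ∈ hull F), lam F x) / (A.filter (fun F => x ∈ hull F)).card

/-- The nodal values of the continuous extension: zero on `∂Ω`; on the other faces the mean of the
values of all faces sharing `x` (if `x` is in the interior of a face, this is the only one);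
in the interior of a cell `T` the value of the local solution. -/
def extNodal {d p : ℕ} (Ω : Set (E d)) (S : Method d p) (ℓ : ℕ) (M : Mesh d) (lam : Skel d)
    (T : Finset (E d)) (x : E d) : ℝ :=
  if ∃ F ∈ M.sides, hull F ⊆ frontier Ω ∧ x ∈ hull F then 0
  else if ∃ F ∈ M.sides, x ∈ hull F then avg M.sides lam x
  else ev (solU S ℓ M lam T) x

/-- The continuous extension `𝒰ᶜ_ℓ lam`, given on every cell by Lagrange interpolation of its nodal
values. (The nodal values on a face determine the interpolant there, so the choice of the cell
containing `x` is immaterial.) -/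
def contExt {d p : ℕ} (Ω : Set (E d)) (S : Method d p) (ℓ : ℕ) (M : Mesh d) (lam : Skel d)
    (x : E d) : ℝ :=
  if h : ∃ T ∈ M.cells, x ∈ hull T then
    interp h.choose p (extNodal Ω S ℓ M lam h.choose) x
  else 0

/-- `I⁰`: the trace of the continuous extension. Here and below, `ℓ` and `M` are the coarse level
and mesh. -/
def inj0 {d p : ℕ} (Ω : Set (E d)) (S : Method d p) (ℓ : ℕ) (M : Mesh d) (lam : Skel d) : Skel d :=
  trace (contExt Ω S ℓ M lam)

/-- A face `F` of the fine mesh that is part of a face of the coarse mesh `M`; the others are the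
new faces. -/
def IsOld {d : ℕ} (M : Mesh d) (F : Finset (E d)) : Prop := ∃ G ∈ M.sides, hull F ⊆ hull G

/-- The face of the coarse mesh containing the old face `F`. -/
def parentSide {d : ℕ} (M : Mesh d) (F : Finset (E d)) : Finset (E d) :=
  Classical.epsilon fun G => G ∈ M.sides ∧ hull F ⊆ hull G

/-- The cell of the coarse mesh containing the face `F` (unique for new faces). -/
def parentCell {d : ℕ} (M : Mesh d) (F : Finset (E d)) : Finset (E d) :=
  Classical.epsilon fun T => T ∈ M.cells ∧ hull F ⊆ hull T

/-- The operator that embeds on old faces and takes the values `new lam F x` on new faces. -/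
def extendToNew {d : ℕ} (M : Mesh d) (new : Skel d → Skel d) (lam : Skel d) : Skel d :=
  fun F x => if IsOld M F then lam (parentSide M F) x else new lam F x

/-- The two customary ways to take the mean of `lam` in a vertex of a new face: over all coarse
faces sharing the vertex, or only over those which belong to the enclosing coarse cell. -/
inductive Averaging
  | global
  | cellwise

/-- The set of coarse faces used for averaging in the coarse cell `T`. -/
def Averaging.patch {d : ℕ} : Averaging → Mesh d → Finset (E d) → Finset (Finset (E d))
  | .global, M, _ => M.sides
  | .cellwise, M, T => M.sidesOf T

/-- Linear interpolation on the new face `F` of the (mean) values of `lam` in the vertices of `F`.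
If a vertex is in the interior of a coarse face, the mean is the value of `lam` there. -/
def linearOnNew {d : ℕ} (r : Averaging) (M : Mesh d) (lam : Skel d) : Skel d :=
  fun F x => ∑ v ∈ F, bary F x v * avg (r.patch M (parentCell M F)) lam v

/-- `I¹`: linear interpolation on new faces. -/
def inj1 {d : ℕ} (r : Averaging) (M : Mesh d) : Skel d → Skel d :=
  extendToNew M (linearOnNew r M)

/-- `I²`: on new faces, the values of the local solution `𝒰 lam`. -/
def inj2 {d p : ℕ} (S : Method d p) (ℓ : ℕ) (M : Mesh d) : Skel d → Skel d :=
  extendToNew M fun lam F x => ev (solU S ℓ M lam (parentCell M F)) x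

/-- `I³`: on new faces, the Lagrange interpolant with the nodal values of `I¹` on the boundary of
the face and those of `𝒰 lam` in its interior. -/
def inj3 {d p : ℕ} (r : Averaging) (S : Method d p) (ℓ : ℕ) (M : Mesh d) : Skel d → Skel d :=
  extendToNew M fun lam F => interp F p fun y =>
    if y ∈ relBoundary F then linearOnNew r M lam F y
    else ev (solU S ℓ M lam (parentCell M F)) y

end HDG

end

noncomputable section

namespace HDG

open MeasureTheory Filter Topology
open scoped Classical

variable {d : ℕ}

/-! Mapping property. Piecewise polynomiality is immediate; the point is the boundary condition. A
face lies in `∂Ω` exactly when it belongs to a single cell, so one relatively interior point in `∂Ω`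
puts the whole face there (`Covers.subset_frontier_of_relint`). Hence a fine boundary face lies in a
coarse face which is itself a boundary face, and new faces never lie in `∂Ω`.

(IA1). All four operators are local and bounded in the maximum norm: on a fine face inside the
coarse cell `T` they only average, take convex combinations, evaluate `𝒰 lam` or interpolate, so
their values are at most `interpConst d p` times the maximum of `lam` and `𝒰 lam` around `T`
(`LocalBound`). The passage to the skeleton norms is `exists_skelInner_le`. The inverse inequality,
proved on the unit simplex by compactness and transported by affine maps, bounds `|T|` times a
squared maximum by the energy of `T`. The surface weights cost only a constant, because all faces of
a shape regular cell have comparable measure (`side_measure_le`). Summation over the cells uses that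
the cells touching `T` have total volume at most a constant times `|T|` (`sum_patch_volume_le`). The
fine cells enter only through their volumes, which add up to at most that of the coarse cell. The
bulk norm of `𝒰 lam` that remains is absorbed by (LS2).

(IA2). The trace of a continuous `w` is single-valued, so all means return `w`; (LS4) gives `𝒰 γ w =
w`; and interpolation on a simplex reproduces affine functions (`IsCell.interp_affine`, a weighted
Vandermonde identity). Only the boundary nodes of `I⁰`, where the value `0` is imposed, need more:
`w ∈ H¹₀(Ω)` must vanish pointwise on boundary faces (`Covers.eq_zero_of_frontier`). No trace
theorem is used for this. The extension of `w` by zero satisfies `‖W(· + h) - W‖ ≤ C‖h‖` in `L²`,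
whereas a nonzero boundary value would create a jump on a layer of thickness `s` under a shift of
order `s`, that is, a squared norm of order `s` instead of `s²`. -/

/-! ### Barycentric coordinates of a cell -/

/-- A nondegenerate simplex of full dimension, given by its vertices. -/
structure IsCell (T : Finset (E d)) : Prop where
  card : T.card = d + 1
  indep : AffineIndependent ℝ ((↑) : T → E d)

/-- The vertices of a cell, as an affine basis. -/
def IsCell.basis {T : Finset (E d)} (h : IsCell T) : AffineBasis T ℝ (E d) :=
  ⟨(↑), h.indep, by
    rw [h.indep.affineSpan_eq_top_iff_card_eq_finrank_add_one]
    simp [h.card]⟩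

/-- The barycentric coordinate of the cell `T` belonging to the vertex `v`. -/
def bc (T : Finset (E d)) (v : E d) : E d →ᵃ[ℝ] ℝ :=
  -- The junk value `0` keeps `bc T v` an affine map for all arguments, so continuity and affinity
  -- need no membership hypothesis.
  if h : IsCell T ∧ v ∈ T then h.1.basis.coord ⟨v, h.2⟩ else 0

/-- The linear part commutes with the sum, and the constant `f 0` is multiplied by the total weight
`1`. Weights may be negative. -/
lemma affine_comb (f : E d →ᵃ[ℝ] ℝ) (s : Finset (E d)) (b : E d → ℝ) (hb : ∑ v ∈ s, b v = 1) :
    f (∑ v ∈ s, b v • v) = ∑ v ∈ s, b v * f v := by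
  have h1 : ∀ x, f x = f.linear x + f 0 := fun x => by
    simpa using congrFun f.decomp x
  rw [h1, map_sum]
  have : ∑ v ∈ s, b v * f v = ∑ v ∈ s, (f.linear (b v • v) + b v * f 0) :=
    Finset.sum_congr rfl fun v _ => by rw [h1 v, map_smul, smul_eq_mul]; ring
  rw [this, Finset.sum_add_distrib, ← Finset.sum_mul, hb, one_mul]

namespace IsCell

variable {T : Finset (E d)} (hT : IsCell T)
include hT

lemma bc_eq {v : E d} (hv : v ∈ T) : bc T v = hT.basis.coord ⟨v, hv⟩ := by
  rw [bc, dif_pos ⟨hT, hv⟩]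

lemma bc_self {v : E d} (hv : v ∈ T) : bc T v v = 1 := by
  rw [hT.bc_eq hv]; exact hT.basis.coord_apply_eq ⟨v, hv⟩

lemma bc_ne {v w : E d} (hv : v ∈ T) (hw : w ∈ T) (h : w ≠ v) : bc T v w = 0 := by
  rw [hT.bc_eq hv]
  exact hT.basis.coord_apply_ne (i := ⟨v, hv⟩) (j := ⟨w, hw⟩) fun h' => h (by simpa using h'.symm)

lemma sum_bc (x : E d) : ∑ v ∈ T, bc T v x = 1 := by
  rw [← hT.basis.sum_coord_apply_eq_one x, ← Finset.sum_coe_sort]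
  exact Finset.sum_congr rfl fun v _ => by rw [hT.bc_eq v.2]

lemma sum_bc_smul (x : E d) : ∑ v ∈ T, bc T v x • v = x := by
  conv_rhs => rw [← hT.basis.linear_combination_coord_eq_self x]
  rw [← Finset.sum_coe_sort]
  exact Finset.sum_congr rfl fun v _ => by rw [hT.bc_eq v.2]; rfl

lemma bc_comb {s : Finset (E d)} (hs : s ⊆ T) {b : E d → ℝ} (hb : ∑ v ∈ s, b v = 1) {v : E d}
    (hv : v ∈ s) : bc T v (∑ w ∈ s, b w • w) = b v := by
  rw [affine_comb _ _ _ hb, Finset.sum_eq_single v]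
  · rw [hT.bc_self (hs hv), mul_one]
  · intro w hw hne; rw [hT.bc_ne (hs hv) (hs hw) hne, mul_zero]
  · exact fun h => absurd hv h

lemma bc_comb_of_notMem {s : Finset (E d)} (hs : s ⊆ T) {b : E d → ℝ} (hb : ∑ v ∈ s, b v = 1)
    {v : E d} (hvT : v ∈ T) (hv : v ∉ s) : bc T v (∑ w ∈ s, b w • w) = 0 := by
  rw [affine_comb _ _ _ hb]
  refine Finset.sum_eq_zero fun w hw => ?_
  rw [hT.bc_ne hvT (hs hw) (fun h => hv (h ▸ hw)), mul_zero]

lemma affine_eq (f : E d →ᵃ[ℝ] ℝ) (x : E d) : f x = ∑ v ∈ T, bc T v x * f v := by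
  conv_lhs => rw [← hT.sum_bc_smul x]
  exact affine_comb f T _ (hT.sum_bc x)

lemma sum_bc_face {s : Finset (E d)} (hs : s ⊆ T) {x : E d}
    (h0 : ∀ v ∈ T, v ∉ s → bc T v x = 0) : ∑ v ∈ s, bc T v x = 1 := by
  rw [← hT.sum_bc x]; exact Finset.sum_subset hs h0

lemma sum_bc_smul_face {s : Finset (E d)} (hs : s ⊆ T) {x : E d}
    (h0 : ∀ v ∈ T, v ∉ s → bc T v x = 0) : ∑ v ∈ s, bc T v x • v = x := by
  conv_rhs => rw [← hT.sum_bc_smul x]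
  exact Finset.sum_subset hs fun v hv hvs => by rw [h0 v hv hvs, zero_smul]

/-- By uniqueness of barycentric coordinates, every face of a cell is described in the coordinates
of that cell. The geometric arguments about faces run on this criterion. -/
lemma mem_hull {s : Finset (E d)} (hs : s ⊆ T) {x : E d} :
    x ∈ hull s ↔ (∀ v ∈ T, 0 ≤ bc T v x) ∧ ∀ v ∈ T, v ∉ s → bc T v x = 0 := by
  rw [hull, Finset.mem_convexHull']
  constructor
  · rintro ⟨w, h0, h1, rfl⟩
    refine ⟨fun v hv => ?_, fun v hv hvs => hT.bc_comb_of_notMem hs h1 hv hvs⟩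
    by_cases hvs : v ∈ s
    · rw [hT.bc_comb hs h1 hvs]; exact h0 v hvs
    · rw [hT.bc_comb_of_notMem hs h1 hv hvs]
  · rintro ⟨h0, h1⟩
    exact ⟨fun v => bc T v x, fun v hv => h0 v (hs hv), hT.sum_bc_face hs h1,
      hT.sum_bc_smul_face hs h1⟩

lemma mem_hull_self {x : E d} : x ∈ hull T ↔ ∀ v ∈ T, 0 ≤ bc T v x := by
  rw [hT.mem_hull subset_rfl]; exact ⟨fun h => h.1, fun h => ⟨h, fun v hv hv' => absurd hv hv'⟩⟩

lemma mem_interior {x : E d} : x ∈ interior (hull T) ↔ ∀ v ∈ T, 0 < bc T v x := by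
  have h : hull T = convexHull ℝ (Set.range hT.basis) := by
    rw [hull]; congr 1; ext y
    exact ⟨fun h => ⟨⟨y, h⟩, rfl⟩, fun ⟨a, h⟩ => h ▸ a.2⟩
  rw [h, AffineBasis.interior_convexHull]
  constructor
  · intro h v hv; rw [hT.bc_eq hv]; exact h ⟨v, hv⟩
  · intro h v; rw [← hT.bc_eq v.2]; exact h v v.2

/-- `bary` is only a choice of weights, but affine independence leaves no freedom on `s`. In
particular the coordinates on a common face are the same from every adjacent cell. -/
lemma bary_eq {s : Finset (E d)} (hs : s ⊆ T) {x : E d} (hx : x ∈ hull s) {v : E d} (hv : v ∈ s) :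
    bary s x v = bc T v x := by
  have h0 := ((hT.mem_hull hs).1 hx).2
  have hex : ∃ b : E d → ℝ, ∑ v ∈ s, b v = 1 ∧ ∑ v ∈ s, b v • v = x :=
    ⟨fun v => bc T v x, hT.sum_bc_face hs h0, hT.sum_bc_smul_face hs h0⟩
  obtain ⟨h1, h2⟩ := Classical.epsilon_spec hex
  conv_rhs => rw [← h2]
  exact (hT.bc_comb hs h1 hv).symm

lemma bc_le_one {x : E d} (hx : x ∈ hull T) {v : E d} (hv : v ∈ T) : bc T v x ≤ 1 := by
  rw [← hT.sum_bc x]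
  exact Finset.single_le_sum (f := fun v => bc T v x) (fun w hw => hT.mem_hull_self.1 hx w hw) hv

end IsCell

lemma vertex_mem_hull {s : Finset (E d)} {v : E d} (hv : v ∈ s) : v ∈ hull s :=
  subset_convexHull ℝ _ (by exact_mod_cast hv)

lemma hull_mono {s t : Finset (E d)} (h : s ⊆ t) : hull s ⊆ hull t :=
  convexHull_mono (by exact_mod_cast h)

lemma hull_convex (s : Finset (E d)) : Convex ℝ (hull s) := convex_convexHull ℝ _

lemma hull_isCompact (s : Finset (E d)) : IsCompact (hull s) :=
  s.finite_toSet.isCompact_convexHull (𝕜 := ℝ)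

lemma hull_isClosed (s : Finset (E d)) : IsClosed (hull s) := (hull_isCompact s).isClosed

lemma hull_isBounded (s : Finset (E d)) : Bornology.IsBounded (hull s) :=
  (hull_isCompact s).isBounded

lemma hull_subset_of_vertices {s : Finset (E d)} {A : Set (E d)} (hA : Convex ℝ A)
    (h : ∀ v ∈ s, v ∈ A) : hull s ⊆ A := convexHull_min (fun v hv => h v (by exact_mod_cast hv)) hA

/-- The barycenter of a simplex. -/
def barycenter (s : Finset (E d)) : E d := ∑ v ∈ s, (1 / s.card : ℝ) • v

lemma sum_barycenter {s : Finset (E d)} (hs : s.Nonempty) : ∑ _v ∈ s, (1 / s.card : ℝ) = 1 := by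
  rw [Finset.sum_const, nsmul_eq_mul, mul_one_div_cancel]
  exact_mod_cast hs.card_pos.ne'

lemma barycenter_mem {s : Finset (E d)} (hs : s.Nonempty) : barycenter s ∈ hull s := by
  rw [hull, Finset.mem_convexHull']
  exact ⟨fun _ => 1 / s.card, fun _ _ => by positivity, sum_barycenter hs, rfl⟩

lemma affine_barycenter {s : Finset (E d)} (hs : s.Nonempty) (f : E d →ᵃ[ℝ] ℝ) :
    f (barycenter s) = (1 / s.card : ℝ) * ∑ v ∈ s, f v := by
  rw [barycenter, affine_comb f s (fun _ => 1 / s.card) (sum_barycenter hs), Finset.mul_sum]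

/-- An affine function which is nonnegative on a simplex and vanishes in its barycenter vanishes on
the simplex. -/
lemma affine_eq_zero_of_barycenter {s : Finset (E d)} (hs : s.Nonempty) (f : E d →ᵃ[ℝ] ℝ)
    (h0 : ∀ v ∈ s, 0 ≤ f v) (hb : f (barycenter s) = 0) : ∀ v ∈ s, f v = 0 := by
  rw [affine_barycenter hs, mul_eq_zero] at hb
  rcases hb with hb | hb
  · have : (0 : ℝ) < s.card := by exact_mod_cast hs.card_pos
    simp only [one_div, inv_eq_zero] at hb
    exact absurd hb this.ne'
  · exact (Finset.sum_eq_zero_iff_of_nonneg h0).1 hb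

/-! ### Affine functions as polynomials -/

/-- The polynomial of degree at most `1` representing an affine function. -/
def affinePoly (f : E d →ᵃ[ℝ] ℝ) : MvPolynomial (Fin d) ℝ :=
  MvPolynomial.C (f 0) + ∑ i, MvPolynomial.C (f.linear (EuclideanSpace.single i 1)) * MvPolynomial.X i

lemma ev_affinePoly (f : E d →ᵃ[ℝ] ℝ) (x : E d) : ev (affinePoly f) x = f x := by
  have h1 : f x = f.linear x + f 0 := by simpa using congrFun f.decomp x
  have h2 : x = ∑ i, x i • EuclideanSpace.single i (1 : ℝ) := by
    ext j; simp [Finset.sum_apply, Pi.single_apply]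
  rw [h1]
  conv_rhs => rw [h2, map_sum]
  simp only [ev, affinePoly, map_add, map_sum, map_mul, MvPolynomial.eval_C, MvPolynomial.eval_X,
    map_smul, smul_eq_mul]
  rw [add_comm]
  congr 1
  exact Finset.sum_congr rfl fun i _ => mul_comm _ _

lemma affinePoly_totalDegree (f : E d →ᵃ[ℝ] ℝ) : (affinePoly f).totalDegree ≤ 1 := by
  refine (MvPolynomial.totalDegree_add _ _).trans (max_le (by simp) ?_)
  refine (MvPolynomial.totalDegree_finsetSum _ _).trans (Finset.sup_le fun i _ => ?_)
  refine (MvPolynomial.totalDegree_mul _ _).trans ?_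
  simp

lemma affinePoly_mem (f : E d →ᵃ[ℝ] ℝ) : affinePoly f ∈ Poly d 1 := by
  rw [MvPolynomial.mem_restrictTotalDegree]; exact affinePoly_totalDegree f

lemma Poly_mono {p q : ℕ} (h : p ≤ q) : Poly d p ≤ Poly d q := fun P hP => by
  rw [MvPolynomial.mem_restrictTotalDegree] at *; exact hP.trans h

lemma ev_continuous (P : MvPolynomial (Fin d) ℝ) : Continuous (ev P) := by
  unfold ev
  exact (MvPolynomial.continuous_eval P).comp (by fun_prop)

/-- The affine function represented by a polynomial of degree at most `1`. -/
lemma exists_affine_of_mem_Poly_one {P : MvPolynomial (Fin d) ℝ} (hP : P ∈ Poly d 1) :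
    ∃ f : E d →ᵃ[ℝ] ℝ, ∀ x, ev P x = f x := by
  rw [MvPolynomial.mem_restrictTotalDegree] at hP
  suffices h : ∀ m ∈ P.support, ∃ f : E d →ᵃ[ℝ] ℝ,
      ∀ x : E d, MvPolynomial.coeff m P * ∏ i, x i ^ m i = f x by
    choose! f hf using h
    refine ⟨∑ m ∈ P.support, f m, fun x => ?_⟩
    rw [ev, MvPolynomial.eval_eq']
    have : (∑ m ∈ P.support, f m) x = ∑ m ∈ P.support, f m x := by
      induction P.support using Finset.induction_on with
      | empty => simp
      | insert a s ha ih => rw [Finset.sum_insert ha, Finset.sum_insert ha, ← ih]; rfl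
    rw [this]
    exact Finset.sum_congr rfl fun m hm => hf m hm x
  intro m hm
  have hdeg : ∑ i, m i ≤ 1 := by
    have := (MvPolynomial.le_totalDegree hm).trans hP
    rwa [Finsupp.sum_fintype _ _ (fun _ => rfl)] at this
  -- A multi-index of weight at most `1` is zero or a unit vector: the monomial is a constant or a
  -- multiple of a coordinate.
  by_cases h0 : m = 0
  · exact ⟨AffineMap.const ℝ _ (MvPolynomial.coeff m P), fun x => by simp [h0]⟩
  · obtain ⟨i, hi⟩ : ∃ i, m i ≠ 0 := by
      by_contra! h; exact h0 (Finsupp.ext h)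
    have hsingle : ∀ j, m j = if j = i then 1 else 0 := by
      intro j
      have h1 := Finset.add_sum_erase Finset.univ m (Finset.mem_univ i)
      split_ifs with hj
      · subst hj; omega
      · have := Finset.single_le_sum (f := m) (fun k _ => Nat.zero_le _)
          (Finset.mem_erase.2 ⟨hj, Finset.mem_univ j⟩)
        omega
    refine ⟨(MvPolynomial.coeff m P • (EuclideanSpace.proj i : E d →L[ℝ] ℝ).toLinearMap).toAffineMap,
      fun x => ?_⟩
    rw [Finset.prod_eq_single i]
    · simp [hsingle]
    · intro j _ hj; simp [hsingle, hj]
    · simp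

/-! ### Combinatorics of a mesh -/

namespace Mesh

variable {M : Mesh d} {T F G s t : Finset (E d)} {x : E d}

lemma mem_cells : T ∈ M.cells ↔ T ∈ M.complex.faces ∧ T.card = d + 1 := by
  simp [cells]

lemma mem_sides : F ∈ M.sides ↔ F ∈ M.complex.faces ∧ F.card = d := by
  simp [sides]

lemma mem_sidesOf : F ∈ M.sidesOf T ↔ F ∈ M.sides ∧ F ⊆ T := by
  simp [sidesOf]

lemma isCell (hT : T ∈ M.cells) : IsCell T :=
  ⟨(mem_cells.1 hT).2, M.complex.indep (mem_cells.1 hT).1⟩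

lemma cell_nonempty (hT : T ∈ M.cells) : T.Nonempty :=
  M.complex.nonempty_of_mem_faces (mem_cells.1 hT).1

lemma side_nonempty (hF : F ∈ M.sides) : F.Nonempty :=
  M.complex.nonempty_of_mem_faces (mem_sides.1 hF).1

lemma exists_cell (hF : F ∈ M.sides) : ∃ T ∈ M.cells, F ⊆ T := by
  obtain ⟨T, hT, hFT, hc⟩ := M.pure F (mem_sides.1 hF).1
  exact ⟨T, mem_cells.2 ⟨hT, hc⟩, hFT⟩

/-- This is the form in which conformity of the mesh is used: simplices meet only in the face
spanned by their common vertices. -/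
lemma mem_hull_inter (hs : s ∈ M.complex.faces) (ht : t ∈ M.complex.faces) (hxs : x ∈ hull s)
    (hxt : x ∈ hull t) : x ∈ hull (s ∩ t) := by
  have := M.complex.inter_subset_convexHull hs ht ⟨hxs, hxt⟩
  rwa [← Finset.coe_inter] at this

lemma erase_mem_sidesOf (hd : 1 ≤ d) (hT : T ∈ M.cells) {v : E d} (hv : v ∈ T) :
    T.erase v ∈ M.sidesOf T := by
  have hc : (T.erase v).card = d := by
    rw [Finset.card_erase_of_mem hv, (mem_cells.1 hT).2]; rfl
  refine mem_sidesOf.2 ⟨mem_sides.2 ⟨M.complex.down_closed (mem_cells.1 hT).1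
    (Finset.erase_subset v T) ?_, hc⟩, Finset.erase_subset v T⟩
  rw [← Finset.card_pos]; omega

/-- A face whose relative interior meets the simplex `t` is a face of `t`. -/
lemma subset_of_relint (hT : T ∈ M.cells) (hs : s ∈ M.complex.faces) (hsT : s ⊆ T)
    (ht : t ∈ M.complex.faces) (hxs : x ∈ hull s) (hpos : ∀ v ∈ s, 0 < bc T v x)
    (hxt : x ∈ hull t) : s ⊆ t := by
  intro v hv
  by_contra hvt
  have h := (((isCell hT).mem_hull (Finset.inter_subset_left.trans hsT)).1
    (mem_hull_inter hs ht hxs hxt)).2 v (hsT hv) (by simp [hvt])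
  exact (hpos v hv).ne' h

lemma subset_of_mem_interior (hT : T ∈ M.cells) (ht : t ∈ M.complex.faces)
    (hx : x ∈ interior (hull T)) (hxt : x ∈ hull t) : T ⊆ t :=
  subset_of_relint hT (mem_cells.1 hT).1 subset_rfl ht (interior_subset hx)
    ((isCell hT).mem_interior.1 hx) hxt

lemma eq_of_mem_interior {T' : Finset (E d)} (hT : T ∈ M.cells) (hT' : T' ∈ M.cells)
    (hx : x ∈ interior (hull T)) (hxt : x ∈ hull T') : T = T' :=
  Finset.eq_of_subset_of_card_le (subset_of_mem_interior hT (mem_cells.1 hT').1 hx hxt)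
    (by rw [(mem_cells.1 hT).2, (mem_cells.1 hT').2])

/-- A point of a cell that lies on some face of the mesh not containing the whole cell lies on a
face of this cell. -/
lemma exists_sideOf_of_ne (hd : 1 ≤ d) (hT : T ∈ M.cells) (ht : t ∈ M.complex.faces)
    (hTt : ¬ T ⊆ t) (hxT : x ∈ hull T) (hxt : x ∈ hull t) :
    ∃ F ∈ M.sidesOf T, x ∈ hull F := by
  obtain ⟨v, hv, hvt⟩ := Finset.not_subset.1 hTt
  refine ⟨T.erase v, erase_mem_sidesOf hd hT hv, hull_mono ?_
    (mem_hull_inter (mem_cells.1 hT).1 ht hxT hxt)⟩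
  intro w hw
  rw [Finset.mem_inter] at hw
  exact Finset.mem_erase.2 ⟨fun h => hvt (h ▸ hw.2), hw.1⟩

lemma not_cell_subset_side (hT : T ∈ M.cells) (hG : G ∈ M.sides) : ¬ T ⊆ G := fun h => by
  have := Finset.card_le_card h
  rw [(mem_cells.1 hT).2, (mem_sides.1 hG).2] at this
  omega

/-- Ensures that the cellwise mean is taken over a nonempty set: a cell that meets the skeleton at
`x` has a face of its own through `x`. -/
lemma exists_sideOf (hd : 1 ≤ d) (hT : T ∈ M.cells) (hG : G ∈ M.sides)
    (hxT : x ∈ hull T) (hxG : x ∈ hull G) : ∃ F ∈ M.sidesOf T, x ∈ hull F :=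
  exists_sideOf_of_ne hd hT (mem_sides.1 hG).1 (not_cell_subset_side hT hG) hxT hxG

lemma exists_interior_point (hT : T ∈ M.cells) : ∃ x, x ∈ interior (hull T) := by
  refine ⟨barycenter T, (isCell hT).mem_interior.2 fun v hv => ?_⟩
  have hne := cell_nonempty hT
  rw [affine_barycenter hne, Finset.sum_eq_single v (fun w hw h => (isCell hT).bc_ne hv hw h)
    (fun h => absurd hv h), (isCell hT).bc_self hv]
  have : 0 < T.card := hne.card_pos
  positivity

/-- The vertex of a cell opposite to one of its faces. -/
lemma exists_apex (hT : T ∈ M.cells) (hG : G ∈ M.sides) (hGT : G ⊆ T) :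
    ∃ a ∈ T, a ∉ G ∧ T = insert a G := by
  have hc : (T \ G).card = 1 := by
    rw [Finset.card_sdiff_of_subset hGT, (mem_cells.1 hT).2, (mem_sides.1 hG).2]; omega
  obtain ⟨a, ha⟩ := Finset.card_eq_one.1 hc
  have haT : a ∈ T \ G := ha ▸ Finset.mem_singleton_self a
  rw [Finset.mem_sdiff] at haT
  refine ⟨a, haT.1, haT.2, ?_⟩
  rw [← Finset.union_sdiff_of_subset hGT, ha, Finset.union_comm]; rfl

end Mesh

/-! ### Position of faces relative to a cell -/

lemma barycenter_bc_pos {M : Mesh d} {T G : Finset (E d)} (hT : T ∈ M.cells)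
    (hGT : G ⊆ T) (hne : G.Nonempty) : ∀ v ∈ G, 0 < bc T v (barycenter G) := by
  intro v hv
  rw [affine_barycenter hne, Finset.sum_eq_single v
    (fun w hw h => (Mesh.isCell hT).bc_ne (hGT hv) (hGT hw) h) (fun h => absurd hv h),
    (Mesh.isCell hT).bc_self (hGT hv)]
  have : 0 < G.card := hne.card_pos
  positivity

/-- A simplex of dimension `d - 1` cannot be contained in one of dimension `d - 2`. -/
lemma not_hull_subset_of_card_lt {s t : Finset (E d)}
    (hs : AffineIndependent ℝ ((↑) : s → E d)) (hc : t.card < s.card) : ¬ hull s ⊆ hull t := by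
  intro h
  -- A simplex and its vertex set have the same affine span, and `t` has too few points to span the
  -- independent vertices of `s`.
  have h1 : affineSpan ℝ (s : Set (E d)) ≤ affineSpan ℝ (t : Set (E d)) := by
    rw [← affineSpan_convexHull (s : Set (E d)), ← affineSpan_convexHull (t : Set (E d))]
    exact affineSpan_mono ℝ h
  have := hs.card_le_card_of_subset_affineSpan
    (s := s) (t := t) (fun v hv => h1 (subset_affineSpan ℝ _ hv))
  omega

/-- A point of the fine face `F` which is in the relative interior of the coarse face `G`. -/
lemma barycenter_relint {M M' : Mesh d} {T F G : Finset (E d)} (hT : T ∈ M.cells)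
    (hG : G ∈ M.sides) (hGT : G ⊆ T) (hF : F ∈ M'.sides) (hFG : hull F ⊆ hull G) :
    ∀ v ∈ G, 0 < bc T v (barycenter F) := by
  intro v hv
  have hc := Mesh.isCell hT
  have hne := Mesh.side_nonempty hF
  have h0 : ∀ x ∈ hull F, 0 ≤ bc T v x := fun x hx =>
    ((hc.mem_hull hGT).1 (hFG hx)).1 v (hGT hv)
  refine lt_of_le_of_ne (h0 _ (barycenter_mem hne)) fun h => ?_
  -- If the coordinate of `v` vanished at the barycenter of `F`, it would vanish on all of `F`, and
  -- `F` would fit into the lower dimensional simplex `G.erase v`.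
  have hz := affine_eq_zero_of_barycenter hne _ (fun w hw => h0 w (vertex_mem_hull hw)) h.symm
  refine not_hull_subset_of_card_lt (t := G.erase v) (M'.complex.indep (Mesh.mem_sides.1 hF).1) ?_ ?_
  · rw [(Mesh.mem_sides.1 hF).2, Finset.card_erase_of_mem hv, (Mesh.mem_sides.1 hG).2]
    have : 0 < G.card := Finset.card_pos.2 ⟨v, hv⟩
    rw [(Mesh.mem_sides.1 hG).2] at this
    omega
  · refine hull_subset_of_vertices (hull_convex _) fun w hw => ?_
    have hwG := (hc.mem_hull hGT).1 (hFG (vertex_mem_hull hw))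
    refine (hc.mem_hull ((Finset.erase_subset _ _).trans hGT)).2 ⟨hwG.1, fun u hu huG => ?_⟩
    by_cases huv : u = v
    · subst huv; exact hz w hw
    · exact hwG.2 u hu fun h => huG (Finset.mem_erase.2 ⟨huv, h⟩)

/-- Every point of a face is a limit of relatively interior points. -/
lemma relint_dense {M : Mesh d} {T G : Finset (E d)} {x : E d} (hT : T ∈ M.cells) (hG : G ∈ M.sides) (hGT : G ⊆ T) (hx : x ∈ hull G)
    {ε : ℝ} (h0 : 0 < ε) (h1 : ε ≤ 1) :
    AffineMap.lineMap x (barycenter G) ε ∈ hull G ∧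
      ∀ v ∈ G, 0 < bc T v (AffineMap.lineMap x (barycenter G) ε) := by
  refine ⟨(hull_convex G).lineMap_mem hx (barycenter_mem (Mesh.side_nonempty hG)) ⟨h0.le, h1⟩,
    fun v hv => ?_⟩
  rw [AffineMap.apply_lineMap, AffineMap.lineMap_apply_module]
  have hb := barycenter_bc_pos hT hGT (Mesh.side_nonempty hG) v hv
  have hx0 := (((Mesh.isCell hT).mem_hull hGT).1 hx).1 v (hGT hv)
  simp only [smul_eq_mul]
  have : 0 ≤ 1 - ε := by linarith
  positivity

/-! ### Two successive meshes of a hierarchy -/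

/-- `M` is a mesh of the open set `Ω`, and `Ω = int Ω̄`. -/
structure Covers (Ω : Set (E d)) (M : Mesh d) : Prop where
  isOpen : IsOpen Ω
  interior_closure : interior (closure Ω) = Ω
  cover : (⋃ T ∈ M.cells, hull T) = closure Ω

lemma IsMeshHierarchy.covers {Ω : Set (E d)} {L : ℕ} {M : ℕ → Mesh d} {ρ κ c : ℝ}
    (h : IsMeshHierarchy Ω L M ρ κ c) {ℓ : ℕ} (hℓ : ℓ ≤ L) : Covers Ω (M ℓ) :=
  ⟨h.isOpen, h.interior_closure, h.cover ℓ hℓ⟩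

/-- Every fine cell is part of a coarse cell. -/
def Refines (M M' : Mesh d) : Prop := ∀ K ∈ M'.cells, ∃ T ∈ M.cells, hull K ⊆ hull T

/-- An interior point of `K` lies in some coarse cell, because both meshes cover `closure Ω`. That
coarse cell is a union of fine cells inside it, and the only fine cell containing the point is `K`.
-/
lemma IsMeshHierarchy.refines' {Ω : Set (E d)} {L : ℕ} {M : ℕ → Mesh d} {ρ κ c : ℝ}
    (h : IsMeshHierarchy Ω L M ρ κ c) {ℓ : ℕ} (hℓ : ℓ < L) : Refines (M ℓ) (M (ℓ + 1)) := by
  intro K hK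
  obtain ⟨x, hx⟩ := Mesh.exists_interior_point hK
  have hx1 : x ∈ ⋃ T ∈ (M (ℓ + 1)).cells, hull T :=
    Set.mem_biUnion (by exact_mod_cast hK) (interior_subset hx)
  rw [h.cover (ℓ + 1) hℓ, ← h.cover ℓ hℓ.le] at hx1
  obtain ⟨T, hT, hxT⟩ := Set.mem_iUnion₂.1 hx1
  rw [h.refines ℓ hℓ T hT] at hxT
  obtain ⟨K', hK', hxK'⟩ := Set.mem_iUnion₂.1 hxT
  rw [Finset.mem_filter] at hK'
  have := Mesh.eq_of_mem_interior hK hK'.1 hx hxK'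
  subst this
  exact ⟨T, hT, hK'.2⟩

/-! ### Boundary faces: the faces with exactly one adjacent cell. -/

namespace Covers

variable {Ω : Set (E d)} {M : Mesh d} (h : Covers Ω M) {T F G : Finset (E d)} {x : E d}
include h

lemma hull_subset_closure (hT : T ∈ M.cells) : hull T ⊆ closure Ω := by
  rw [← h.cover]; exact Set.subset_biUnion_of_mem (u := fun T => hull T) (by exact_mod_cast hT)

lemma interior_subset (hT : T ∈ M.cells) : interior (hull T) ⊆ Ω := by
  rw [← h.interior_closure]; exact interior_mono (h.hull_subset_closure hT)

lemma not_mem_interior_of_frontier (hT : T ∈ M.cells) (hx : x ∈ frontier Ω) :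
    x ∉ interior (hull T) := fun hi => by
  rw [h.isOpen.frontier_eq] at hx
  exact hx.2 (h.interior_subset hT hi)

/-- Near a point `x`, only the cells containing `x` matter. -/
lemma eventually_mem_cell (x : E d) :
    ∀ᶠ z in 𝓝 x, z ∈ closure Ω → ∃ T ∈ M.cells, x ∈ hull T ∧ z ∈ hull T := by
  have h1 : ∀ T ∈ M.cells, ∀ᶠ z in 𝓝 x, x ∉ hull T → z ∉ hull T := by
    intro T _
    by_cases hx : x ∈ hull T
    · exact Eventually.of_forall fun z hz => absurd hx hz
    · filter_upwards [(hull_isClosed T).isOpen_compl.mem_nhds hx] with z hz _ using hz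
  have h2 := (Filter.eventually_all_finset M.cells).2 h1
  filter_upwards [h2] with z hz hzΩ
  rw [← h.cover] at hzΩ
  obtain ⟨T, hT, hzT⟩ := Set.mem_iUnion₂.1 hzΩ
  refine ⟨T, hT, ?_, hzT⟩
  by_contra hx
  exact hz T hT hx hzT

/-- If two cells share the face `G`, then the relative interior of `G` is in `Ω`. -/
lemma mem_of_two_cells {T₁ T₂ : Finset (E d)} (h₁ : T₁ ∈ M.cells) (h₂ : T₂ ∈ M.cells)
    (hne : T₁ ≠ T₂) (hG : G ∈ M.sides) (hG₁ : G ⊆ T₁) (hG₂ : G ⊆ T₂) (hx : x ∈ hull G)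
    (hpos : ∀ v ∈ G, 0 < bc T₁ v x) : x ∈ Ω := by
  have c₁ := Mesh.isCell h₁
  have c₂ := Mesh.isCell h₂
  obtain ⟨a₁, ha₁, haG₁, e₁⟩ := Mesh.exists_apex h₁ hG hG₁
  obtain ⟨a₂, ha₂, haG₂, e₂⟩ := Mesh.exists_apex h₂ hG hG₂
  have hx₁ := (c₁.mem_hull hG₁).1 hx
  have hx₂ := (c₂.mem_hull hG₂).1 hx
  -- both apex coordinates vanish on `G`
  have key : ∀ z, bc T₁ a₁ z = bc T₂ a₂ z * bc T₁ a₁ a₂ := by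
    intro z
    rw [c₂.affine_eq (bc T₁ a₁) z, Finset.sum_eq_single a₂]
    · intro w hw hwne
      have hwG : w ∈ G := by
        rw [e₂, Finset.mem_insert] at hw; exact hw.resolve_left hwne
      rw [c₁.bc_ne ha₁ (hG₁ hwG) (fun h => haG₁ (h ▸ hwG)), mul_zero]
    · exact fun h => absurd ha₂ h
  -- The apexes lie on opposite sides of the hyperplane of `G`. The factor cannot be zero, by
  -- evaluation at `a₁`; if it were positive, a short step from `x` towards `a₂` would reach the
  -- interior of `T₁` inside `T₂`.
  have hneg : bc T₁ a₁ a₂ < 0 := by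
    rcases lt_trichotomy (bc T₁ a₁ a₂) 0 with hlt | h0 | hgt
    · exact hlt
    · exfalso
      have := key a₁
      rw [h0, mul_zero, c₁.bc_self ha₁] at this
      exact one_ne_zero this
    · exfalso
      have hev : ∀ᶠ ε : ℝ in 𝓝[>] 0, ∀ v ∈ G, 0 < bc T₁ v (AffineMap.lineMap x a₂ ε) := by
        refine (Filter.eventually_all_finset G).2 fun v hv => ?_
        have hcont : ContinuousAt (fun ε : ℝ => bc T₁ v (AffineMap.lineMap x a₂ ε)) 0 := by
          have := (AffineMap.continuous_of_finiteDimensional (bc T₁ v)).comp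
            (AffineMap.lineMap_continuous (R := ℝ) (p := x) (q := a₂))
          exact this.continuousAt
        have h0 : 0 < bc T₁ v (AffineMap.lineMap x a₂ (0 : ℝ)) := by simpa using hpos v hv
        exact (hcont.eventually (lt_mem_nhds h0)).filter_mono nhdsWithin_le_nhds
      obtain ⟨ε, hε, hε0, hε1⟩ := (hev.and (Ioc_mem_nhdsGT (zero_lt_one' ℝ))).exists
      set z := AffineMap.lineMap x a₂ ε with hz
      have hz1 : z ∈ interior (hull T₁) := by
        refine c₁.mem_interior.2 fun v hv => ?_
        rw [e₁, Finset.mem_insert] at hv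
        rcases hv with rfl | hv
        · rw [hz, AffineMap.apply_lineMap, AffineMap.lineMap_apply_module, hx₁.2 v ha₁ haG₁]
          simp only [smul_eq_mul, mul_zero, zero_add]
          positivity
        · exact hε v hv
      have hz2 : z ∈ hull T₂ :=
        (hull_convex T₂).lineMap_mem (hull_mono hG₂ hx) (vertex_mem_hull ha₂) ⟨hε0.le, hε1⟩
      exact hne (Mesh.eq_of_mem_interior h₁ h₂ hz1 hz2)
  have hpos₂ : ∀ v ∈ G, 0 < bc T₂ v x := by
    intro v hv
    rw [← c₂.bary_eq hG₂ hx hv, c₁.bary_eq hG₁ hx hv]; exact hpos v hv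
  have hc : ∀ T : Finset (E d), (∀ v ∈ G, 0 < bc T v x) → ∀ᶠ z in 𝓝 x, ∀ v ∈ G, 0 < bc T v z := by
    intro T hT
    refine (Filter.eventually_all_finset G).2 fun v hv => ?_
    exact (AffineMap.continuous_of_finiteDimensional (bc T v)).continuousAt.eventually
      (lt_mem_nhds (hT v hv))
  -- Since `Ω = int Ω̄`, it suffices that nearby points lie in `T₁` or `T₂`; the sign of the
  -- coordinate of `a₁` decides which.
  rw [← h.interior_closure, mem_interior_iff_mem_nhds]
  filter_upwards [hc T₁ hpos, hc T₂ hpos₂] with z hz₁ hz₂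
  by_cases hza : 0 ≤ bc T₁ a₁ z
  · refine h.hull_subset_closure h₁ (c₁.mem_hull_self.2 fun v hv => ?_)
    rw [e₁, Finset.mem_insert] at hv
    rcases hv with rfl | hv
    · exact hza
    · exact (hz₁ v hv).le
  · refine h.hull_subset_closure h₂ (c₂.mem_hull_self.2 fun v hv => ?_)
    rw [e₂, Finset.mem_insert] at hv
    rcases hv with rfl | hv
    · have := key z
      push Not at hza
      nlinarith
    · exact (hz₂ v hv).le

/-- A face with a relatively interior point on the boundary of `Ω` belongs to a single cell. -/
lemma unique_cell (hT : T ∈ M.cells) (hG : G ∈ M.sides) (hGT : G ⊆ T) (hx : x ∈ hull G)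
    (hpos : ∀ v ∈ G, 0 < bc T v x) (hfr : x ∈ frontier Ω) :
    ∀ T' ∈ M.cells, G ⊆ T' → T' = T := by
  intro T' hT' hG'
  by_contra hne
  rw [h.isOpen.frontier_eq] at hfr
  exact hfr.2 (h.mem_of_two_cells hT hT' (Ne.symm hne) hG hGT hG' hx hpos)

/-- Near a relatively interior point of a face belonging to the cell `T` only, the closure of `Ω`
is part of `T`. -/
lemma eventually_mem_of_unique (hT : T ∈ M.cells) (hG : G ∈ M.sides) (hGT : G ⊆ T)
    (hu : ∀ T' ∈ M.cells, G ⊆ T' → T' = T) (hx : x ∈ hull G) (hpos : ∀ v ∈ G, 0 < bc T v x) :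
    ∀ᶠ z in 𝓝 x, z ∈ closure Ω → z ∈ hull T := by
  filter_upwards [h.eventually_mem_cell x] with z hz hzΩ
  obtain ⟨T', hT', hxT', hzT'⟩ := hz hzΩ
  have := hu T' hT' (Mesh.subset_of_relint hT (Mesh.mem_sides.1 hG).1 hGT (Mesh.mem_cells.1 hT').1
    hx hpos hxT')
  exact this ▸ hzT'

/-- If `x` were in `Ω`, the single cell `T` would be a neighbourhood of `x`; but the coordinate of
the opposite vertex is zero at `x`. -/
lemma mem_frontier_of_unique (hT : T ∈ M.cells) (hG : G ∈ M.sides) (hGT : G ⊆ T)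
    (hu : ∀ T' ∈ M.cells, G ⊆ T' → T' = T) (hx : x ∈ hull G) (hpos : ∀ v ∈ G, 0 < bc T v x) :
    x ∈ frontier Ω := by
  rw [h.isOpen.frontier_eq]
  refine ⟨h.hull_subset_closure hT (hull_mono hGT hx), fun hxΩ => ?_⟩
  have h1 : hull T ∈ 𝓝 x := by
    filter_upwards [h.eventually_mem_of_unique hT hG hGT hu hx hpos, h.isOpen.mem_nhds hxΩ] with
      z hz hzΩ using hz (subset_closure hzΩ)
  obtain ⟨a, haT, haG, -⟩ := Mesh.exists_apex hT hG hGT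
  have h2 := (Mesh.isCell hT).mem_interior.1 (mem_interior_iff_mem_nhds.2 h1) a haT
  exact h2.ne' (((Mesh.isCell hT).mem_hull hGT).1 hx |>.2 a haT haG)

/-- Having a single adjacent cell is a property of the face, not of the point. So one relatively
interior boundary point makes all of them boundary points, and the rest of the face follows by
closedness. -/
lemma subset_frontier_of_relint (hT : T ∈ M.cells) (hG : G ∈ M.sides) (hGT : G ⊆ T)
    (hx : x ∈ hull G) (hpos : ∀ v ∈ G, 0 < bc T v x) (hfr : x ∈ frontier Ω) :
    hull G ⊆ frontier Ω := by
  have hu := h.unique_cell hT hG hGT hx hpos hfr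
  intro y hy
  have hcont : Tendsto (fun ε : ℝ => AffineMap.lineMap y (barycenter G) ε) (𝓝[>] 0) (𝓝 y) := by
    have := (AffineMap.lineMap_continuous (R := ℝ) (p := y) (q := barycenter G)).tendsto 0
    rw [AffineMap.lineMap_apply_zero] at this
    exact this.mono_left nhdsWithin_le_nhds
  refine isClosed_frontier.mem_of_tendsto hcont ?_
  filter_upwards [Ioc_mem_nhdsGT (zero_lt_one' ℝ)] with ε hε
  obtain ⟨h1, h2⟩ := relint_dense hT hG hGT hy hε.1 hε.2
  exact h.mem_frontier_of_unique hT hG hGT hu h1 h2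

/-- A coarse face containing a fine face in the boundary of `Ω` is in the boundary of `Ω`. -/
lemma coarse_side_subset_frontier {M' : Mesh d} (hG : G ∈ M.sides) (hF : F ∈ M'.sides)
    (hFG : hull F ⊆ hull G) (hfr : hull F ⊆ frontier Ω) : hull G ⊆ frontier Ω := by
  obtain ⟨T, hT, hGT⟩ := Mesh.exists_cell hG
  have hb := barycenter_mem (Mesh.side_nonempty hF)
  exact h.subset_frontier_of_relint hT hG hGT (hFG hb) (barycenter_relint hT hG hGT hF hFG) (hfr hb)

/-- A fine face in the boundary of `Ω` is part of a coarse face. -/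
lemma exists_coarse_side (hd : 1 ≤ d) {M' : Mesh d} (hM : Refines M M') (hF : F ∈ M'.sides)
    (hfr : hull F ⊆ frontier Ω) : ∃ G ∈ M.sides, hull F ⊆ hull G := by
  obtain ⟨K, hK, hFK⟩ := Mesh.exists_cell hF
  obtain ⟨T, hT, hKT⟩ := hM K hK
  have hc := Mesh.isCell hT
  have hne := Mesh.side_nonempty hF
  have hFT : hull F ⊆ hull T := (hull_mono hFK).trans hKT
  have hb := barycenter_mem hne
  -- The barycenter of `F` is not interior to `T`, so some coordinate of `T` vanishes there and
  -- hence on all of `F`: `F` lies in the face opposite to `v`.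
  have hni := h.not_mem_interior_of_frontier hT (hfr hb)
  rw [hc.mem_interior] at hni
  push Not at hni
  obtain ⟨v, hv, hv0⟩ := hni
  have hnn : ∀ w ∈ F, 0 ≤ bc T v w := fun w hw =>
    hc.mem_hull_self.1 (hFT (vertex_mem_hull hw)) v hv
  have hz := affine_eq_zero_of_barycenter hne _ hnn
    (le_antisymm hv0 (hc.mem_hull_self.1 (hFT hb) v hv))
  refine ⟨T.erase v, (Mesh.mem_sidesOf.1 (Mesh.erase_mem_sidesOf hd hT hv)).1,
    hull_subset_of_vertices (hull_convex _) fun w hw => ?_⟩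
  refine (hc.mem_hull (Finset.erase_subset _ _)).2
    ⟨hc.mem_hull_self.1 (hFT (vertex_mem_hull hw)), fun u hu hue => ?_⟩
  have : u = v := by
    by_contra hne'
    exact hue (Finset.mem_erase.2 ⟨hne', hu⟩)
  subst this
  exact hz w hw

end Covers

lemma parentSide_spec {M : Mesh d} {F : Finset (E d)} (h : IsOld M F) :
    parentSide M F ∈ M.sides ∧ hull F ⊆ hull (parentSide M F) := Classical.epsilon_spec h

lemma parentCell_spec {M M' : Mesh d} (hM : Refines M M') {F : Finset (E d)} (hF : F ∈ M'.sides) :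
    parentCell M F ∈ M.cells ∧ hull F ⊆ hull (parentCell M F) := by
  obtain ⟨K, hK, hFK⟩ := Mesh.exists_cell hF
  obtain ⟨T, hT, hKT⟩ := hM K hK
  exact Classical.epsilon_spec (p := fun T => T ∈ M.cells ∧ hull F ⊆ hull T)
    ⟨T, hT, (hull_mono hFK).trans hKT⟩

/-! ### Lagrange interpolation -/

/-- Interpolation sums run over functions, whereas the coefficient formula for products of power
series and the count of multi-indices use finitely supported functions. -/
lemma sum_piAntidiag {α ι : Type*} [DecidableEq ι] [AddCommMonoid α] (s : Finset ι) (n : ℕ) (f : (ι → ℕ) → α) :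
    ∑ k ∈ s.piAntidiag n, f k = ∑ k ∈ s.finsuppAntidiag n, f k := by
  symm
  refine Finset.sum_bij (fun k _ => (k : ι → ℕ)) ?_ ?_ ?_ (fun _ _ => rfl)
  · intro k hk
    rw [Finset.mem_finsuppAntidiag] at hk
    rw [Finset.mem_piAntidiag]
    exact ⟨hk.1, fun i hi => hk.2 (Finsupp.mem_support_iff.2 hi)⟩
  · intro a _ b _ h
    exact DFunLike.coe_injective h
  · intro k hk
    rw [Finset.mem_piAntidiag] at hk
    refine ⟨Finsupp.onFinset s k hk.2, ?_, rfl⟩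
    rw [Finset.mem_finsuppAntidiag]
    exact ⟨hk.1, Finsupp.support_onFinset_subset⟩

lemma card_piAntidiag_le {ι : Type*} [DecidableEq ι] (s : Finset ι) (n : ℕ) :
    (s.piAntidiag n).card ≤ (s.card + n).choose n := by
  have h := sum_piAntidiag s n (fun _ => 1)
  rw [← Finset.card_eq_sum_ones, ← Finset.card_eq_sum_ones] at h
  rw [h, Finset.card_finsuppAntidiag_nat_eq_choose]
  exact Nat.choose_le_choose _ (Nat.sub_le _ _)

/-! ### Generalized binomial coefficients and a weighted Vandermonde identity. -/

/-- The binomial coefficient of a real number. -/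
def binom (x : ℝ) (k : ℕ) : ℝ := ∏ j ∈ Finset.range k, (x - j) / (j + 1)

lemma factorial_mul_binom (x : ℝ) (k : ℕ) :
    (k.factorial : ℝ) * binom x k = ∏ j ∈ Finset.range k, (x - j) := by
  induction k with
  | zero => simp [binom]
  | succ k ih =>
    rw [Finset.prod_range_succ, ← ih, binom, Finset.prod_range_succ, Nat.factorial_succ, ← binom]
    push_cast
    field_simp

lemma binom_eq_choose (x : ℝ) (k : ℕ) : binom x k = Ring.choose x k := by
  have h1 := factorial_mul_binom x
  have h2 := Ring.descPochhammer_eq_factorial_smul_choose x k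
  have h3 : (descPochhammer ℤ k).smeval x = ∏ j ∈ Finset.range k, (x - j) := by
    clear h1 h2
    induction k with
    | zero => simp
    | succ k ih =>
      rw [Finset.prod_range_succ, ← ih, descPochhammer_succ_right]
      simp [Polynomial.smeval_mul, Polynomial.smeval_sub, Polynomial.smeval_natCast]
  rw [h3, ← h1, nsmul_eq_mul] at h2
  exact mul_left_cancel₀ (by positivity) h2

/-- The absorption identity. It turns the weight `k u` in `sum_mul_prod_binom` into a shift of the
generating function. -/
lemma succ_mul_binom (x : ℝ) (k : ℕ) : ((k + 1 : ℕ) : ℝ) * binom x (k + 1) = x * binom (x - 1) k := by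
  have h := factorial_mul_binom
  have h1 := h x (k + 1)
  rw [Finset.prod_range_succ'] at h1
  have h2 := h (x - 1) k
  have h3 : ∏ j ∈ Finset.range k, (x - ((j + 1 : ℕ) : ℝ)) = ∏ j ∈ Finset.range k, (x - 1 - j) :=
    Finset.prod_congr rfl fun j _ => by push_cast; ring
  rw [h3, ← h2, Nat.factorial_succ] at h1
  have h4 : (k.factorial : ℝ) ≠ 0 := by positivity
  apply mul_left_cancel₀ h4
  push_cast at h1 ⊢
  linarith

open PowerSeries in
lemma sum_piAntidiag_prod {ι : Type*} [DecidableEq ι] (s : Finset ι) (n : ℕ) (g : ι → ℕ → ℝ) :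
    ∑ k ∈ s.piAntidiag n, ∏ v ∈ s, g v (k v) = coeff n (∏ v ∈ s, PowerSeries.mk (g v)) := by
  rw [sum_piAntidiag s n (fun k => ∏ v ∈ s, g v (k v)), PowerSeries.coeff_prod]
  simp

open PowerSeries in
lemma mk_binom (x : ℝ) : PowerSeries.mk (binom x) = PowerSeries.binomialSeries ℝ x := by
  ext n; simp [binom_eq_choose]

open PowerSeries in
lemma prod_binomialSeries {ι : Type*} [DecidableEq ι] (s : Finset ι) (x : ι → ℝ) :
    ∏ v ∈ s, PowerSeries.binomialSeries ℝ (x v) = PowerSeries.binomialSeries ℝ (∑ v ∈ s, x v) := by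
  induction s using Finset.induction_on with
  | empty => simp
  | insert a s ha ih => rw [Finset.prod_insert ha, Finset.sum_insert ha, PowerSeries.binomialSeries_add, ih]

lemma binom_natCast_self (n : ℕ) : binom n n = 1 := by
  rw [binom_eq_choose, Ring.choose_natCast, Nat.choose_self, Nat.cast_one]

-- Generating functions: the factor of `u` is `x u * X * (1 + X)^(x u - 1)`, the other factors are
-- `(1 + X)^(x v)`. The product is `x u * X * (1 + X)^(n - 1)`, whose coefficient at `X^n` is `x u`.
open PowerSeries in
lemma sum_mul_prod_binom {ι : Type*} [DecidableEq ι] (s : Finset ι) {n : ℕ} (hn : 1 ≤ n) (x : ι → ℝ)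
    (hx : ∑ v ∈ s, x v = n) {u : ι} (hu : u ∈ s) :
    ∑ k ∈ s.piAntidiag n, (k u : ℝ) * ∏ v ∈ s, binom (x v) (k v) = x u := by
  obtain ⟨m, rfl⟩ : ∃ m, n = m + 1 := ⟨n - 1, by omega⟩
  have h1 : ∀ k ∈ s.piAntidiag (m + 1), (k u : ℝ) * ∏ v ∈ s, binom (x v) (k v) =
      ∏ v ∈ s, (fun (v : ι) (j : ℕ) => (if v = u then (j : ℝ) else 1) * binom (x v) j) v (k v) := by
    intro k _
    rw [Finset.prod_mul_distrib, Finset.prod_ite_eq' s u, if_pos hu]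
  rw [Finset.sum_congr rfl h1, sum_piAntidiag_prod s (m + 1)
    (fun (v : ι) (j : ℕ) => (if v = u then (j : ℝ) else 1) * binom (x v) j)]
  have h2 : ∀ v ∈ s.erase u, PowerSeries.mk ((fun (v : ι) (j : ℕ) =>
      (if v = u then (j : ℝ) else 1) * binom (x v) j) v) = PowerSeries.binomialSeries ℝ (x v) := by
    intro v hv
    rw [← mk_binom]
    ext j
    simp [(Finset.mem_erase.1 hv).1]
  have h3 : PowerSeries.mk ((fun (v : ι) (j : ℕ) =>
      (if v = u then (j : ℝ) else 1) * binom (x v) j) u) =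
      C (x u) * (X * PowerSeries.binomialSeries ℝ (x u - 1)) := by
    rw [← mk_binom]
    ext j
    rw [coeff_C_mul, coeff_mk]
    cases j with
    | zero => simp
    | succ j => 
      rw [coeff_succ_X_mul, coeff_mk, ← succ_mul_binom]
      simp
  rw [← Finset.mul_prod_erase s _ hu, h3, Finset.prod_congr rfl h2, prod_binomialSeries, mul_assoc,
    mul_assoc, coeff_C_mul, coeff_succ_X_mul, ← PowerSeries.binomialSeries_add]
  have h4 : x u - 1 + ∑ v ∈ s.erase u, x v = m := by
    have := Finset.add_sum_erase s x hu
    rw [hx] at this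
    push_cast at this
    linarith
  rw [h4, ← mk_binom, coeff_mk, binom_natCast_self, mul_one]

lemma lagrangeBasis_eq (s : Finset (E d)) (p : ℕ) (k : E d → ℕ) (x : E d) :
    lagrangeBasis s p k x = ∏ v ∈ s, binom (p * bary s x v) (k v) := rfl

lemma node_mem_hull {s : Finset (E d)} {p : ℕ} (hp : 1 ≤ p) {k : E d → ℕ}
    (hk : k ∈ s.piAntidiag p) : node s p k ∈ hull s := by
  rw [Finset.mem_piAntidiag] at hk
  rw [hull, Finset.mem_convexHull']
  refine ⟨fun v => (k v : ℝ) / p, fun _ _ => by positivity, ?_, rfl⟩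
  rw [← Finset.sum_div, div_eq_one_iff_eq (by positivity)]
  exact_mod_cast hk.1

lemma interp_congr {s : Finset (E d)} {p : ℕ} {x : E d} (hp : 1 ≤ p) {f g : E d → ℝ} (h : ∀ y ∈ hull s, f y = g y) :
    interp s p f x = interp s p g x :=
  Finset.sum_congr rfl fun k hk => by rw [h _ (node_mem_hull hp hk)]

namespace IsCell

variable {T s : Finset (E d)} (hT : IsCell T) (hs : s ⊆ T) {p : ℕ} {x : E d}
include hT hs

lemma sum_bary (hx : x ∈ hull s) : ∑ v ∈ s, bary s x v = 1 := by
  rw [Finset.sum_congr rfl fun v hv => hT.bary_eq hs hx hv]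
  exact hT.sum_bc_face hs ((hT.mem_hull hs).1 hx).2

lemma sum_bary_mul (hx : x ∈ hull s) (f : E d →ᵃ[ℝ] ℝ) : ∑ v ∈ s, bary s x v * f v = f x := by
  rw [← affine_comb f s _ (hT.sum_bary hs hx),
    Finset.sum_congr rfl fun v hv => by rw [hT.bary_eq hs hx hv],
    hT.sum_bc_smul_face hs ((hT.mem_hull hs).1 hx).2]

lemma bary_nonneg (hx : x ∈ hull s) {v : E d} (hv : v ∈ s) : 0 ≤ bary s x v := by
  rw [hT.bary_eq hs hx hv]; exact ((hT.mem_hull hs).1 hx).1 v (hs hv)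

lemma bary_le_one (hx : x ∈ hull s) {v : E d} (hv : v ∈ s) : bary s x v ≤ 1 := by
  rw [hT.bary_eq hs hx hv]; exact hT.bc_le_one (hull_mono hs hx) (hs hv)

/-- Interpolation reproduces affine functions. -/
lemma interp_affine (hp : 1 ≤ p) (hx : x ∈ hull s) (f : E d →ᵃ[ℝ] ℝ) :
    interp s p f x = f x := by
  have hp0 : (p : ℝ) ≠ 0 := by positivity
  -- The barycentric coordinates of a node are `k v / p`. After exchanging the sums, each vertex
  -- contributes one instance of `sum_mul_prod_binom` with `x v = p * bary s x v`.
  have h1 : ∀ k ∈ s.piAntidiag p, f (node s p k) * lagrangeBasis s p k x =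
      ∑ v ∈ s, (f v / p) * ((k v : ℝ) * ∏ w ∈ s, binom (p * bary s x w) (k w)) := by
    intro k hk
    rw [Finset.mem_piAntidiag] at hk
    rw [node, affine_comb f s, lagrangeBasis_eq, Finset.sum_mul]
    · exact Finset.sum_congr rfl fun v _ => by ring
    · rw [← Finset.sum_div, div_eq_one_iff_eq hp0]
      exact_mod_cast hk.1
  have h2 : ∑ v ∈ s, (p : ℝ) * bary s x v = p := by
    rw [← Finset.mul_sum, hT.sum_bary hs hx, mul_one]
  rw [interp, Finset.sum_congr rfl h1, Finset.sum_comm, ← hT.sum_bary_mul hs hx f]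
  refine Finset.sum_congr rfl fun v hv => ?_
  rw [← Finset.mul_sum, sum_mul_prod_binom s hp _ h2 hv]
  field_simp

/-- On a face of the cell, the interpolant is determined by the nodal values on this face. -/
lemma interp_face (hx : x ∈ hull s) (f : E d → ℝ) : interp T p f x = interp s p f x := by
  have hxT := hull_mono hs hx
  have h0 := ((hT.mem_hull hs).1 hx).2
  have hsub : s.piAntidiag p ⊆ T.piAntidiag p := by
    intro k hk
    rw [Finset.mem_piAntidiag] at hk ⊢
    refine ⟨?_, fun i hi => hs (hk.2 i hi)⟩
    rw [← hk.1]
    refine (Finset.sum_subset hs fun v _ hv => ?_).symm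
    by_contra h; exact hv (hk.2 v h)
  rw [interp, interp, ← Finset.sum_subset hsub]
  · refine Finset.sum_congr rfl fun k hk => ?_
    rw [Finset.mem_piAntidiag] at hk
    have hk0 : ∀ v ∈ T, v ∉ s → k v = 0 := fun v _ hv => by
      by_contra h; exact hv (hk.2 v h)
    congr 1
    · congr 1
      refine (Finset.sum_subset hs fun v hv hvs => ?_).symm
      rw [hk0 v hv hvs]; simp
    · rw [lagrangeBasis_eq, lagrangeBasis_eq, ← Finset.prod_subset hs]
      · exact Finset.prod_congr rfl fun v hv => by
          rw [hT.bary_eq hs hx hv, hT.bary_eq subset_rfl hxT (hs hv)]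
      · intro v hv hvs
        rw [hk0 v hv hvs]; simp [binom]
  · intro k hk hks
    rw [Finset.mem_piAntidiag] at hk hks
    have : ∃ v ∈ T, v ∉ s ∧ k v ≠ 0 := by
      by_contra! hcon
      refine hks ⟨?_, fun i hi => ?_⟩
      · rw [← hk.1]
        exact Finset.sum_subset hs fun v hv hvs => hcon v hv hvs
      · by_contra his; exact hi (hcon i (hk.2 i hi) his)
    obtain ⟨v, hv, hvs, hkv⟩ := this
    rw [lagrangeBasis_eq, Finset.prod_eq_zero hv, mul_zero]
    -- A multi-index that charges a vertex outside `s` has the factor `j = 0`, which is `p * 0 - 0`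
    -- on the face.
    rw [hT.bary_eq subset_rfl hxT hv, h0 v hv hvs, binom]
    exact Finset.prod_eq_zero (Finset.mem_range.2 (Nat.pos_of_ne_zero hkv)) (by simp)

/-- Both `p * bary s x v` and `j` lie in `[0, p]`, so each factor is at most `p` in modulus, and
there are `∑ k v = p` factors. -/
lemma abs_lagrangeBasis_le (hp : 1 ≤ p) (hx : x ∈ hull s) {k : E d → ℕ}
    (hk : k ∈ s.piAntidiag p) : |lagrangeBasis s p k x| ≤ (p : ℝ) ^ p := by
  rw [Finset.mem_piAntidiag] at hk
  rw [lagrangeBasis_eq, Finset.abs_prod]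
  have hp1 : (1 : ℝ) ≤ p := by exact_mod_cast hp
  have h1 : ∀ v ∈ s, |binom (p * bary s x v) (k v)| ≤ (p : ℝ) ^ k v := by
    intro v hv
    rw [binom, Finset.abs_prod]
    have hkp : k v ≤ p := hk.1 ▸ Finset.single_le_sum (f := k) (fun _ _ => Nat.zero_le _) hv
    calc _ ≤ ∏ j ∈ Finset.range (k v), (p : ℝ) := by
          refine Finset.prod_le_prod (fun _ _ => abs_nonneg _) fun j hj => ?_
          have hj' : (j : ℝ) ≤ p := by
            exact_mod_cast (Finset.mem_range.1 hj).le.trans hkp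
          have hb0 := hT.bary_nonneg hs hx hv
          have hb1 := hT.bary_le_one hs hx hv
          rw [abs_div, abs_of_pos (by positivity : (0 : ℝ) < j + 1)]
          refine (div_le_self (abs_nonneg _) (by linarith [j.cast_nonneg (α := ℝ)])).trans ?_
          rw [abs_le]
          constructor <;> nlinarith [j.cast_nonneg (α := ℝ)]
      _ = _ := by simp
  refine (Finset.prod_le_prod (fun _ _ => abs_nonneg _) h1).trans ?_
  rw [Finset.prod_pow_eq_pow_sum, hk.1]

/-- The interpolant is bounded by the nodal values. -/
lemma abs_interp_le (hp : 1 ≤ p) (hx : x ∈ hull s) {f : E d → ℝ} {B : ℝ} (hB : 0 ≤ B)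
    (hf : ∀ y ∈ hull s, |f y| ≤ B) :
    |interp s p f x| ≤ ((d + 1 + p).choose p * (p : ℝ) ^ p) * B := by
  rw [interp]
  refine (Finset.abs_sum_le_sum_abs _ _).trans ?_
  calc _ ≤ ∑ k ∈ s.piAntidiag p, B * (p : ℝ) ^ p := by
        refine Finset.sum_le_sum fun k hk => ?_
        rw [abs_mul]
        exact mul_le_mul (hf _ (node_mem_hull hp hk)) (hT.abs_lagrangeBasis_le hs hp hx hk)
          (abs_nonneg _) hB
    _ = (s.piAntidiag p).card * (B * (p : ℝ) ^ p) := by rw [Finset.sum_const, nsmul_eq_mul]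
    _ ≤ (d + 1 + p).choose p * (B * (p : ℝ) ^ p) := by
        refine mul_le_mul_of_nonneg_right ?_ (by positivity)
        have h1 := card_piAntidiag_le s p
        have h2 := Finset.card_le_card hs
        rw [hT.card] at h2
        exact_mod_cast h1.trans (Nat.choose_le_choose _ (by omega))
    _ = _ := by ring

/-- The interpolant is a polynomial of degree at most `p`. -/
lemma exists_poly_interp (f : E d → ℝ) :
    ∃ P ∈ Poly d p, ∀ x ∈ hull s, interp s p f x = ev P x := by
  have h : ∀ k ∈ s.piAntidiag p, ∃ P ∈ Poly d p, ∀ x ∈ hull s, lagrangeBasis s p k x = ev P x := by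
    intro k hk
    rw [Finset.mem_piAntidiag] at hk
    -- On the simplex `bary` agrees with the affine functions `bc T v`, which makes the basis
    -- function a product of `∑ k v = p` affine polynomials.
    refine ⟨∏ v ∈ s, ∏ j ∈ Finset.range (k v),
      affinePoly (((1 : ℝ) / (j + 1)) • ((p : ℝ) • bc T v - AffineMap.const ℝ _ (j : ℝ))), ?_, ?_⟩
    · rw [MvPolynomial.mem_restrictTotalDegree]
      refine (MvPolynomial.totalDegree_finsetProd _ _).trans ?_
      rw [← hk.1]
      refine Finset.sum_le_sum fun v _ => ?_
      refine (MvPolynomial.totalDegree_finsetProd _ _).trans ?_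
      refine (Finset.sum_le_sum fun j _ => affinePoly_totalDegree _).trans ?_
      simp
    · intro x hx
      rw [lagrangeBasis, ev, map_prod]
      refine Finset.prod_congr rfl fun v hv => ?_
      rw [map_prod]
      refine Finset.prod_congr rfl fun j _ => ?_
      rw [← ev, ev_affinePoly, hT.bary_eq hs hx hv]
      simp
      ring
  choose! P hP hPe using h
  refine ⟨∑ k ∈ s.piAntidiag p, f (node s p k) • P k,
    Submodule.sum_mem _ fun k hk => Submodule.smul_mem _ _ (hP k hk), fun x hx => ?_⟩
  rw [interp, ev, map_sum]
  exact Finset.sum_congr rfl fun k hk => by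
    rw [hPe k hk x hx, MvPolynomial.smul_eval]; rfl

end IsCell

/-! ### The reference simplex -/

/-- The unit simplex in `ℝ^m`. -/
def refSimplex (m : ℕ) : Set (Fin m → ℝ) :=
  convexHull ℝ (insert 0 (Set.range fun i => Pi.single i 1))

lemma refSimplex_isCompact (m : ℕ) : IsCompact (refSimplex m) :=
  ((Set.finite_range _).insert 0).isCompact_convexHull (𝕜 := ℝ)

lemma refSimplex_interior (m : ℕ) : (interior (refSimplex m)).Nonempty := by
  rw [refSimplex, interior_convexHull_nonempty_iff_affineSpan_eq_top,
    ← AffineSubspace.coe_eq_univ_iff, affineSpan_insert_zero]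
  have : Submodule.span ℝ (Set.range fun i : Fin m => (Pi.single i 1 : Fin m → ℝ)) = ⊤ := by
    rw [← (Pi.basisFun ℝ (Fin m)).span_eq]
    congr 1
    ext x
    simp
  rw [this]; rfl

lemma refSimplex_closure_interior (m : ℕ) : closure (interior (refSimplex m)) = refSimplex m := by
  rw [refSimplex, (convex_convexHull ℝ _).closure_interior_eq_closure_of_nonempty_interior
    (refSimplex_interior m)]
  exact (refSimplex_isCompact m).isClosed.closure_eq

lemma refSimplex_volume_pos (m : ℕ) : 0 < volume (refSimplex m) :=
  Measure.measure_pos_of_nonempty_interior _ (refSimplex_interior m)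

lemma refSimplex_volume_lt_top (m : ℕ) : volume (refSimplex m) < ⊤ :=
  (refSimplex_isCompact m).measure_lt_top

lemma refSimplex_volume_real_pos (m : ℕ) : 0 < volume.real (refSimplex m) :=
  ENNReal.toReal_pos (refSimplex_volume_pos m).ne' (refSimplex_volume_lt_top m).ne

lemma isFiniteMeasure_comap (m : ℕ) : IsFiniteMeasure
    ((volume : Measure (Fin m → ℝ)).comap (Subtype.val : refSimplex m → Fin m → ℝ)) := ⟨by
  rw [comap_subtype_coe_apply (refSimplex_isCompact m).measurableSet, Set.image_univ,
    Subtype.range_coe]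
  exact refSimplex_volume_lt_top m⟩

/-- A continuous function with zero `L²` norm vanishes on the interior, since nonempty open sets are
not null, and the interior is dense in the simplex. -/
lemma integral_sq_pos {m : ℕ} (f : C(refSimplex m, ℝ)) (hf : f ≠ 0) :
    0 < ∫ z, f z ^ 2 ∂((volume : Measure (Fin m → ℝ)).comap Subtype.val) := by
  set μ : Measure (refSimplex m) := volume.comap Subtype.val with hμ
  have : CompactSpace (refSimplex m) := isCompact_iff_compactSpace.1 (refSimplex_isCompact m)
  have hS : MeasurableSet (refSimplex m) := (refSimplex_isCompact m).measurableSet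
  have : IsFiniteMeasure μ := isFiniteMeasure_comap m
  refine lt_of_le_of_ne (integral_nonneg fun z => sq_nonneg _) fun h => hf ?_
  have hint : Integrable (fun z => f z ^ 2) μ := by
    have : Continuous fun z => f z ^ 2 := by fun_prop
    exact this.integrable_of_hasCompactSupport (HasCompactSupport.of_compactSpace _)
  rw [eq_comm, integral_eq_zero_iff_of_nonneg (fun z => sq_nonneg _) hint] at h
  ext y
  have h1 : ∀ z : refSimplex m, z.1 ∈ interior (refSimplex m) → f z = 0 := by
    by_contra! hcon
    obtain ⟨z, hz, hfz⟩ := hcon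
    have hopen : IsOpen {w : refSimplex m | w.1 ∈ interior (refSimplex m) ∧
        f w ≠ 0} := by
      refine (isOpen_interior.preimage continuous_subtype_val).inter ?_
      exact isOpen_ne_fun f.continuous continuous_const
    obtain ⟨U, hU, hUe⟩ := isOpen_induced_iff.1 hopen
    have hnull : μ {w : refSimplex m | w.1 ∈ interior (refSimplex m) ∧
        f w ≠ 0} = 0 := by
      refine measure_mono_null ?_ (ae_iff.1 h)
      intro w hw
      simpa using hw.2
    rw [hμ, comap_subtype_coe_apply hS] at hnull
    have hsub : U ∩ interior (refSimplex m) ⊆ Subtype.val '' {w : refSimplex m |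
        w.1 ∈ interior (refSimplex m) ∧ f w ≠ 0} := by
      rintro w ⟨hwU, hwi⟩
      refine ⟨⟨w, interior_subset hwi⟩, ?_, rfl⟩
      rw [← hUe]; exact hwU
    have hzU : z.1 ∈ U := by
      have : z ∈ Subtype.val ⁻¹' U := by rw [hUe]; exact ⟨hz, hfz⟩
      exact this
    exact ((hU.inter isOpen_interior).measure_pos volume ⟨z.1, hzU, hz⟩).ne'
      (measure_mono_null hsub hnull)
  have hcl : IsClosed {z : refSimplex m | f z = 0} :=
    isClosed_eq f.continuous continuous_const
  have hy : y ∈ closure {z : refSimplex m | z.1 ∈ interior (refSimplex m)} := by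
    rw [Topology.IsInducing.subtypeVal.closure_eq_preimage_closure_image]
    have : Subtype.val '' {z : refSimplex m | z.1 ∈ interior (refSimplex m)} =
        interior (refSimplex m) := by
      ext w
      exact ⟨by rintro ⟨z, hz, rfl⟩; exact hz, fun hw => ⟨⟨w, interior_subset hw⟩, hw, rfl⟩⟩
    rw [Set.mem_preimage, this, refSimplex_closure_interior]
    exact y.2
  exact closure_minimal (fun z hz => h1 z hz) hcl hy

/-- On a finite dimensional space of continuous functions, the maximum norm is controlled by the
`L²` norm. -/
lemma exists_sq_le_integral {m : ℕ} (V : Submodule ℝ C(refSimplex m, ℝ)) [FiniteDimensional ℝ V] :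
    ∃ C : ℝ, 0 < C ∧ ∀ f ∈ V, ∀ y, f y ^ 2 ≤ C * ∫ z, f z ^ 2 ∂(volume.comap Subtype.val) := by
  set μ : Measure (refSimplex m) := volume.comap Subtype.val with hμ
  have : CompactSpace (refSimplex m) := isCompact_iff_compactSpace.1 (refSimplex_isCompact m)
  have : IsFiniteMeasure μ := isFiniteMeasure_comap m
  have : ProperSpace V := FiniteDimensional.proper ℝ V
  have hcont : Continuous fun f : V => ∫ z, (f : C(refSimplex m, ℝ)) z ^ 2 ∂μ := by
    have h : Continuous (Function.uncurry fun (f : V) (z : refSimplex m) =>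
        (f : C(refSimplex m, ℝ)) z ^ 2) := by
      have : Continuous fun q : V × refSimplex m => (q.1 : C(refSimplex m, ℝ)) q.2 := by fun_prop
      exact this.pow 2
    simpa using continuous_parametric_integral_of_continuous (μ := μ) h isCompact_univ
  have hpos : ∀ f : V, f ≠ 0 → 0 < ∫ z, (f : C(refSimplex m, ℝ)) z ^ 2 ∂μ := fun f hf =>
    integral_sq_pos _ fun h => hf (Subtype.ext h)
  -- The minimum of the squared `L²` norm over the compact unit sphere of `V`. If `V` is trivial,
  -- the sphere is empty and any constant serves.
  obtain ⟨C, hC, hCf⟩ : ∃ C : ℝ, 0 < C ∧ ∀ f ∈ V, ‖f‖ = 1 →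
      C ≤ ∫ z, f z ^ 2 ∂μ := by
    rcases (Metric.sphere (0 : V) 1).eq_empty_or_nonempty with he | hne
    · refine ⟨1, one_pos, fun f hfV hf => ?_⟩
      have hfs : (⟨f, hfV⟩ : V) ∈ Metric.sphere (0 : V) 1 := mem_sphere_zero_iff_norm.2 hf
      rw [he] at hfs
      exact hfs.elim
    · obtain ⟨f₀, hf₀, hmin⟩ := (isCompact_sphere (0 : V) 1).exists_isMinOn hne hcont.continuousOn
      refine ⟨_, hpos f₀ ?_, fun f hfV hf =>
        hmin (a := ⟨f, hfV⟩) (mem_sphere_zero_iff_norm.2 hf)⟩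
      rintro rfl
      rw [mem_sphere_zero_iff_norm, norm_zero] at hf₀
      exact zero_ne_one hf₀
  refine ⟨C⁻¹, inv_pos.2 hC, fun f hf y => ?_⟩
  by_cases h0 : (⟨f, hf⟩ : V) = 0
  · have : f = 0 := congrArg Subtype.val h0
    subst this; simp
  · have hn : 0 < ‖f‖ := norm_pos_iff.2 fun h => h0 (Subtype.ext h)
    have hunit : ‖(‖f‖⁻¹ • f : C(refSimplex m, ℝ))‖ = 1 := by
      rw [norm_smul, norm_inv, norm_norm, inv_mul_cancel₀ hn.ne']
    have h1 := hCf _ (V.smul_mem ‖f‖⁻¹ hf) hunit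
    simp only [ContinuousMap.smul_apply, smul_eq_mul, mul_pow] at h1
    rw [integral_const_mul] at h1
    have h2 : |f y| ≤ ‖f‖ := by
      simpa using f.norm_coe_le_norm y
    have h3 : f y ^ 2 ≤ ‖f‖ ^ 2 := by
      rw [← sq_abs (f y)]; gcongr
    refine h3.trans ?_
    rw [inv_mul_eq_div, le_div_iff₀ hC]
    rw [inv_pow, inv_mul_eq_div, le_div_iff₀ (by positivity)] at h1
    linarith

/-- The inverse inequality on the reference simplex. -/
lemma exists_inverse_ref (m p : ℕ) : ∃ C : ℝ, 0 < C ∧ ∀ Q ∈ MvPolynomial.restrictTotalDegree (Fin m) ℝ p,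
    ∀ y ∈ refSimplex m, (MvPolynomial.eval y Q) ^ 2 ≤
      C * ∫ z in refSimplex m, (MvPolynomial.eval z Q) ^ 2 := by
  let Φ : MvPolynomial.restrictTotalDegree (Fin m) ℝ p →ₗ[ℝ] C(refSimplex m, ℝ) :=
    { toFun := fun Q => ⟨fun y => MvPolynomial.eval y.1 Q.1,
        (MvPolynomial.continuous_eval Q.1).comp continuous_subtype_val⟩
      map_add' := fun P Q => by ext y; simp
      map_smul' := fun a Q => by ext y; simp [MvPolynomial.smul_eval] }
  obtain ⟨C, hC, h⟩ := exists_sq_le_integral (LinearMap.range Φ)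
  refine ⟨C, hC, fun Q hQ y hy => ?_⟩
  have h1 := h (Φ ⟨Q, hQ⟩) ⟨_, rfl⟩ ⟨y, hy⟩
  have h2 := integral_subtype_comap (μ := volume) (refSimplex_isCompact m).measurableSet
    (fun z => (MvPolynomial.eval z Q) ^ 2)
  rw [← h2]
  exact h1

/-! ### Parametrization of simplices -/

/-- Substituting affine polynomials for the variables does not raise the total degree. -/
lemma exists_pullback {m p : ℕ} (A : (Fin m → ℝ) →ᵃ[ℝ] E d) {P : MvPolynomial (Fin d) ℝ}
    (hP : P ∈ Poly d p) : ∃ Q ∈ MvPolynomial.restrictTotalDegree (Fin m) ℝ p,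
      ∀ y, MvPolynomial.eval y Q = ev P (A y) := by
  rw [MvPolynomial.mem_restrictTotalDegree] at hP
  let l : Fin d → MvPolynomial (Fin m) ℝ := fun i =>
    MvPolynomial.C (A 0 i) + ∑ j, MvPolynomial.C (A.linear (Pi.single j 1) i) * MvPolynomial.X j
  have hl : ∀ i, (l i).totalDegree ≤ 1 := by
    intro i
    refine (MvPolynomial.totalDegree_add _ _).trans (max_le (by simp) ?_)
    refine (MvPolynomial.totalDegree_finsetSum _ _).trans (Finset.sup_le fun j _ => ?_)
    exact (MvPolynomial.totalDegree_mul _ _).trans (by simp)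
  have hle : ∀ i y, MvPolynomial.eval y (l i) = A y i := by
    intro i y
    have h1 : A y = A.linear y + A 0 := by simpa using congrFun A.decomp y
    have h2 : y = ∑ j, y j • (Pi.single j 1 : Fin m → ℝ) := by
      ext k; simp [Finset.sum_apply, Pi.single_apply]
    rw [h1]
    conv_rhs => rw [h2, map_sum]
    simp [l, mul_comm, add_comm]
  refine ⟨∑ k ∈ P.support, MvPolynomial.C (MvPolynomial.coeff k P) * ∏ i, l i ^ k i, ?_, fun y => ?_⟩
  · refine Submodule.sum_mem _ fun k hk => ?_
    rw [MvPolynomial.mem_restrictTotalDegree]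
    refine (MvPolynomial.totalDegree_mul _ _).trans ?_
    rw [MvPolynomial.totalDegree_C, zero_add]
    refine (MvPolynomial.totalDegree_finsetProd _ _).trans ?_
    refine le_trans ?_ ((MvPolynomial.le_totalDegree hk).trans hP)
    rw [Finsupp.sum_fintype _ _ (fun _ => rfl)]
    refine Finset.sum_le_sum fun i _ => ?_
    refine (MvPolynomial.totalDegree_pow _ _).trans ?_
    have := hl i
    nlinarith
  · rw [ev, MvPolynomial.eval_eq' _ P]
    simp [hle]

/-- Affine maps are Lipschitz, and on `ℝ^m` the Hausdorff measure `μH[m]` is Lebesgue measure. The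
matching lower bound below comes from injective affine maps being antilipschitz. -/
lemma euclideanHausdorff_finite_on_image {m : ℕ} (A : (Fin m → ℝ) →ᵃ[ℝ] E d) {K : Set (Fin m → ℝ)}
    (hK : volume K < ⊤) : (μHE[m] : Measure (E d)) (A '' K) < ⊤ := by
  obtain ⟨k, hk⟩ := A.lipschitzWith_of_finiteDimensional
  have h1 := hk.hausdorffMeasure_image_le (d := m) (by positivity) K
  have h2 : (μH[m] : Measure (Fin m → ℝ)) = volume := by
    have := hausdorffMeasure_pi_real (ι := Fin m)
    rwa [Fintype.card_fin] at this
  rw [h2] at h1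
  rw [Measure.euclideanHausdorffMeasure_def]
  simp only [Measure.smul_apply]
  refine ENNReal.mul_lt_top (by simp) (h1.trans_lt (ENNReal.mul_lt_top ?_ hK))
  simp

lemma euclideanHausdorff_pos_image {m : ℕ} (A : (Fin m → ℝ) →ᵃ[ℝ] E d)
    (hA : Function.Injective A) {K : Set (Fin m → ℝ)}
    (hK : 0 < volume K) : 0 < (μHE[m] : Measure (E d)) (A '' K) := by
  have hlin : A.linear.ker = ⊥ := by
    rw [LinearMap.ker_eq_bot]; exact A.linear_injective_iff.2 hA
  obtain ⟨k, -, hk⟩ := LinearMap.exists_antilipschitzWith A.linear hlin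
  have hkA : AntilipschitzWith k A := by
    intro x y
    have h1 : A x = A.linear x + A 0 := by simpa using congrFun A.decomp x
    have h2 : A y = A.linear y + A 0 := by simpa using congrFun A.decomp y
    rw [h1, h2, edist_add_right]
    exact hk x y
  have h1 := hkA.le_hausdorffMeasure_image (d := m) (by positivity) K
  have h2 : (μH[m] : Measure (Fin m → ℝ)) = volume := by
    have := hausdorffMeasure_pi_real (ι := Fin m)
    rwa [Fintype.card_fin] at this
  rw [h2] at h1
  rw [Measure.euclideanHausdorffMeasure_def]
  simp only [Measure.smul_apply]
  have h3 : (μH[m] : Measure (E d)) (A '' K) ≠ 0 := by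
    intro h0
    rw [h0, mul_zero] at h1
    exact hK.ne' (le_antisymm h1 zero_le)
  have h4 := Measure.addHaarScalarFactor_pos_of_isAddHaarMeasure
    (volume : Measure (EuclideanSpace ℝ (Fin m))) μH[m]
  exact pos_iff_ne_zero.2 (mul_ne_zero (by exact_mod_cast h4.ne') h3)

/-- The Hausdorff measure on an affine subspace is a multiple of the Lebesgue measure of the
parameter domain. -/
lemma exists_setIntegral_image {m : ℕ} (A : (Fin m → ℝ) →ᵃ[ℝ] E d) (hA : Function.Injective A) :
    ∃ c : ℝ, 0 < c ∧ ∀ (S : Set (Fin m → ℝ)) (f : E d → ℝ), IsCompact S →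
      ∫ x in A '' S, f x ∂μHE[m] = c * ∫ y in S, f (A y) := by
  have hcont : Continuous A := A.continuous_of_finiteDimensional
  have hemb : MeasurableEmbedding A := hcont.measurableEmbedding hA
  -- The measure pulled back to the parameter domain is translation invariant and finite on compact
  -- sets, so uniqueness of Haar measure makes it a multiple of Lebesgue measure. The factor is not
  -- computed; it cancels later.
  set ν : Measure (Fin m → ℝ) := (μHE[m] : Measure (E d)).comap A with hν
  have hνa : ∀ s, ν s = μHE[m] (A '' s) := fun s => hemb.comap_apply _ s
  have hinvH : (μHE[m] : Measure (E d)).IsAddLeftInvariant := by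
    rw [Measure.euclideanHausdorffMeasure_def]; infer_instance
  have : ν.IsAddLeftInvariant := by
    refine ⟨fun a => ?_⟩
    ext s hs
    rw [Measure.map_apply (measurable_const_add a) hs, hνa, hνa]
    have : A '' ((fun x => a + x) ⁻¹' s) = (fun x => A.linear a + x) ⁻¹' (A '' s) := by
      have hadd : ∀ y, A (a + y) = A.linear a + A y := fun y => by
        have := A.map_vadd y a
        simpa using this
      ext x
      constructor
      · rintro ⟨y, hy, rfl⟩
        exact ⟨a + y, hy, hadd y⟩
      · rintro ⟨y, hy, hxy⟩
        refine ⟨-a + y, by simpa using hy, ?_⟩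
        have := hadd (-a + y)
        rw [add_neg_cancel_left, hxy] at this
        exact (add_left_cancel this).symm
    rw [this, measure_preimage_add]
  have : IsFiniteMeasureOnCompacts ν :=
    ⟨fun K hK => by rw [hνa]; exact euclideanHausdorff_finite_on_image A hK.measure_lt_top⟩
  have hc := Measure.isAddLeftInvariant_eq_smul ν (volume : Measure (Fin m → ℝ))
  set c := ν.addHaarScalarFactor (volume : Measure (Fin m → ℝ)) with hcdef
  have hcpos : 0 < c := by
    rw [pos_iff_ne_zero]
    intro h0
    rw [h0, zero_smul] at hc
    have := euclideanHausdorff_pos_image A hA (refSimplex_volume_pos m)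
    rw [← hνa, hc] at this
    simp at this
  refine ⟨c, hcpos, fun S f hS => ?_⟩
  have h1 : (μHE[m] : Measure (E d)).restrict (A '' S) =
      ((μHE[m] : Measure (E d)).restrict (Set.range A)).restrict (A '' S) := by
    rw [Measure.restrict_restrict (hS.image hcont).measurableSet,
      Set.inter_eq_left.2 (Set.image_subset_range _ _)]
  rw [h1, ← hemb.map_comap, hemb.setIntegral_map, Set.preimage_image_eq _ hA, ← hν, hc,
    Measure.restrict_smul]
  rw [integral_smul_nnreal_measure]
  rfl

lemma exists_param {m : ℕ} {s : Finset (E d)} (hc : s.card = m + 1)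
    (hind : AffineIndependent ℝ ((↑) : s → E d)) :
    ∃ (A : (Fin m → ℝ) →ᵃ[ℝ] E d), Function.Injective A ∧ A '' refSimplex m = hull s := by
  let e : Fin (m + 1) ≃ s := (Finset.equivFinOfCardEq hc).symm
  let v : Fin (m + 1) → E d := fun i => e i
  have hv : AffineIndependent ℝ v := hind.comp_embedding e.toEmbedding
  have hl := (affineIndependent_iff_linearIndependent_vsub ℝ v 0).1 hv
  have hl' : LinearIndependent ℝ fun i : Fin m => v i.succ - v 0 :=
    hl.comp (fun i : Fin m => (⟨i.succ, Fin.succ_ne_zero i⟩ : {x : Fin (m + 1) // x ≠ 0}))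
      (fun i j h => by simpa using h)
  let B : (Fin m → ℝ) →ₗ[ℝ] E d := Fintype.linearCombination ℝ (fun i : Fin m => v i.succ - v 0)
  have hB : Function.Injective B := hl'.fintypeLinearCombination_injective
  let A : (Fin m → ℝ) →ᵃ[ℝ] E d := B.toAffineMap + AffineMap.const ℝ _ (v 0)
  have hAe : ∀ y, A y = B y + v 0 := fun y => rfl
  refine ⟨A, fun x y h => ?_, ?_⟩
  · rw [hAe, hAe] at h
    exact hB (add_right_cancel h)
  · rw [refSimplex, AffineMap.image_convexHull, hull]
    congr 1
    rw [Set.image_insert_eq, ← Set.range_comp]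
    have hs : (s : Set (E d)) = Set.range v := by
      ext x
      constructor
      · intro hx; exact ⟨e.symm ⟨x, hx⟩, by simp [v]⟩
      · rintro ⟨i, rfl⟩; exact (e i).2
    have h1 : ∀ i, A (Pi.single i 1) = v i.succ := by
      intro i
      rw [hAe]
      simp [B, Fintype.linearCombination_apply, Pi.single_apply]
    have h2 : A 0 = v 0 := by rw [hAe]; simp
    rw [hs, h2]
    ext x
    simp only [Set.mem_insert_iff, Set.mem_range, Function.comp_apply, h1]
    rw [Fin.exists_fin_succ]
    simp [eq_comm]

/-! ### Inverse inequality and measures of simplices -/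

lemma setIntegral_one_eq {m : ℕ} (S : Set (E d)) :
    ∫ _x in S, (1 : ℝ) ∂μHE[m] = (μHE[m] : Measure (E d)).real S := by
  simp

lemma simplex_measure {m : ℕ} {s : Finset (E d)} (hc : s.card = m + 1)
    (hind : AffineIndependent ℝ ((↑) : s → E d)) :
    0 < (μHE[m] : Measure (E d)).real (hull s) ∧ (μHE[m] : Measure (E d)) (hull s) < ⊤ := by
  obtain ⟨A, hA, hAs⟩ := exists_param hc hind
  have h1 := euclideanHausdorff_finite_on_image A (refSimplex_volume_lt_top m)
  have h2 := euclideanHausdorff_pos_image A hA (refSimplex_volume_pos m)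
  rw [hAs] at h1 h2
  exact ⟨ENNReal.toReal_pos h2.ne' h1.ne, h1⟩

/-- The inverse inequality for polynomials on a simplex. -/
lemma exists_inverse (d m p : ℕ) : ∃ C : ℝ, 0 < C ∧ ∀ s : Finset (E d), s.card = m + 1 →
    AffineIndependent ℝ ((↑) : s → E d) → ∀ P ∈ Poly d p, ∀ x ∈ hull s,
    (μHE[m] : Measure (E d)).real (hull s) * ev P x ^ 2 ≤
      C * ∫ z in hull s, ev P z ^ 2 ∂μHE[m] := by
  obtain ⟨C, hC, h⟩ := exists_inverse_ref m p
  -- The scaling factor of the parametrization occurs on both sides, so only the volume of the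
  -- reference simplex enters the constant.
  refine ⟨volume.real (refSimplex m) * C, mul_pos (refSimplex_volume_real_pos m) hC,
    fun s hc hind P hP x hx => ?_⟩
  obtain ⟨A, hA, hAs⟩ := exists_param hc hind
  obtain ⟨c, hcpos, hint⟩ := exists_setIntegral_image A hA
  obtain ⟨Q, hQ, hQe⟩ := exists_pullback A hP
  rw [← hAs] at hx
  obtain ⟨y, hy, rfl⟩ := hx
  have h1 := hint (refSimplex m) (fun _ => 1) (refSimplex_isCompact m)
  have h2 := hint (refSimplex m) (fun z => ev P z ^ 2) (refSimplex_isCompact m)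
  rw [hAs] at h1 h2
  rw [setIntegral_one_eq] at h1
  have h3 := h Q hQ y hy
  simp only [hQe] at h3
  rw [h1, h2]
  simp only [integral_const, smul_eq_mul, mul_one, MeasurableSet.univ, measureReal_restrict_apply,
    Set.univ_inter]
  have h4 : 0 ≤ c * volume.real (refSimplex m) := by positivity
  nlinarith [mul_le_mul_of_nonneg_left h3 h4]

lemma hausdorff_eq_volume (S : Set (E d)) : (μHE[d] : Measure (E d)).real S = volume.real S := by
  rw [EuclideanSpace.euclideanHausdorffMeasure_eq_volume]

lemma IsCell.volume_pos {T : Finset (E d)} (hT : IsCell T) : 0 < volume.real (hull T) := by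
  rw [← hausdorff_eq_volume]; exact (simplex_measure hT.card hT.indep).1

lemma IsCell.diam_pos {T : Finset (E d)} (hd : 1 ≤ d) (hT : IsCell T) :
    0 < Metric.diam (hull T) := by
  have : 1 < T.card := by rw [hT.card]; omega
  obtain ⟨a, ha, b, hb, hab⟩ := Finset.one_lt_card.1 this
  refine lt_of_lt_of_le (dist_pos.2 hab)
    (Metric.dist_le_diam_of_mem (hull_isBounded T) (vertex_mem_hull ha) (vertex_mem_hull hb))

/-- A coordinate takes values in `[0, 1]` on the cell, so it changes by at most `1` along a radius
of a ball inside it. Being affine, it has Lipschitz constant at most `1 / r` everywhere. -/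
lemma IsCell.abs_bc_sub_le {T : Finset (E d)} (hT : IsCell T) {z : E d} {r : ℝ} (hr : 0 < r)
    (hz : Metric.closedBall z r ⊆ hull T) {v : E d} (hv : v ∈ T) (x y : E d) :
    |bc T v x - bc T v y| ≤ dist x y / r := by
  rcases eq_or_ne x y with rfl | hxy
  · simp
  have hn : 0 < ‖x - y‖ := norm_pos_iff.2 (sub_ne_zero.2 hxy)
  have hlin : ∀ w w', bc T v w - bc T v w' = (bc T v).linear (w - w') := fun w w' => by
    have := (bc T v).linearMap_vsub w w'
    simpa using this.symm
  have hw : z + (r / ‖x - y‖) • (x - y) ∈ Metric.closedBall z r := by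
    rw [Metric.mem_closedBall, dist_eq_norm, add_sub_cancel_left, norm_smul, Real.norm_eq_abs,
      abs_of_pos (by positivity), div_mul_cancel₀ _ hn.ne']
  have h1 := hlin (z + (r / ‖x - y‖) • (x - y)) z
  rw [add_sub_cancel_left, map_smul, ← hlin x y, smul_eq_mul] at h1
  have h2 := hz hw
  have h3 := hz (Metric.mem_closedBall_self hr.le)
  have h4 : |r / ‖x - y‖ * (bc T v x - bc T v y)| ≤ 1 := by
    rw [← h1, abs_le]
    have a1 := hT.mem_hull_self.1 h2 v hv
    have a2 := hT.mem_hull_self.1 h3 v hv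
    have a3 := hT.bc_le_one h2 hv
    have a4 := hT.bc_le_one h3 hv
    constructor <;> linarith
  rw [abs_mul, abs_of_pos (by positivity), div_mul_eq_mul_div, div_le_one hn] at h4
  rw [dist_eq_norm, le_div_iff₀ hr]
  linarith

/-- The measures of the faces of a shape regular cell are comparable. -/
lemma side_measure_le {m : ℕ} {T F G : Finset (E d)} (hT : IsCell T) (hd : 1 ≤ d) {ρ : ℝ}
    (hρ : 0 < ρ) (hball : ∃ z, Metric.closedBall z (ρ * Metric.diam (hull T)) ⊆ hull T)
    (hF : F ⊆ T) (hG : G ⊆ T) (hFc : F.card = m + 1) (hGc : G.card = m + 1) :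
    (μHE[m] : Measure (E d)).real (hull G) ≤
      (((m : ℝ) + 1) / ρ) ^ m * (μHE[m] : Measure (E d)).real (hull F) := by
  obtain ⟨z, hz⟩ := hball
  have hD := hT.diam_pos hd
  set D := Metric.diam (hull T)
  have hr : 0 < ρ * D := mul_pos hρ hD
  obtain ⟨e⟩ : Nonempty (F ≃ G) := ⟨Finset.equivOfCardEq (hFc.trans hGc.symm)⟩
  let g : E d → E d := fun v => if h : v ∈ F then e ⟨v, h⟩ else 0
  have hg : ∀ v ∈ F, g v ∈ G := fun v hv => by
    simp only [g, dif_pos hv]; exact (e ⟨v, hv⟩).2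
  have hgs : ∀ w ∈ G, ∃ v ∈ F, g v = w := fun w hw => by
    refine ⟨e.symm ⟨w, hw⟩, (e.symm ⟨w, hw⟩).2, ?_⟩
    simp [g]
  obtain ⟨w₀, hw₀⟩ : G.Nonempty := by rw [← Finset.card_pos]; omega
  -- the affine map taking the vertices of `F` to those of `G`
  let A : E d → E d := fun x => ∑ v ∈ F, bc T v x • g v
  have hLip : LipschitzOnWith (Real.toNNReal (((m : ℝ) + 1) / ρ)) A (hull F) := by
    refine LipschitzOnWith.of_dist_le_mul fun x hx y hy => ?_
    rw [Real.coe_toNNReal _ (by positivity)]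
    have hx1 := hT.sum_bc_face hF ((hT.mem_hull hF).1 hx).2
    have hy1 := hT.sum_bc_face hF ((hT.mem_hull hF).1 hy).2
    -- The coordinate differences sum to zero, so `w₀` may be subtracted. Then each of the `m + 1`
    -- terms is at most `dist x y / (ρ D)` times `D`, and the diameter cancels.
    have h1 : A x - A y = ∑ v ∈ F, (bc T v x - bc T v y) • (g v - w₀) := by
      simp only [A, smul_sub, sub_smul, Finset.sum_sub_distrib, ← Finset.sum_smul, hx1, hy1]
      abel
    rw [dist_eq_norm, h1]
    calc _ ≤ ∑ v ∈ F, ‖(bc T v x - bc T v y) • (g v - w₀)‖ := norm_sum_le _ _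
      _ ≤ ∑ v ∈ F, dist x y / (ρ * D) * D := by
          refine Finset.sum_le_sum fun v hv => ?_
          rw [norm_smul, Real.norm_eq_abs]
          refine mul_le_mul (hT.abs_bc_sub_le hr hz (hF hv) x y) ?_ (norm_nonneg _) (by positivity)
          rw [← dist_eq_norm]
          exact Metric.dist_le_diam_of_mem (hull_isBounded T) (vertex_mem_hull (hG (hg v hv)))
            (vertex_mem_hull (hG hw₀))
      _ = ((m : ℝ) + 1) / ρ * dist x y := by
          rw [Finset.sum_const, hFc, nsmul_eq_mul]
          push_cast
          field_simp
  have himg : hull G ⊆ A '' hull F := by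
    intro x hx
    rw [hull, Finset.mem_convexHull'] at hx
    obtain ⟨b, hb0, hb1, rfl⟩ := hx
    have hsum : ∀ f : E d → E d, ∑ v ∈ F, f (g v) = ∑ w ∈ G, f w := by
      intro f
      rw [← Finset.sum_coe_sort F, ← Finset.sum_coe_sort G]
      refine Fintype.sum_equiv e _ _ fun v => ?_
      simp [g]
    have hsum' : ∑ v ∈ F, b (g v) = ∑ w ∈ G, b w := by
      rw [← Finset.sum_coe_sort F, ← Finset.sum_coe_sort G]
      refine Fintype.sum_equiv e _ _ fun v => ?_
      simp [g]
    refine ⟨∑ v ∈ F, b (g v) • v, ?_, ?_⟩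
    · rw [hull, Finset.mem_convexHull']
      exact ⟨fun v => b (g v), fun v hv => hb0 _ (hg v hv), hsum'.trans hb1, rfl⟩
    · simp only [A]
      rw [← hsum (fun w => b w • w)]
      exact Finset.sum_congr rfl fun v hv => by rw [hT.bc_comb hF (hsum'.trans hb1) hv]
  have h1 := hLip.hausdorffMeasure_image_le (d := m) (by positivity)
  have h2 : (μHE[m] : Measure (E d)) (hull G) ≤
      (Real.toNNReal (((m : ℝ) + 1) / ρ) : ENNReal) ^ m * (μHE[m] : Measure (E d)) (hull F) := by
    refine (measure_mono himg).trans ?_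
    rw [Measure.euclideanHausdorffMeasure_def]
    simp only [Measure.smul_apply, ENNReal.smul_def, smul_eq_mul]
    rw [ENNReal.rpow_natCast] at h1
    calc _ ≤ _ := mul_le_mul_right h1 _
      _ = _ := by ring
  have hFi : AffineIndependent ℝ ((↑) : F → E d) := hT.indep.mono (by exact_mod_cast hF)
  have h3 := (simplex_measure hFc hFi).2
  have h4 := ENNReal.toReal_mono (ENNReal.mul_lt_top (by simp) h3).ne h2
  rw [ENNReal.toReal_mul, ENNReal.toReal_pow, ENNReal.coe_toReal,
    Real.coe_toNNReal _ (by positivity)] at h4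
  exact h4

/-! ### The contribution of a cell to the skeleton norm -/

/-- The contribution of the cell `T` to `‖lam‖_ℓ²`. -/
def cellTerm (M : Mesh d) (lam : Skel d) (T : Finset (E d)) : ℝ :=
  volume.real (hull T) / (∑ F ∈ M.sidesOf T, sideInt F fun _ => 1) *
    ∑ F ∈ M.sidesOf T, sideInt F fun x => lam F x * lam F x

lemma skelInner_eq (M : Mesh d) (lam : Skel d) :
    skelInner M lam lam = ∑ T ∈ M.cells, cellTerm M lam T := rfl

lemma sideInt_one (F : Finset (E d)) :
    sideInt F (fun _ => 1) = (μHE[d - 1] : Measure (E d)).real (hull F) := setIntegral_one_eq _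

lemma sideInt_sq_nonneg (F : Finset (E d)) (f : E d → ℝ) : 0 ≤ sideInt F fun x => f x * f x :=
  integral_nonneg fun _ => mul_self_nonneg _

lemma cellTerm_nonneg (M : Mesh d) (lam : Skel d) (T : Finset (E d)) : 0 ≤ cellTerm M lam T := by
  refine mul_nonneg (div_nonneg measureReal_nonneg (Finset.sum_nonneg fun F _ => ?_))
    (Finset.sum_nonneg fun F _ => sideInt_sq_nonneg F _)
  rw [sideInt_one]; exact measureReal_nonneg

lemma skelInner_nonneg (M : Mesh d) (lam : Skel d) : 0 ≤ skelInner M lam lam :=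
  Finset.sum_nonneg fun T _ => cellTerm_nonneg M lam T

lemma skelNorm_sq (M : Mesh d) (lam : Skel d) : skelNorm M lam ^ 2 = skelInner M lam lam :=
  Real.sq_sqrt (skelInner_nonneg M lam)

namespace Mesh

lemma side_measure (hd : 1 ≤ d) {M : Mesh d} {F : Finset (E d)} (hF : F ∈ M.sides) :
    0 < (μHE[d - 1] : Measure (E d)).real (hull F) ∧
      (μHE[d - 1] : Measure (E d)) (hull F) < ⊤ :=
  simplex_measure (by rw [(mem_sides.1 hF).2]; omega) (M.complex.indep (mem_sides.1 hF).1)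

lemma sidesOf_eq (hd : 1 ≤ d) {M : Mesh d} {T : Finset (E d)} (hT : T ∈ M.cells) :
    M.sidesOf T = T.image T.erase := by
  ext F
  rw [Finset.mem_image]
  constructor
  · intro hF
    rw [mem_sidesOf] at hF
    obtain ⟨a, haT, haF, rfl⟩ := exists_apex hT hF.1 hF.2
    exact ⟨a, haT, Finset.erase_insert haF⟩
  · rintro ⟨a, ha, rfl⟩
    exact erase_mem_sidesOf hd hT ha

lemma card_sidesOf_le (hd : 1 ≤ d) {M : Mesh d} {T : Finset (E d)} (hT : T ∈ M.cells) :
    (M.sidesOf T).card ≤ d + 1 := by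
  rw [sidesOf_eq hd hT, ← (mem_cells.1 hT).2]
  exact Finset.card_image_le

lemma sum_sides_pos (hd : 1 ≤ d) {M : Mesh d} {T : Finset (E d)} (hT : T ∈ M.cells) :
    0 < ∑ F ∈ M.sidesOf T, sideInt F fun _ => 1 := by
  obtain ⟨v, hv⟩ := cell_nonempty hT
  refine Finset.sum_pos (fun F hF => ?_) ⟨_, erase_mem_sidesOf hd hT hv⟩
  rw [sideInt_one]
  exact (side_measure hd (mem_sidesOf.1 hF).1).1

end Mesh

/-- The maximum norm of a function of the skeleton space on the faces of a shape regular cell is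
controlled by the contribution of the cell to the norm. -/
lemma exists_volume_mul_sq_le_cellTerm (d p : ℕ) (hd : 1 ≤ d) {ρ : ℝ} (hρ : 0 < ρ) :
    ∃ C : ℝ, 0 < C ∧ ∀ (Ω : Set (E d)) (M : Mesh d), ∀ lam ∈ skeletonSpace p Ω M,
      ∀ T ∈ M.cells, (∃ z, Metric.closedBall z (ρ * Metric.diam (hull T)) ⊆ hull T) →
      ∀ F ∈ M.sidesOf T, ∀ x ∈ hull F,
        volume.real (hull T) * lam F x ^ 2 ≤ C * cellTerm M lam T := by
  obtain ⟨C, hC, h⟩ := exists_inverse d (d - 1) p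
  set K : ℝ := ((((d - 1 : ℕ) : ℝ) + 1) / ρ) ^ (d - 1) with hK
  have hKpos : 0 < K := by positivity
  refine ⟨(d + 1) * K * C, by positivity, fun Ω M lam hlam T hT hball F hF x hx => ?_⟩
  have hF' := Mesh.mem_sidesOf.1 hF
  have hFs := Mesh.mem_sides.1 hF'.1
  obtain ⟨⟨P, hP, hPe⟩, -⟩ := hlam F hF'.1
  have hcF : F.card = d - 1 + 1 := by rw [hFs.2]; omega
  have h1 := h F hcF (M.complex.indep hFs.1) P hP x hx
  have hint : ∫ z in hull F, ev P z ^ 2 ∂μHE[d - 1] = sideInt F fun x => lam F x * lam F x := by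
    refine setIntegral_congr_fun (hull_isCompact F).measurableSet fun z hz => ?_
    simp only [hPe z hz]; ring
  rw [hint, ← hPe x hx] at h1
  set σF := (μHE[d - 1] : Measure (E d)).real (hull F) with hσ
  have hσpos : 0 < σF := (Mesh.side_measure hd hF'.1).1
  have hS := Mesh.sum_sides_pos hd hT
  set S := ∑ F ∈ M.sidesOf T, sideInt F fun _ => 1 with hSdef
  -- A cell has at most `d + 1` faces, each of measure at most `K` times that of `F`. Thus `|∂T|` in
  -- the weight may be replaced by `|F|`, which the inverse inequality on `F` provides.
  have hSle : S ≤ (d + 1) * (K * σF) := by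
    calc S ≤ ∑ _G ∈ M.sidesOf T, K * σF := by
          refine Finset.sum_le_sum fun G hG => ?_
          rw [sideInt_one]
          have hG' := Mesh.mem_sidesOf.1 hG
          exact side_measure_le (Mesh.isCell hT) hd hρ hball hF'.2 hG'.2 hcF
            (by rw [(Mesh.mem_sides.1 hG'.1).2]; omega)
      _ = (M.sidesOf T).card * (K * σF) := by rw [Finset.sum_const, nsmul_eq_mul]
      _ ≤ _ := by
          refine mul_le_mul_of_nonneg_right ?_ (by positivity)
          exact_mod_cast Mesh.card_sidesOf_le hd hT
  have hterm : volume.real (hull T) / S * (sideInt F fun x => lam F x * lam F x) ≤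
      cellTerm M lam T := by
    refine mul_le_mul_of_nonneg_left ?_ (div_nonneg measureReal_nonneg hS.le)
    exact Finset.single_le_sum (f := fun F => sideInt F fun x => lam F x * lam F x)
      (fun G _ => sideInt_sq_nonneg G _) hF
  set I := sideInt F fun x => lam F x * lam F x
  set V := volume.real (hull T)
  have hV : 0 < V := (Mesh.isCell hT).volume_pos
  refine le_trans ?_ (mul_le_mul_of_nonneg_left hterm (by positivity))
  rw [div_mul_eq_mul_div, mul_div_assoc', le_div_iff₀ hS]
  have h2 : lam F x ^ 2 * S ≤ (d + 1) * K * (C * I) := by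
    calc _ ≤ lam F x ^ 2 * ((d + 1) * (K * σF)) :=
          mul_le_mul_of_nonneg_left hSle (sq_nonneg _)
      _ = (d + 1) * K * (σF * lam F x ^ 2) := by ring
      _ ≤ _ := mul_le_mul_of_nonneg_left h1 (by positivity)
  nlinarith [mul_le_mul_of_nonneg_left h2 hV.le]

/-- The maximum norm of a polynomial on a cell is controlled by its `L²` norm. -/
lemma exists_volume_mul_sq_le_integral (d p : ℕ) : ∃ C : ℝ, 0 < C ∧ ∀ T : Finset (E d), IsCell T →
    ∀ P ∈ Poly d p, ∀ x ∈ hull T,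
      volume.real (hull T) * ev P x ^ 2 ≤ C * ∫ z in hull T, ev P z ^ 2 := by
  obtain ⟨C, hC, h⟩ := exists_inverse d d p
  refine ⟨C, hC, fun T hT P hP x hx => ?_⟩
  have := h T hT.card hT.indep P hP x hx
  rwa [EuclideanSpace.euclideanHausdorffMeasure_eq_volume] at this

/-- Upper bound of the contribution of a cell by the maximum norm. -/
lemma cellTerm_le (hd : 1 ≤ d) {M : Mesh d} {T : Finset (E d)} (hT : T ∈ M.cells) {lam : Skel d}
    {B : ℝ} (h : ∀ F ∈ M.sidesOf T, ∀ x ∈ hull F, lam F x ^ 2 ≤ B) :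
    cellTerm M lam T ≤ volume.real (hull T) * B := by
  have hS := Mesh.sum_sides_pos hd hT
  rw [cellTerm, div_mul_eq_mul_div, div_le_iff₀ hS, mul_assoc]
  refine mul_le_mul_of_nonneg_left ?_ measureReal_nonneg
  rw [Finset.mul_sum]
  refine Finset.sum_le_sum fun F hF => ?_
  rw [sideInt_one]
  refine (le_abs_self _).trans ?_
  rw [← Real.norm_eq_abs]
  refine norm_setIntegral_le_of_norm_le_const (Mesh.side_measure hd (Mesh.mem_sidesOf.1 hF).1).2
    fun x hx => ?_
  rw [Real.norm_eq_abs, abs_mul_self, ← sq]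
  exact h F hF x hx

/-! ### Volumes of patches -/

/-- The intersection lies in the affine span of the common vertices. Two different cells share too
few vertices for this to be the whole space, and proper affine subspaces are null sets. -/
lemma hull_inter_null {M : Mesh d} {T T' : Finset (E d)} (hT : T ∈ M.cells) (hT' : T' ∈ M.cells)
    (hne : T ≠ T') : volume (hull T ∩ hull T') = 0 := by
  have h1 : hull T ∩ hull T' ⊆ (affineSpan ℝ ((T ∩ T' : Finset (E d)) : Set (E d)) : Set (E d)) := by
    rintro x ⟨hx, hx'⟩
    exact convexHull_subset_affineSpan _
      (Mesh.mem_hull_inter (Mesh.mem_cells.1 hT).1 (Mesh.mem_cells.1 hT').1 hx hx')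
  refine measure_mono_null h1 (Measure.addHaar_affineSubspace _ _ fun htop => ?_)
  have h2 := (M.complex.indep (Mesh.mem_cells.1 hT).1).card_le_card_of_subset_affineSpan
    (s := T) (t := T ∩ T') (by rw [htop]; exact fun _ _ => trivial)
  have h3 : T ∩ T' = T := Finset.eq_of_subset_of_card_le Finset.inter_subset_left h2
  refine hne (Finset.eq_of_subset_of_card_le (Finset.inter_eq_left.1 h3) ?_)
  rw [(Mesh.mem_cells.1 hT).2, (Mesh.mem_cells.1 hT').2]

lemma sum_volume_le {M : Mesh d} {A : Finset (Finset (E d))} (hA : A ⊆ M.cells) {B : Set (E d)}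
    (hB : volume B ≠ ⊤) (h : ∀ T ∈ A, hull T ⊆ B) : ∑ T ∈ A, volume.real (hull T) ≤ volume.real B := by
  rw [← measureReal_biUnion_finset₀ ?_ ?_ fun T _ => (hull_isCompact T).measure_lt_top.ne]
  · exact measureReal_mono (Set.iUnion₂_subset h) hB
  · intro T hT T' hT' hne
    exact hull_inter_null (hA hT) (hA hT') hne
  · exact fun T _ => (hull_isCompact T).measurableSet.nullMeasurableSet

lemma diam_le_size {M : Mesh d} {T : Finset (E d)} (hT : T ∈ M.cells) :
    Metric.diam (hull T) ≤ M.size :=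
  le_csSup ((M.cells.finite_toSet.image _).bddAbove) ⟨T, hT, rfl⟩

/-- The cells which touch the cell `T`. -/
def patch (M : Mesh d) (T : Finset (E d)) : Finset (Finset (E d)) :=
  M.cells.filter fun T' => (hull T ∩ hull T').Nonempty

lemma mem_patch {M : Mesh d} {T T' : Finset (E d)} :
    T' ∈ patch M T ↔ T' ∈ M.cells ∧ (hull T ∩ hull T').Nonempty := by simp [patch]

/-- Shape regularity and quasi-uniformity of a mesh. -/
structure Regular (ρ κ : ℝ) (M : Mesh d) : Prop where
  ball : ∀ T ∈ M.cells, ∃ z, Metric.closedBall z (ρ * Metric.diam (hull T)) ⊆ hull T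
  diam : ∀ T ∈ M.cells, κ * M.size ≤ Metric.diam (hull T)

/-- With mesh size `h`, the touching cells lie in a ball of radius `2h` about a vertex of `T`, and
`T` contains a ball of radius `ρ κ h`. Comparing volumes avoids counting neighbours. -/
lemma sum_patch_volume_le (hd : 1 ≤ d) {ρ κ : ℝ} (hρ : 0 < ρ) (hκ : 0 < κ) {M : Mesh d}
    (hM : Regular ρ κ M) {T : Finset (E d)} (hT : T ∈ M.cells) :
    ∑ T' ∈ patch M T, volume.real (hull T') ≤ (2 / (ρ * κ)) ^ d * volume.real (hull T) := by
  obtain ⟨x, hx⟩ := Mesh.cell_nonempty hT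
  have hh : 0 < M.size := ((Mesh.isCell hT).diam_pos hd).trans_le (diam_le_size hT)
  have hxT := vertex_mem_hull hx
  have h1 : ∑ T' ∈ patch M T, volume.real (hull T') ≤
      volume.real (Metric.closedBall x (2 * M.size)) := by
    refine sum_volume_le (Finset.filter_subset _ _) measure_closedBall_lt_top.ne fun T' hT' y hy => ?_
    obtain ⟨hT'c, w, hwT, hwT'⟩ := mem_patch.1 hT'
    rw [Metric.mem_closedBall]
    have a1 := Metric.dist_le_diam_of_mem (hull_isBounded T') hy hwT'
    have a2 := Metric.dist_le_diam_of_mem (hull_isBounded T) hwT hxT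
    linarith [dist_triangle y w x, diam_le_size hT, diam_le_size hT'c]
  obtain ⟨z, hz⟩ := hM.ball T hT
  have h2 : volume.real (Metric.closedBall z (ρ * (κ * M.size))) ≤ volume.real (hull T) := by
    refine measureReal_mono ((Metric.closedBall_subset_closedBall ?_).trans hz)
      (hull_isCompact T).measure_lt_top.ne
    exact mul_le_mul_of_nonneg_left (hM.diam T hT) hρ.le
  rw [Measure.addHaar_real_closedBall _ _ (by positivity)] at h1 h2
  simp only [finrank_euclideanSpace, Fintype.card_fin] at h1 h2
  refine h1.trans (le_trans (le_of_eq ?_) (mul_le_mul_of_nonneg_left h2 (by positivity)))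
  rw [← mul_assoc, ← mul_pow]
  congr 2
  field_simp

/-! ### Boundary values of functions in `H¹₀` -/

/-- Jensen's inequality on the unit interval, a probability space. -/
lemma lintegral_unit_sq_le (f : ℝ → ℝ) (hf : Continuous f) :
    ‖∫ t in (0 : ℝ)..1, f t‖ₑ ^ 2 ≤ ∫⁻ t in Set.Ioc (0 : ℝ) 1, ‖f t‖ₑ ^ 2 := by
  have : IsProbabilityMeasure ((volume : Measure ℝ).restrict (Set.Ioc 0 1)) := ⟨by simp⟩
  have h1 : ‖∫ t in (0 : ℝ)..1, f t‖ₑ ≤ eLpNorm f 2 (volume.restrict (Set.Ioc 0 1)) := by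
    rw [intervalIntegral.integral_of_le zero_le_one]
    refine (enorm_integral_le_lintegral_enorm _).trans ?_
    rw [← eLpNorm_one_eq_lintegral_enorm]
    exact eLpNorm_le_eLpNorm_of_exponent_le (by norm_num) hf.aestronglyMeasurable
  have h2 := eLpNorm_nnreal_pow_eq_lintegral (μ := (volume : Measure ℝ).restrict (Set.Ioc 0 1))
    (f := f) (p := 2) (by norm_num)
  have h3 : eLpNorm f 2 (volume.restrict (Set.Ioc 0 1)) ^ 2 =
      ∫⁻ t in Set.Ioc (0 : ℝ) 1, ‖f t‖ₑ ^ 2 := by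
    simpa only [NNReal.coe_ofNat, ENNReal.rpow_ofNat, ENNReal.coe_ofNat] using h2
  rw [← h3]
  gcongr

/-- The `L²` norm of a difference quotient is bounded by that of the gradient. -/
lemma eLpNorm_translate_sub_le {φ : E d → ℝ} (hφ : ContDiff ℝ (⊤ : ℕ∞) φ) (h : E d) :
    eLpNorm (fun x => φ (x + h) - φ x) 2 volume ≤ ‖h‖ₑ * eLpNorm (gradient φ) 2 volume := by
  have hdiff : Differentiable ℝ φ := hφ.differentiable (by simp)
  have hfd : Continuous (fderiv ℝ φ) := hφ.continuous_fderiv (by simp)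
  have hgn : ∀ x, ‖gradient φ x‖ₑ = ‖fderiv ℝ φ x‖ₑ := by
    intro x
    rw [← toDual_gradient]
    exact (enorm_eq_iff_norm_eq.2 (LinearIsometryEquiv.norm_map _ _)).symm
  have hsq : ∀ {F : Type} [NormedAddCommGroup F] (f : E d → F),
      eLpNorm f 2 volume ^ 2 = ∫⁻ x, ‖f x‖ₑ ^ 2 := by
    intro F _ f
    have := eLpNorm_nnreal_pow_eq_lintegral (μ := (volume : Measure (E d))) (f := f) (p := 2)
      (by norm_num)
    simpa only [NNReal.coe_ofNat, ENNReal.rpow_ofNat, ENNReal.coe_ofNat] using this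
  have hpt : ∀ x, ‖φ (x + h) - φ x‖ₑ ^ 2 ≤
      ∫⁻ t in Set.Ioc (0 : ℝ) 1, ‖fderiv ℝ φ (x + t • h) h‖ₑ ^ 2 := by
    intro x
    have hc : Continuous fun t : ℝ => fderiv ℝ φ (x + t • h) h := by fun_prop
    have hder : ∀ t : ℝ, HasDerivAt (fun t : ℝ => φ (x + t • h)) (fderiv ℝ φ (x + t • h) h) t := by
      intro t
      have h1 : HasDerivAt (fun t : ℝ => x + t • h) h t := by
        simpa using ((hasDerivAt_id t).smul_const h).const_add x
      exact (hdiff (x + t • h)).hasFDerivAt.comp_hasDerivAt t h1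
    have h1 := intervalIntegral.integral_eq_sub_of_hasDerivAt (a := 0) (b := 1)
      (fun t _ => hder t) (hc.intervalIntegrable 0 1)
    simp only [one_smul, zero_smul, add_zero] at h1
    rw [← h1]
    exact lintegral_unit_sq_le _ hc
  refine (ENNReal.pow_le_pow_left_iff (n := 2) (by norm_num)).1 ?_
  rw [mul_pow, hsq, hsq]
  -- After the fundamental theorem of calculus along the segment, Tonelli puts the `x` integral
  -- inside, where the shift by `t • h` disappears by translation invariance.
  calc ∫⁻ x, ‖φ (x + h) - φ x‖ₑ ^ 2
      ≤ ∫⁻ x, ∫⁻ t in Set.Ioc (0 : ℝ) 1, ‖fderiv ℝ φ (x + t • h) h‖ₑ ^ 2 := lintegral_mono hpt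
    _ = ∫⁻ t in Set.Ioc (0 : ℝ) 1, ∫⁻ x, ‖fderiv ℝ φ (x + t • h) h‖ₑ ^ 2 := by
        refine lintegral_lintegral_swap ?_
        have : Continuous (Function.uncurry fun (x : E d) (t : ℝ) =>
            ‖fderiv ℝ φ (x + t • h) h‖ₑ ^ 2) := by
          have h1 : Continuous fun q : E d × ℝ => fderiv ℝ φ (q.1 + q.2 • h) h := by fun_prop
          exact (ENNReal.continuous_pow 2).comp h1.enorm
        exact this.measurable.aemeasurable
    _ ≤ ∫⁻ _t in Set.Ioc (0 : ℝ) 1, ‖h‖ₑ ^ 2 * ∫⁻ x, ‖gradient φ x‖ₑ ^ 2 := by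
        refine lintegral_mono fun t => ?_
        have h1 : ∀ x, ‖fderiv ℝ φ (x + t • h) h‖ₑ ^ 2 ≤ ‖h‖ₑ ^ 2 * ‖gradient φ (x + t • h)‖ₑ ^ 2 := by
          intro x
          rw [hgn, ← mul_pow, mul_comm]
          gcongr
          exact ContinuousLinearMap.le_opENorm _ _
        refine (lintegral_mono h1).trans ?_
        rw [lintegral_const_mul' _ _ (by simp),
          lintegral_add_right_eq_self (fun x => ‖gradient φ x‖ₑ ^ 2) (t • h)]
    _ = ‖h‖ₑ ^ 2 * ∫⁻ x, ‖gradient φ x‖ₑ ^ 2 := by simp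

/-- The extension by zero of a function in `H¹₀(Ω)` has `L²` bounded difference quotients. -/
lemma MemH10.exists_translate_le {Ω : Set (E d)} (hΩ : IsOpen Ω) {w : E d → ℝ} (hw : MemH10 Ω w) :
    ∃ C : ℝ, 0 ≤ C ∧ ∀ (h : E d) (D : Set (E d)) (m : ℝ), 0 ≤ m → volume D ≠ ⊤ →
      (∀ x ∈ D, m ≤ |Ω.indicator w (x + h) - Ω.indicator w x|) →
      m ^ 2 * volume.real D ≤ (‖h‖ * C) ^ 2 := by
  obtain ⟨hwL, g, φ, hg, hφ, hlim, hglim⟩ := hw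
  set W := Ω.indicator w with hW
  have hWm : AEStronglyMeasurable W volume :=
    (aestronglyMeasurable_indicator_iff hΩ.measurableSet).2 hwL.1
  have hsupp : ∀ n x, x ∉ Ω → φ n x = 0 := fun n x hx =>
    image_eq_zero_of_notMem_tsupport fun h => hx ((hφ n).2.2 h)
  have hgsupp : ∀ n x, x ∉ Ω → gradient (φ n) x = 0 := by
    intro n x hx
    have h1 : φ n =ᶠ[𝓝 x] fun _ => 0 :=
      notMem_tsupport_iff_eventuallyEq.1 fun h => hx ((hφ n).2.2 h)
    rw [h1.gradient_eq, gradient_fun_const]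
  have h1 : ∀ n, eLpNorm (φ n - W) 2 volume = eLpNorm (φ n - w) 2 (volume.restrict Ω) := by
    intro n
    rw [← eLpNorm_indicator_eq_eLpNorm_restrict hΩ.measurableSet]
    congr 1
    ext x
    by_cases hx : x ∈ Ω
    · simp [hW, hx]
    · simp [hW, hx, hsupp n x hx]
  have h2 : ∀ n, eLpNorm (gradient (φ n)) 2 volume =
      eLpNorm (gradient (φ n)) 2 (volume.restrict Ω) := by
    intro n
    refine (eLpNorm_restrict_eq_of_support_subset fun x hx => ?_).symm
    by_contra hxΩ
    exact hx (hgsupp n x hxΩ)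
  have hφm : ∀ n, AEStronglyMeasurable (φ n) volume := fun n =>
    (hφ n).1.continuous.aestronglyMeasurable
  have hgm : ∀ n, AEStronglyMeasurable (gradient (φ n)) (volume.restrict Ω) := by
    intro n
    have : Continuous (gradient (φ n)) :=
      (LinearIsometryEquiv.continuous _).comp ((hφ n).1.continuous_fderiv (by simp))
    exact this.aestronglyMeasurable
  set G := eLpNorm g 2 (volume.restrict Ω) with hG
  have hGtop : G ≠ ⊤ := hg.2.ne
  have hmain : ∀ h : E d, eLpNorm (fun x => W (x + h) - W x) 2 volume ≤ ‖h‖ₑ * G := by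
    intro h
    have hmp := measurePreserving_add_right (volume : Measure (E d)) h
    have hbound : ∀ n, eLpNorm (fun x => W (x + h) - W x) 2 volume ≤
        eLpNorm (φ n - w) 2 (volume.restrict Ω) + eLpNorm (φ n - w) 2 (volume.restrict Ω) +
          ‖h‖ₑ * (eLpNorm (gradient (φ n) - g) 2 (volume.restrict Ω) + G) := by
      intro n
      -- Replacing `W` by `φ n` costs two copies of `φ n - W`, which tend to zero. As `φ n` vanishes
      -- outside `Ω`, norms over `Ω` and over the whole space agree.
      have e1 : (fun x => W (x + h) - W x) =
          ((φ n - W) - (φ n - W) ∘ (fun x => x + h)) + fun x => φ n (x + h) - φ n x := by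
        ext x
        simp only [Pi.add_apply, Pi.sub_apply, Function.comp_apply]
        ring
      have m1 : AEStronglyMeasurable (φ n - W) volume := (hφm n).sub hWm
      have m2 : AEStronglyMeasurable ((φ n - W) ∘ (fun x => x + h)) volume :=
        m1.comp_measurePreserving hmp
      have m3 : AEStronglyMeasurable (fun x => φ n (x + h) - φ n x) volume :=
        ((hφm n).comp_measurePreserving hmp).sub (hφm n)
      rw [e1]
      refine (eLpNorm_add_le (m1.sub m2) m3 (by norm_num)).trans (add_le_add ?_ ?_)
      · refine (eLpNorm_sub_le m1 m2 (by norm_num)).trans (le_of_eq ?_)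
        rw [eLpNorm_comp_measurePreserving m1 hmp, h1]
      · refine (eLpNorm_translate_sub_le (hφ n).1 h).trans ?_
        rw [h2]
        gcongr
        have e2 : gradient (φ n) = (gradient (φ n) - g) + g := by simp
        conv_lhs => rw [e2]
        exact eLpNorm_add_le ((hgm n).sub hg.1) hg.1 (by norm_num)
    have hl : Tendsto (fun n => eLpNorm (φ n - w) 2 (volume.restrict Ω) +
        eLpNorm (φ n - w) 2 (volume.restrict Ω) +
          ‖h‖ₑ * (eLpNorm (gradient (φ n) - g) 2 (volume.restrict Ω) + G)) atTop
        (𝓝 (0 + 0 + ‖h‖ₑ * (0 + G))) :=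
      (hlim.add hlim).add (ENNReal.Tendsto.const_mul (hglim.add tendsto_const_nhds)
        (Or.inr (by simp)))
    simpa using ge_of_tendsto' hl hbound
  refine ⟨G.toReal, ENNReal.toReal_nonneg, fun h D m hm hD hmD => ?_⟩
  have hF : AEStronglyMeasurable (fun x => W (x + h) - W x) volume :=
    (hWm.comp_measurePreserving (measurePreserving_add_right volume h)).sub hWm
  -- Chebyshev's inequality turns the `L²` bound into a bound on the measure of the set where the
  -- difference is at least `m`.
  have h3 := mul_meas_ge_le_pow_eLpNorm (p := 2) volume (by norm_num) (by norm_num) hF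
    (ENNReal.ofReal (m ^ 2))
  have h4 : D ⊆ {x | ENNReal.ofReal (m ^ 2) ≤ ‖W (x + h) - W x‖ₑ ^ (2 : ENNReal).toReal} := by
    intro x hx
    rw [Set.mem_ofPred_eq, Real.enorm_eq_ofReal_abs, ENNReal.toReal_ofNat, ENNReal.rpow_ofNat,
      ← ENNReal.ofReal_pow (abs_nonneg _)]
    refine ENNReal.ofReal_le_ofReal ?_
    have := hmD x hx
    gcongr
  have h5 : ENNReal.ofReal (m ^ 2) * volume D ≤ (‖h‖ₑ * G) ^ 2 := by
    calc _ ≤ _ := mul_le_mul_right (measure_mono h4) _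
      _ ≤ _ := h3
      _ ≤ _ := by
        rw [ENNReal.toReal_ofNat, ENNReal.rpow_ofNat]
        gcongr
        exact hmain h
  have h6 := ENNReal.toReal_mono (by finiteness) h5
  rw [ENNReal.toReal_mul, ENNReal.toReal_ofReal (by positivity), ENNReal.toReal_pow,
    ENNReal.toReal_mul, toReal_enorm] at h6
  exact h6

/-! ### Vanishing boundary values by a thin layer argument. -/

/-- The part of a cell near the face opposite to the vertex `a` has a volume of order at least
the thickness of the layer. -/
lemma volume_layer_ge (hd : 1 ≤ d) {T : Finset (E d)} (hT : IsCell T) {a y : E d} (ha : a ∈ T)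
    {r s : ℝ} (hr : 0 < r) (hs0 : 0 < s) (hs1 : s < 1) :
    r ^ d * (s * volume.real (interior (hull T))) ≤
      volume.real (AffineMap.homothety y r '' {u ∈ interior (hull T) | bc T a u ≤ s}) := by
  set U := interior (hull T) with hU
  set H := AffineMap.homothety a (1 - s) '' U with hH
  have hUfin : volume U ≠ ⊤ :=
    ((measure_mono interior_subset).trans_lt (hull_isCompact T).measure_lt_top).ne
  -- Shrinking towards `a` by the factor `1 - s` sends the coordinate `t` of `a` to `s + (1 - s) t`,
  -- so every interior point with coordinate above `s` lies in `H`. The layer has at least the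
  -- fraction `1 - (1 - s)^d ≥ s` of the volume.
  have hsub : U \ H ⊆ {u ∈ U | bc T a u ≤ s} := by
    rintro u ⟨huU, huH⟩
    refine ⟨huU, ?_⟩
    by_contra! hgt
    refine huH ⟨AffineMap.homothety a (1 - s)⁻¹ u, ?_, ?_⟩
    · rw [hU, hT.mem_interior]
      intro v hv
      have h1 : bc T v (AffineMap.homothety a (1 - s)⁻¹ u) =
          (1 - s)⁻¹ * (bc T v u - bc T v a) + bc T v a := by
        rw [AffineMap.homothety_eq_lineMap, AffineMap.apply_lineMap, AffineMap.lineMap_apply]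
        simp
      have hs2 : 0 < 1 - s := by linarith
      rw [h1]
      rcases eq_or_ne v a with rfl | hva
      · rw [hT.bc_self hv]
        have : (1 - s)⁻¹ * (bc T v u - 1) + 1 = (1 - s)⁻¹ * (bc T v u - s) := by
          field_simp; ring
        rw [this]
        have : 0 < bc T v u - s := by linarith
        positivity
      · rw [hT.bc_ne hv ha (Ne.symm hva), sub_zero, add_zero]
        have := hT.mem_interior.1 huU v hv
        positivity
    · rw [← AffineMap.comp_apply, ← AffineMap.homothety_mul, mul_inv_cancel₀ (by linarith),
        AffineMap.homothety_one]
      rfl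
  have h1 : volume.real U ≤ volume.real {u ∈ U | bc T a u ≤ s} + volume.real H := by
    have h2 : volume H ≠ ⊤ := by
      rw [hH, Measure.addHaar_image_homothety]
      exact ENNReal.mul_ne_top (by simp) hUfin
    calc volume.real U ≤ volume.real ({u ∈ U | bc T a u ≤ s} ∪ H) := by
          refine measureReal_mono (fun u hu => ?_) ?_
          · by_cases h : u ∈ H
            · exact Or.inr h
            · exact Or.inl (hsub ⟨hu, h⟩)
          · refine (measure_union_lt_top ?_ h2.lt_top).ne
            exact (measure_mono (Set.sep_subset _ _)).trans_lt hUfin.lt_top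
      _ ≤ _ := measureReal_union_le _ _
  have hreal : ∀ (z : E d) (c : ℝ) (S : Set (E d)), 0 ≤ c →
      volume.real (AffineMap.homothety z c '' S) = c ^ d * volume.real S := by
    intro z c S hc
    rw [measureReal_def, Measure.addHaar_image_homothety, ENNReal.toReal_mul,
      ENNReal.toReal_ofReal (abs_nonneg _), finrank_euclideanSpace, Fintype.card_fin,
      abs_of_nonneg (by positivity)]
    rfl
  rw [hH, hreal _ _ _ (by linarith)] at h1
  rw [hreal _ _ _ hr.le]
  refine mul_le_mul_of_nonneg_left ?_ (by positivity)
  have h3 : (1 - s) ^ d ≤ 1 - s := by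
    calc (1 - s) ^ d ≤ (1 - s) ^ 1 := pow_le_pow_of_le_one (by linarith) (by linarith) hd
      _ = _ := pow_one _
  nlinarith [mul_le_mul_of_nonneg_right h3 (measureReal_nonneg (μ := volume) (s := U))]

/-- For small `s` a linear term beats a quadratic one. Here the linear term is the volume of a layer
and the quadratic one the squared shift. -/
lemma not_forall_le_sq {α β : ℝ} (hα : 0 < α) (hβ : 0 ≤ β) :
    ¬ ∀ s : ℝ, 0 < s → s ≤ 1 / 2 → α * s ≤ β * s ^ 2 := by
  intro h
  have hs : 0 < min (1 / 2) (α / (2 * (β + 1))) := by positivity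
  have h1 := h _ hs (min_le_left _ _)
  have h2 : min (1 / 2) (α / (2 * (β + 1))) ≤ α / (2 * (β + 1)) := min_le_right _ _
  set s := min (1 / 2) (α / (2 * (β + 1)))
  rw [le_div_iff₀ (by positivity)] at h2
  have h3 : α ≤ β * s := by
    have : s * α ≤ s * (β * s) := by nlinarith
    exact le_of_mul_le_mul_left this hs
  nlinarith

/-- Conforming finite element functions vanish on the faces in the boundary. -/
lemma Covers.eq_zero_of_frontier (hd : 1 ≤ d) {Ω : Set (E d)} {M : Mesh d} (h : Covers Ω M)
    {w : E d → ℝ} (hw : w ∈ conformingP1 Ω M) {G : Finset (E d)} (hG : G ∈ M.sides)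
    (hfr : hull G ⊆ frontier Ω) : ∀ x ∈ hull G, w x = 0 := by
  obtain ⟨hH10, hP1⟩ := hw
  obtain ⟨C, hC0, hC⟩ := hH10.exists_translate_le h.isOpen
  obtain ⟨T, hT, hGT⟩ := Mesh.exists_cell hG
  obtain ⟨a, haT, haG, -⟩ := Mesh.exists_apex hT hG hGT
  obtain ⟨P, hP, hPe⟩ := hP1 T hT
  have hc := Mesh.isCell hT
  -- the relatively interior points
  have key : ∀ y ∈ hull G, (∀ v ∈ G, 0 < bc T v y) → w y = 0 := by
    intro y hy hpos
    by_contra hne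
    have hu := h.unique_cell hT hG hGT hy hpos (hfr hy)
    have hyT := hull_mono hGT hy
    have hay : bc T a y = 0 := ((hc.mem_hull hGT).1 hy).2 a haT haG
    set m := |w y| / 2 with hm
    have hmpos : 0 < m := by have := abs_pos.2 hne; positivity
    have hev1 : ∀ᶠ z in 𝓝 y, m < |ev P z| := by
      have hcont : ContinuousAt (fun z => |ev P z|) y := (ev_continuous P).abs.continuousAt
      refine hcont.eventually (lt_mem_nhds ?_)
      change m < |ev P y|
      rw [← hPe y hyT, hm]
      exact half_lt_self (abs_pos.2 hne)
    have hev2 := h.eventually_mem_of_unique hT hG hGT hu hy hpos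
    obtain ⟨δ, hδ, hball⟩ := Metric.eventually_nhds_iff.1 (hev1.and hev2)
    set D := Metric.diam (hull T) with hD
    have hD0 : 0 < D := hc.diam_pos hd
    -- The copy of `T` scaled by `r` towards `y` stays in `T`, and after a further shift by at most
    -- `r * D` it is still within `δ` of `y`.
    set r := min 1 (δ / (4 * D)) with hr
    have hr0 : 0 < r := by positivity
    have hr1 : r ≤ 1 := min_le_left _ _
    have hrD : r * D < δ / 2 := by
      have : r ≤ δ / (4 * D) := min_le_right _ _
      rw [le_div_iff₀ (by positivity)] at this
      linarith
    have hdist : ∀ u ∈ hull T, ‖u - y‖ ≤ D := fun u hu => by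
      rw [← dist_eq_norm]; exact Metric.dist_le_diam_of_mem (hull_isBounded T) hu hyT
    set V := volume.real (interior (hull T)) with hV
    have hVpos : 0 < V := by
      refine ENNReal.toReal_pos ?_ ?_
      · exact (isOpen_interior.measure_pos volume (Mesh.exists_interior_point hT)).ne'
      · exact ((measure_mono _root_.interior_subset).trans_lt (hull_isCompact T).measure_lt_top).ne
    -- The set `S` is a layer of the scaled copy with volume at least `r ^ d * s * V`. A shift of
    -- length at most `2 r s D` takes all of `S` out of `Ω`, where the extension by zero has dropped
    -- by at least `m`.
    refine not_forall_le_sq (α := m ^ 2 * (r ^ d * V)) (β := (2 * r * D * C) ^ 2) (by positivity)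
      (by positivity) fun s hs0 hs1 => ?_
    set S := AffineMap.homothety y r '' {u ∈ interior (hull T) | bc T a u ≤ s} with hS
    have hhom : ∀ u, AffineMap.homothety y r u = y + r • (u - y) := fun u => by
      rw [AffineMap.homothety_apply]; simp [add_comm]
    have hSfin : volume S ≠ ⊤ := by
      rw [hS, Measure.addHaar_image_homothety]
      refine ENNReal.mul_ne_top (by simp) ?_
      exact ((measure_mono ((Set.sep_subset _ _).trans _root_.interior_subset)).trans_lt
        (hull_isCompact T).measure_lt_top).ne
    have h1 := hC (-((2 * r * s) • (a - y))) S m hmpos.le hSfin ?_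
    · rw [norm_neg, norm_smul, Real.norm_of_nonneg (by positivity)] at h1
      have h2 := volume_layer_ge hd hc (y := y) haT hr0 hs0 (by linarith : s < 1)
      have h3 : m ^ 2 * (r ^ d * (s * V)) ≤ m ^ 2 * volume.real S :=
        mul_le_mul_of_nonneg_left h2 (by positivity)
      have h4 : (2 * r * s * ‖a - y‖ * C) ^ 2 ≤ (2 * r * s * D * C) ^ 2 := by
        have := hdist a (vertex_mem_hull haT)
        gcongr
      calc _ = m ^ 2 * (r ^ d * (s * V)) := by ring
        _ ≤ _ := h3.trans (h1.trans h4)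
        _ = _ := by ring
    · rintro _ ⟨u, ⟨huT, hus⟩, rfl⟩
      rw [hhom]
      have hupos := hc.mem_interior.1 huT
      set x := y + r • (u - y) with hx
      have hbx : ∀ v, bc T v x = bc T v y + r * (bc T v u - bc T v y) := by
        intro v
        rw [hx, ← hhom, AffineMap.homothety_eq_lineMap, AffineMap.apply_lineMap,
          AffineMap.lineMap_apply]
        simp [add_comm]
      have hxi : x ∈ interior (hull T) := by
        refine hc.mem_interior.2 fun v hv => ?_
        rw [hbx]
        have h1 := hc.mem_hull_self.1 hyT v hv
        have h2 := hupos v hv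
        nlinarith
      have hxy : ‖x - y‖ ≤ r * D := by
        rw [hx, add_sub_cancel_left, norm_smul, Real.norm_of_nonneg hr0.le]
        exact mul_le_mul_of_nonneg_left (hdist u (_root_.interior_subset huT)) hr0.le
      have hxΩ : x ∈ Ω := h.interior_subset hT hxi
      have hxm : m < |ev P x| := (hball (by rw [dist_eq_norm]; linarith)).1
      -- On the layer the coordinate of `a` is at most `r s`, and the shift lowers it by exactly `2
      -- r s`. The shifted point is thus outside `T`, while near `y` the closure of `Ω` is part of
      -- `T`.
      have hx' : x + -((2 * r * s) • (a - y)) ∉ Ω := by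
        intro hmem
        have hdy : dist (x + -((2 * r * s) • (a - y))) y < δ := by
          rw [dist_eq_norm]
          have e : x + -((2 * r * s) • (a - y)) - y = (x - y) - (2 * r * s) • (a - y) := by abel
          rw [e]
          refine (norm_sub_le _ _).trans_lt ?_
          rw [norm_smul, Real.norm_of_nonneg (by positivity)]
          have h1 := hdist a (vertex_mem_hull haT)
          have h2 : 2 * r * s * ‖a - y‖ ≤ r * D := by
            have : 2 * r * s ≤ r := by nlinarith
            exact mul_le_mul this h1 (norm_nonneg _) hr0.le
          linarith
        have h1 := (hball hdy).2 (subset_closure hmem)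
        have h2 := hc.mem_hull_self.1 h1 a haT
        have h3 : bc T a (x + -((2 * r * s) • (a - y))) = bc T a x - 2 * r * s := by
          have e : x + -((2 * r * s) • (a - y)) = -((2 * r * s) • (a - y)) +ᵥ x := by
            rw [vadd_eq_add, add_comm]
          have e2 : (bc T a).linear (a - y) = 1 := by
            have := (bc T a).linearMap_vsub a y
            rw [vsub_eq_sub, hay, hc.bc_self haT] at this
            simpa using this
          rw [e, AffineMap.map_vadd, map_neg, map_smul, e2]
          simp; ring
        rw [h3, hbx, hay] at h2
        nlinarith
      rw [Set.indicator_of_notMem hx', Set.indicator_of_mem hxΩ, zero_sub, abs_neg,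
        hPe x (_root_.interior_subset hxi)]
      exact hxm.le
  intro x hx
  obtain ⟨f, hf⟩ := exists_affine_of_mem_Poly_one hP
  have hb := barycenter_mem (Mesh.side_nonempty hG)
  have hwf : ∀ z ∈ hull G, w z = f z := fun z hz => by rw [hPe z (hull_mono hGT hz), hf]
  have h1 := key _ hb (barycenter_bc_pos hT hGT (Mesh.side_nonempty hG))
  -- The midpoint of `x` and the barycenter is relatively interior; an affine function vanishing
  -- there and at the barycenter vanishes at `x`.
  obtain ⟨hm1, hm2⟩ := relint_dense hT hG hGT hx (ε := 1 / 2) (by norm_num) (by norm_num)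
  have h2 := key _ hm1 hm2
  rw [hwf _ hm1, AffineMap.apply_lineMap, AffineMap.lineMap_apply_module, ← hwf _ hb, h1] at h2
  rw [hwf _ hx]
  simp only [smul_eq_mul] at h2
  linarith

/-! ### The operators map into the skeleton space -/

/-- No solvability is needed: without a local solution the default `0` is used, which is a
polynomial of the space as well. -/
lemma solU_mem {p : ℕ} (S : Method d p) (ℓ : ℕ) (M : Mesh d) (lam : Skel d) (T : Finset (E d)) :
    solU S ℓ M lam T ∈ Poly d p := by
  rw [solU, localSolution]
  split_ifs with h
  · exact S.V_le ℓ T h.choose_spec.1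
  · exact Submodule.zero_mem _

/-- The interpolation formula for the continuous extension holds in every cell containing `x`. -/
lemma contExt_eq (hd : 1 ≤ d) {p : ℕ} (hp : 1 ≤ p) (Ω : Set (E d)) (S : Method d p) (ℓ : ℕ)
    {M : Mesh d} (lam : Skel d) {T : Finset (E d)} (hT : T ∈ M.cells) {x : E d} (hx : x ∈ hull T) :
    contExt Ω S ℓ M lam x = interp T p (extNodal Ω S ℓ M lam T) x := by
  have h : ∃ T ∈ M.cells, x ∈ hull T := ⟨T, hT, hx⟩
  rw [contExt, dif_pos h]
  obtain ⟨hT', hx'⟩ := h.choose_spec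
  set T' := h.choose
  by_cases hTT : T' = T
  · rw [hTT]
  -- Both interpolants depend only on the nodal values on the common face of `T` and `T'`. Points
  -- there lie on the skeleton, where the nodal values do not refer to a cell.
  have hxs := Mesh.mem_hull_inter (Mesh.mem_cells.1 hT).1 (Mesh.mem_cells.1 hT').1 hx hx'
  rw [(Mesh.isCell hT').interp_face Finset.inter_subset_right hxs,
    (Mesh.isCell hT).interp_face Finset.inter_subset_left hxs]
  refine interp_congr hp fun y hy => ?_
  have hsub : ¬ T ⊆ T' := fun hs => hTT (Finset.eq_of_subset_of_card_le hs (by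
    rw [(Mesh.mem_cells.1 hT).2, (Mesh.mem_cells.1 hT').2])).symm
  obtain ⟨F, hF, hyF⟩ := Mesh.exists_sideOf_of_ne hd hT (Mesh.mem_cells.1 hT').1 hsub
    (hull_mono Finset.inter_subset_left hy) (hull_mono Finset.inter_subset_right hy)
  have hex : ∃ F ∈ M.sides, y ∈ hull F := ⟨F, (Mesh.mem_sidesOf.1 hF).1, hyF⟩
  simp only [extNodal, if_pos hex]

lemma exists_coarse_cell {M M' : Mesh d} (hM : Refines M M') {F : Finset (E d)}
    (hF : F ∈ M'.sides) : ∃ T ∈ M.cells, hull F ⊆ hull T :=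
  ⟨_, parentCell_spec hM hF⟩

section MapsTo

variable {Ω : Set (E d)} {M M' : Mesh d} (hΩ : Covers Ω M) (hM : Refines M M') (hd : 1 ≤ d) {p : ℕ}
include hΩ hM hd

lemma inj0_mapsTo (hp : 1 ≤ p) (S : Method d p) (ℓ : ℕ) :
    Set.MapsTo (inj0 Ω S ℓ M) (skeletonSpace p Ω M) (skeletonSpace p Ω M') := by
  intro lam _ F hF
  constructor
  · obtain ⟨T, hT, hFT⟩ := exists_coarse_cell hM hF
    obtain ⟨P, hP, hPe⟩ := (Mesh.isCell hT).exists_poly_interp subset_rfl (p := p)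
      (extNodal Ω S ℓ M lam T)
    refine ⟨P, hP, fun x hx => ?_⟩
    rw [inj0, trace, contExt_eq hd hp Ω S ℓ lam hT (hFT hx), hPe x (hFT hx)]
  · intro hfr x hx
    obtain ⟨G, hG, hFG⟩ := hΩ.exists_coarse_side hd hM hF hfr
    have hGfr := hΩ.coarse_side_subset_frontier hG hF hFG hfr
    obtain ⟨T, hT, hGT⟩ := Mesh.exists_cell hG
    rw [inj0, trace, contExt_eq hd hp Ω S ℓ lam hT (hull_mono hGT (hFG hx)),
      (Mesh.isCell hT).interp_face hGT (hFG hx), interp_congr (g := fun _ => 0) hp]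
    · simp [interp]
    · intro y hy
      rw [extNodal, if_pos ⟨G, hG, hGfr, hy⟩]

/-- New faces are never boundary faces, so only polynomiality has to be checked on them. The coarse
face containing an old boundary face is a boundary face, where `lam` vanishes. -/
lemma extendToNew_mapsTo {new : Skel d → Skel d} (hnew : ∀ lam ∈ skeletonSpace p Ω M,
    ∀ F ∈ M'.sides, ∃ P ∈ Poly d p, ∀ x ∈ hull F, new lam F x = ev P x) :
    Set.MapsTo (extendToNew M new) (skeletonSpace p Ω M) (skeletonSpace p Ω M') := by
  intro lam hlam F hF
  by_cases hold : IsOld M F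
  · obtain ⟨hG, hFG⟩ := parentSide_spec hold
    obtain ⟨⟨P, hP, hPe⟩, h0⟩ := hlam _ hG
    refine ⟨⟨P, hP, fun x hx => ?_⟩, fun hfr x hx => ?_⟩
    · rw [extendToNew, if_pos hold, hPe x (hFG hx)]
    · rw [extendToNew, if_pos hold,
        h0 (hΩ.coarse_side_subset_frontier hG hF hFG hfr) x (hFG hx)]
  · refine ⟨?_, fun hfr => absurd (hΩ.exists_coarse_side hd hM hF hfr) hold⟩
    obtain ⟨P, hP, hPe⟩ := hnew lam hlam F hF
    refine ⟨P, hP, fun x hx => ?_⟩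
    rw [extendToNew, if_neg hold, hPe x hx]

omit hΩ hM hd in
lemma linearOnNew_poly (hp : 1 ≤ p) (r : Averaging) (lam : Skel d) {F : Finset (E d)}
    (hF : F ∈ M'.sides) : ∃ P ∈ Poly d p, ∀ x ∈ hull F, linearOnNew r M lam F x = ev P x := by
  obtain ⟨K, hK, hFK⟩ := Mesh.exists_cell hF
  refine ⟨∑ v ∈ F, avg (r.patch M (parentCell M F)) lam v • affinePoly (bc K v),
    Submodule.sum_mem _ fun v _ => Submodule.smul_mem _ _ (Poly_mono hp (affinePoly_mem _)),
    fun x hx => ?_⟩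
  rw [linearOnNew, ev, map_sum]
  refine Finset.sum_congr rfl fun v hv => ?_
  rw [MvPolynomial.smul_eval, ← ev, ev_affinePoly, (Mesh.isCell hK).bary_eq hFK hx hv, mul_comm]

lemma inj1_mapsTo (hp : 1 ≤ p) (r : Averaging) :
    Set.MapsTo (inj1 r M) (skeletonSpace p Ω M) (skeletonSpace p Ω M') :=
  extendToNew_mapsTo hΩ hM hd fun lam _ _ hF => linearOnNew_poly hp r lam hF

lemma inj2_mapsTo (S : Method d p) (ℓ : ℕ) :
    Set.MapsTo (inj2 S ℓ M) (skeletonSpace p Ω M) (skeletonSpace p Ω M') :=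
  extendToNew_mapsTo hΩ hM hd fun lam _ _ _ => ⟨_, solU_mem S ℓ M lam _, fun _ _ => rfl⟩

lemma inj3_mapsTo (r : Averaging) (S : Method d p) (ℓ : ℕ) :
    Set.MapsTo (inj3 r S ℓ M) (skeletonSpace p Ω M) (skeletonSpace p Ω M') :=
  extendToNew_mapsTo hΩ hM hd fun lam _ F hF => by
    obtain ⟨K, hK, hFK⟩ := Mesh.exists_cell hF
    exact (Mesh.isCell hK).exists_poly_interp hFK _

end MapsTo

/-! ### Preservation of conforming functions -/

/-- Without a face through `x` the mean would be the junk value `0`, hence the existence hypothesis.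
-/
lemma avg_trace {A : Finset (Finset (E d))} {w : E d → ℝ} {x : E d} (h : ∃ F ∈ A, x ∈ hull F) :
    avg A (trace w) x = w x := by
  obtain ⟨F, hF, hx⟩ := h
  have hc : 0 < (A.filter fun F => x ∈ hull F).card :=
    Finset.card_pos.2 ⟨F, Finset.mem_filter.2 ⟨hF, hx⟩⟩
  rw [avg]
  simp only [trace, Finset.sum_const, nsmul_eq_mul]
  rw [mul_div_cancel_left₀]
  exact_mod_cast hc.ne'

lemma exists_affine_on {Ω : Set (E d)} {M : Mesh d} {w : E d → ℝ} (hw : w ∈ conformingP1 Ω M)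
    {T : Finset (E d)} (hT : T ∈ M.cells) : ∃ f : E d →ᵃ[ℝ] ℝ, ∀ x ∈ hull T, w x = f x := by
  obtain ⟨P, hP, hPe⟩ := hw.2 T hT
  obtain ⟨f, hf⟩ := exists_affine_of_mem_Poly_one hP
  exact ⟨f, fun x hx => by rw [hPe x hx, hf]⟩

section IA2

variable {Ω : Set (E d)} {M M' : Mesh d} (hM : Refines M M') (hd : 1 ≤ d) {p : ℕ}
include hM hd

/-- The vertices lie on the skeleton, so the means there are the values of `w`. Since `w` is affine
on the enclosing coarse cell, linear interpolation returns `w`. -/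
lemma linearOnNew_trace (hv : VerticesOnSkeleton M M') (r : Averaging) {w : E d → ℝ}
    (hw : w ∈ conformingP1 Ω M) {F : Finset (E d)} (hF : F ∈ M'.sides) {x : E d} (hx : x ∈ hull F) :
    linearOnNew r M (trace w) F x = w x := by
  obtain ⟨K, hK, hFK⟩ := Mesh.exists_cell hF
  obtain ⟨hT, hFT⟩ := parentCell_spec hM hF
  obtain ⟨f, hf⟩ := exists_affine_on hw hT
  have havg : ∀ v ∈ F, avg (r.patch M (parentCell M F)) (trace w) v = f v := by
    intro v hvF
    have hvT := hFT (vertex_mem_hull hvF)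
    obtain ⟨G, hG, hvG⟩ := hv K hK v (hFK hvF)
    rw [avg_trace, hf v hvT]
    cases r with
    | global => exact ⟨G, hG, hvG⟩
    | cellwise => exact Mesh.exists_sideOf hd hT hG hvT hvG
  rw [linearOnNew, Finset.sum_congr rfl fun v hv => by rw [havg v hv],
    (Mesh.isCell hK).sum_bary_mul hFK hx, hf x (hFT hx)]

omit hM hd in
lemma extendToNew_IA2 {new : Skel d → Skel d} (hnew : ∀ w ∈ conformingP1 Ω M,
    ∀ F ∈ M'.sides, ∀ x ∈ hull F, new (trace w) F x = w x) :
    IA2 Ω M M' (extendToNew M new) := by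
  intro w hw F hF x hx
  rw [extendToNew]
  split_ifs
  · rfl
  · exact hnew w hw F hF x hx

lemma inj1_IA2 (hv : VerticesOnSkeleton M M') (r : Averaging) : IA2 Ω M M' (inj1 r M) :=
  extendToNew_IA2 fun _ hw _ hF _ hx => linearOnNew_trace hM hd hv r hw hF hx

variable {S : Method d p} {ℓ : ℕ} (hU : ∀ w ∈ conformingP1 Ω M, ∀ T ∈ M.cells, ∀ x ∈ hull T,
  ev (solU S ℓ M (trace w) T) x = w x)
include hU

omit hd in
lemma inj2_IA2 : IA2 Ω M M' (inj2 S ℓ M) :=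
  extendToNew_IA2 fun w hw _ hF x hx =>
    hU w hw _ (parentCell_spec hM hF).1 x ((parentCell_spec hM hF).2 hx)

lemma inj3_IA2 (hp : 1 ≤ p) (hv : VerticesOnSkeleton M M') (r : Averaging) :
    IA2 Ω M M' (inj3 r S ℓ M) := by
  refine extendToNew_IA2 fun w hw F hF x hx => ?_
  obtain ⟨K, hK, hFK⟩ := Mesh.exists_cell hF
  obtain ⟨hT, hFT⟩ := parentCell_spec hM hF
  obtain ⟨f, hf⟩ := exists_affine_on hw hT
  rw [interp_congr (g := f) hp, (Mesh.isCell hK).interp_affine hFK hp hx, hf x (hFT hx)]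
  intro y hy
  rw [← hf y (hFT hy)]
  split_ifs
  · exact linearOnNew_trace hM hd hv r hw hF hy
  · exact hU w hw _ hT y (hFT hy)

/-- The nodal values of the extension are those of `w`. For the nodes on `∂Ω`, with prescribed value
`0`, this is the vanishing of `H¹₀` functions on boundary faces. -/
lemma inj0_IA2 (hp : 1 ≤ p) (hΩ : Covers Ω M) : IA2 Ω M M' (inj0 Ω S ℓ M) := by
  intro w hw F hF x hx
  obtain ⟨T, hT, hFT⟩ := exists_coarse_cell hM hF
  obtain ⟨f, hf⟩ := exists_affine_on hw hT
  have hxT := hFT hx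
  rw [inj0, trace, contExt_eq hd hp Ω S ℓ _ hT hxT, interp_congr (g := f) hp,
    (Mesh.isCell hT).interp_affine subset_rfl hp hxT, trace, hf x hxT]
  intro y hy
  rw [← hf y hy, extNodal]
  split_ifs with h1 h2
  · obtain ⟨G, hG, hfr, hyG⟩ := h1
    exact (hΩ.eq_zero_of_frontier hd hw hG hfr y hyG).symm
  · exact avg_trace h2
  · exact hU w hw T hT y hy

end IA2

/-! ### Boundedness of the operators -/

/-- The sum of the densities of `e` over the cells touching `T`. -/
def patchSum (M : Mesh d) (e : Finset (E d) → ℝ) (T : Finset (E d)) : ℝ :=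
  ∑ T' ∈ patch M T, e T' / volume.real (hull T')

section patchSum

variable {M : Mesh d} {e : Finset (E d) → ℝ} (he : ∀ T, 0 ≤ e T)
include he

lemma patchSum_nonneg (T : Finset (E d)) : 0 ≤ patchSum M e T :=
  Finset.sum_nonneg fun T' _ => div_nonneg (he T') measureReal_nonneg

lemma le_patchSum {C y : ℝ} (hC : 0 ≤ C) {T T' : Finset (E d)} (hT' : T' ∈ patch M T)
    (hy : volume.real (hull T') * y ≤ C * e T') : y ≤ C * patchSum M e T := by
  have hV := (Mesh.isCell (mem_patch.1 hT').1).volume_pos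
  have h1 : e T' / volume.real (hull T') ≤ patchSum M e T :=
    Finset.single_le_sum (f := fun T' => e T' / volume.real (hull T'))
      (fun T' _ => div_nonneg (he T') measureReal_nonneg) hT'
  refine le_trans ?_ (mul_le_mul_of_nonneg_left h1 hC)
  rw [mul_div_assoc', le_div_iff₀ hV]
  linarith

/-- Touching is symmetric, so the double sum can be exchanged. The density `e T' / |T'|` then meets
the volume of the patch of `T'`, which is at most a constant times `|T'|`. -/
lemma sum_volume_mul_patchSum_le (hd : 1 ≤ d) {ρ κ : ℝ} (hρ : 0 < ρ) (hκ : 0 < κ)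
    (hM : Regular ρ κ M) : ∑ T ∈ M.cells, volume.real (hull T) * patchSum M e T ≤
      (2 / (ρ * κ)) ^ d * ∑ T ∈ M.cells, e T := by
  simp only [patchSum, Finset.mul_sum]
  rw [Finset.sum_comm' (t' := M.cells) (s' := fun T' => patch M T')]
  · refine Finset.sum_le_sum fun T' hT' => ?_
    have hV := (Mesh.isCell hT').volume_pos
    rw [← Finset.sum_mul, mul_div_assoc', div_le_iff₀ hV]
    have := mul_le_mul_of_nonneg_right (sum_patch_volume_le hd hρ hκ hM hT') (he T')
    linarith
  · intro T T'
    simp only [mem_patch, Set.inter_comm (hull T) (hull T')]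
    tauto

end patchSum

/-- Pointwise bounds on the coarse cells imply a bound of the norm on the fine mesh. -/
lemma skelInner_le_of_pointwise (hd : 1 ≤ d) {M M' : Mesh d} (hM : Refines M M') {mu : Skel d}
    {g : Finset (E d) → ℝ} (hg : ∀ T, 0 ≤ g T)
    (h : ∀ T ∈ M.cells, ∀ F ∈ M'.sides, hull F ⊆ hull T → ∀ x ∈ hull F, mu F x ^ 2 ≤ g T) :
    skelInner M' mu mu ≤ ∑ T ∈ M.cells, volume.real (hull T) * g T := by
  -- Fine cells are grouped by one chosen coarse cell each. The groups do not overlap, and the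
  -- volumes in a group add up to at most that of its coarse cell.
  choose! par hpar hparK using hM
  rw [skelInner_eq, ← Finset.sum_fiberwise_of_maps_to hpar]
  refine Finset.sum_le_sum fun T hT => ?_
  calc _ ≤ ∑ K ∈ M'.cells with par K = T, volume.real (hull K) * g T := by
        refine Finset.sum_le_sum fun K hK => ?_
        obtain ⟨hK', rfl⟩ := Finset.mem_filter.1 hK
        refine cellTerm_le hd hK' fun F hF x hx => ?_
        rw [Mesh.mem_sidesOf] at hF
        exact h _ hT F hF.1 ((hull_mono hF.2).trans (hparK K hK')) x hx
    _ ≤ _ := by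
        rw [← Finset.sum_mul]
        refine mul_le_mul_of_nonneg_right ?_ (hg T)
        refine sum_volume_le (Finset.filter_subset _ _) (hull_isCompact T).measure_lt_top.ne ?_
        intro K hK
        obtain ⟨hK', rfl⟩ := Finset.mem_filter.1 hK
        exact hparK K hK'

/-- `lam` and the piecewise polynomial function `U` are bounded by `B` in the vicinity of `T`. -/
structure LocalBound (M : Mesh d) (lam : Skel d) (U : Finset (E d) → MvPolynomial (Fin d) ℝ)
    (T : Finset (E d)) (B : ℝ) : Prop where
  nonneg : 0 ≤ B
  side : ∀ G ∈ M.sides, (hull T ∩ hull G).Nonempty → ∀ x ∈ hull G, |lam G x| ≤ B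
  cell : ∀ T' ∈ patch M T, ∀ x ∈ hull T', |ev (U T') x| ≤ B

/-- If an operator is locally bounded in the maximum norm, then it is bounded in the norms of the
skeleton spaces. -/
lemma exists_skelInner_le (p : ℕ) (hd : 1 ≤ d) {ρ κ A : ℝ} (hρ : 0 < ρ) (hκ : 0 < κ) :
    ∃ C : ℝ, 0 ≤ C ∧ ∀ (Ω : Set (E d)) (M M' : Mesh d), Regular ρ κ M → Refines M M' →
      ∀ lam ∈ skeletonSpace p Ω M, ∀ U : Finset (E d) → MvPolynomial (Fin d) ℝ,
      (∀ T, U T ∈ Poly d p) → ∀ mu : Skel d,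
      (∀ T ∈ M.cells, ∀ B, LocalBound M lam U T B → ∀ F ∈ M'.sides, hull F ⊆ hull T →
        ∀ x ∈ hull F, |mu F x| ≤ A * B) →
      skelInner M' mu mu ≤ C * (skelInner M lam lam +
        ∑ T ∈ M.cells, ∫ x in hull T, ev (U T) x ^ 2) := by
  obtain ⟨C₁, hC₁, h₁⟩ := exists_volume_mul_sq_le_cellTerm d p hd hρ
  obtain ⟨C₂, hC₂, h₂⟩ := exists_volume_mul_sq_le_integral d p
  refine ⟨A ^ 2 * (C₁ + C₂) * (2 / (ρ * κ)) ^ d, by positivity,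
    fun Ω M M' hreg hM lam hlam U hU mu hmu => ?_⟩
  set e : Finset (E d) → ℝ := fun T => cellTerm M lam T + ∫ x in hull T, ev (U T) x ^ 2 with he
  have hint : ∀ T, 0 ≤ ∫ x in hull T, ev (U T) x ^ 2 := fun T =>
    integral_nonneg fun _ => sq_nonneg _
  have he0 : ∀ T, 0 ≤ e T := fun T => add_nonneg (cellTerm_nonneg M lam T) (hint T)
  have hps := patchSum_nonneg (M := M) he0
  have hC : 0 ≤ C₁ + C₂ := by positivity
  -- Each squared pointwise value is bounded by the energy density of one touching cell, hence by
  -- the sum of the densities over the patch.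
  have hB : ∀ T, LocalBound M lam U T (√((C₁ + C₂) * patchSum M e T)) := by
    intro T
    refine ⟨Real.sqrt_nonneg _, fun G hG hne x hx => ?_, fun T' hT' x hx => ?_⟩
    · obtain ⟨T', hT', hGT'⟩ := Mesh.exists_cell hG
      refine Real.abs_le_sqrt (le_patchSum he0 hC (T' := T') ?_ ?_)
      · exact mem_patch.2 ⟨hT', hne.mono (Set.inter_subset_inter_right _ (hull_mono hGT'))⟩
      · have h3 := h₁ Ω M lam hlam T' hT' (hreg.ball T' hT') G (Mesh.mem_sidesOf.2 ⟨hG, hGT'⟩) x hx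
        have h4 := cellTerm_nonneg M lam T'
        have h5 := hint T'
        simp only [he]
        nlinarith
    · refine Real.abs_le_sqrt (le_patchSum he0 hC hT' ?_)
      have h3 := h₂ T' (Mesh.isCell (mem_patch.1 hT').1) (U T') (hU T') x hx
      have h4 := cellTerm_nonneg M lam T'
      have h5 := hint T'
      simp only [he]
      nlinarith
  have hmain := skelInner_le_of_pointwise hd hM (mu := mu)
    (g := fun T => A ^ 2 * ((C₁ + C₂) * patchSum M e T))
    (fun T => mul_nonneg (sq_nonneg _) (mul_nonneg hC (hps T))) (fun T hT F hF hFT x hx => by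
      have h3 := hmu T hT _ (hB T) F hF hFT x hx
      have h4 := pow_le_pow_left₀ (abs_nonneg _) h3 2
      rwa [sq_abs, mul_pow, Real.sq_sqrt (mul_nonneg hC (hps T))] at h4)
  have hsum := sum_volume_mul_patchSum_le he0 hd hρ hκ hreg
  have he1 : ∑ T ∈ M.cells, e T = skelInner M lam lam +
      ∑ T ∈ M.cells, ∫ x in hull T, ev (U T) x ^ 2 := by
    rw [skelInner_eq, ← Finset.sum_add_distrib]
  rw [he1] at hsum
  refine hmain.trans ?_
  calc _ = A ^ 2 * (C₁ + C₂) * ∑ T ∈ M.cells, volume.real (hull T) * patchSum M e T := by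
        rw [Finset.mul_sum]; exact Finset.sum_congr rfl fun T _ => by ring
    _ ≤ A ^ 2 * (C₁ + C₂) * _ := mul_le_mul_of_nonneg_left hsum (by positivity)
    _ = _ := by ring

/-- The bound of the Lagrange interpolant by its nodal values. -/
def interpConst (d p : ℕ) : ℝ := (d + 1 + p).choose p * (p : ℝ) ^ p

lemma one_le_interpConst {p : ℕ} (hp : 1 ≤ p) : 1 ≤ interpConst d p := by
  have h1 : (1 : ℝ) ≤ (d + 1 + p).choose p := by
    exact_mod_cast Nat.choose_pos (by omega)
  have h2 : (1 : ℝ) ≤ (p : ℝ) ^ p := one_le_pow₀ (by exact_mod_cast hp)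
  exact one_le_mul_of_one_le_of_one_le h1 h2

lemma abs_avg_le {A : Finset (Finset (E d))} {lam : Skel d} {x : E d} {B : ℝ} (hB : 0 ≤ B)
    (h : ∀ F ∈ A, x ∈ hull F → |lam F x| ≤ B) : |avg A lam x| ≤ B := by
  rw [avg, abs_div, Nat.abs_cast]
  refine div_le_of_le_mul₀ (Nat.cast_nonneg _) hB ?_
  refine (Finset.abs_sum_le_sum_abs _ _).trans ?_
  refine (Finset.sum_le_card_nsmul _ _ B fun F hF => ?_).trans (le_of_eq ?_)
  · obtain ⟨hF, hx⟩ := Finset.mem_filter.1 hF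
    exact h F hF hx
  · rw [nsmul_eq_mul, mul_comm]

/-! ### Maximum norm bounds of the four operators on one coarse cell. -/

namespace LocalBound

variable {M M' : Mesh d} {lam : Skel d} {U : Finset (E d) → MvPolynomial (Fin d) ℝ}
  {T F : Finset (E d)} {B : ℝ} (h : LocalBound M lam U T B) {x : E d} {p : ℕ}
include h

lemma le_const (hp : 1 ≤ p) : B ≤ interpConst d p * B :=
  le_mul_of_one_le_left h.nonneg (one_le_interpConst hp)

lemma abs_avg_le {A : Finset (Finset (E d))} (hA : A ⊆ M.sides) (hx : x ∈ hull T) :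
    |avg A lam x| ≤ B :=
  HDG.abs_avg_le h.nonneg fun F hF hxF => h.side F (hA hF) ⟨x, hx, hxF⟩ x hxF

lemma abs_old_le (hFT : hull F ⊆ hull T) (hold : IsOld M F) (hx : x ∈ hull F) :
    |lam (parentSide M F) x| ≤ B := by
  obtain ⟨hG, hFG⟩ := parentSide_spec hold
  exact h.side _ hG ⟨x, hFT hx, hFG hx⟩ x (hFG hx)

lemma abs_extendToNew_le {new : Skel d → Skel d} (hp : 1 ≤ p) (hFT : hull F ⊆ hull T) (hx : x ∈ hull F) (hnew : |new lam F x| ≤ interpConst d p * B) :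
    |extendToNew M new lam F x| ≤ interpConst d p * B := by
  rw [extendToNew]
  split_ifs with hold
  · exact (h.abs_old_le hFT hold hx).trans (h.le_const hp)
  · exact hnew

lemma abs_linearOnNew_le (r : Averaging) (hF : F ∈ M'.sides) (hFT : hull F ⊆ hull T)
    (hx : x ∈ hull F) : |linearOnNew r M lam F x| ≤ B := by
  obtain ⟨K, hK, hFK⟩ := Mesh.exists_cell hF
  have hc := Mesh.isCell hK
  have hsub : r.patch M (parentCell M F) ⊆ M.sides := by
    cases r with
    | global => exact subset_rfl
    | cellwise => exact Finset.filter_subset _ _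
  rw [linearOnNew]
  calc _ ≤ ∑ v ∈ F, |bary F x v * avg (r.patch M (parentCell M F)) lam v| :=
        Finset.abs_sum_le_sum_abs _ _
    -- On the face the weights are nonnegative with sum `1`, so linear interpolation does not
    -- increase the maximum.
    _ ≤ ∑ v ∈ F, bary F x v * B := by
        refine Finset.sum_le_sum fun v hv => ?_
        have hb := hc.bary_nonneg hFK hx hv
        rw [abs_mul, abs_of_nonneg hb]
        exact mul_le_mul_of_nonneg_left (h.abs_avg_le hsub (hFT (vertex_mem_hull hv))) hb
    _ = B := by rw [← Finset.sum_mul, hc.sum_bary hFK hx, one_mul]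

lemma abs_parentCell_le (hM : Refines M M') (hF : F ∈ M'.sides) (hFT : hull F ⊆ hull T)
    (hx : x ∈ hull F) : |ev (U (parentCell M F)) x| ≤ B := by
  obtain ⟨hT', hFT'⟩ := parentCell_spec hM hF
  exact h.cell _ (mem_patch.2 ⟨hT', x, hFT hx, hFT' hx⟩) x (hFT' hx)

lemma abs_inj1_le (hp : 1 ≤ p) (r : Averaging) (hF : F ∈ M'.sides) (hFT : hull F ⊆ hull T)
    (hx : x ∈ hull F) : |inj1 r M lam F x| ≤ interpConst d p * B :=
  h.abs_extendToNew_le hp hFT hx ((h.abs_linearOnNew_le r hF hFT hx).trans (h.le_const hp))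

end LocalBound

section LocalBoundSol

variable {M M' : Mesh d} {lam : Skel d} {T F : Finset (E d)} {B : ℝ} {x : E d} {p : ℕ}
  {S : Method d p} {ℓ : ℕ} (h : LocalBound M lam (solU S ℓ M lam) T B)
include h

lemma abs_inj0_le (hd : 1 ≤ d) (hp : 1 ≤ p) (Ω : Set (E d)) (hT : T ∈ M.cells)
    (hFT : hull F ⊆ hull T) (hx : x ∈ hull F) :
    |inj0 Ω S ℓ M lam F x| ≤ interpConst d p * B := by
  rw [inj0, trace, contExt_eq hd hp Ω S ℓ lam hT (hFT hx)]
  refine (Mesh.isCell hT).abs_interp_le subset_rfl hp (hFT hx) h.nonneg fun y hy => ?_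
  rw [extNodal]
  split_ifs
  · simpa using h.nonneg
  · exact h.abs_avg_le subset_rfl hy
  · exact h.cell T (mem_patch.2 ⟨hT, y, hy, hy⟩) y hy

lemma abs_inj2_le (hM : Refines M M') (hp : 1 ≤ p) (hF : F ∈ M'.sides) (hFT : hull F ⊆ hull T)
    (hx : x ∈ hull F) : |inj2 S ℓ M lam F x| ≤ interpConst d p * B :=
  h.abs_extendToNew_le hp hFT hx ((h.abs_parentCell_le hM hF hFT hx).trans (h.le_const hp))

lemma abs_inj3_le (hM : Refines M M') (hp : 1 ≤ p) (r : Averaging) (hF : F ∈ M'.sides)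
    (hFT : hull F ⊆ hull T) (hx : x ∈ hull F) : |inj3 r S ℓ M lam F x| ≤ interpConst d p * B := by
  refine h.abs_extendToNew_le hp hFT hx ?_
  obtain ⟨K, hK, hFK⟩ := Mesh.exists_cell hF
  refine (Mesh.isCell hK).abs_interp_le hFK hp hx h.nonneg fun y hy => ?_
  split_ifs
  · exact h.abs_linearOnNew_le r hF hFT hy
  · exact h.abs_parentCell_le hM hF hFT hy

end LocalBoundSol

lemma IsMeshHierarchy.regular {Ω : Set (E d)} {L : ℕ} {M : ℕ → Mesh d} {ρ κ c : ℝ}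
    (h : IsMeshHierarchy Ω L M ρ κ c) {ℓ : ℕ} (hℓ : ℓ ≤ L) : Regular ρ κ (M ℓ) :=
  ⟨h.shape_regular ℓ hℓ, h.quasi_uniform ℓ hℓ⟩

lemma skelNorm_le {M M' : Mesh d} {lam mu : Skel d} {C : ℝ} (hC : 0 ≤ C)
    (h : skelInner M' mu mu ≤ C * skelInner M lam lam) :
    skelNorm M' mu ≤ √C * skelNorm M lam := by
  rw [skelNorm, skelNorm, ← Real.sqrt_mul hC]
  exact Real.sqrt_le_sqrt h

lemma bulkNorm_nonneg (M : Mesh d) (u : Finset (E d) → MvPolynomial (Fin d) ℝ) :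
    0 ≤ bulkNorm M u := Real.sqrt_nonneg _

/-- (IA1) for the operator `I¹`. -/
lemma exists_inj1_IA1 (hd : 1 ≤ d) {p : ℕ} (hp : 1 ≤ p) {ρ κ : ℝ} (hρ : 0 < ρ) (hκ : 0 < κ) :
    ∃ C : ℝ, ∀ (Ω : Set (E d)) (M M' : Mesh d), Regular ρ κ M → Refines M M' → ∀ r : Averaging,
      IA1 p Ω M M' (inj1 r M) C := by
  obtain ⟨C, hC, h⟩ := exists_skelInner_le (d := d) p hd (A := interpConst d p) hρ hκ
  refine ⟨√C, fun Ω M M' hreg hM r lam hlam => skelNorm_le hC ?_⟩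
  -- `I¹` does not involve the local solver, so the bulk function is taken to be zero and its term
  -- disappears.
  have := h Ω M M' hreg hM lam hlam (fun _ => 0) (fun _ => Submodule.zero_mem _) (inj1 r M lam)
    fun T _ B hB F hF hFT x hx => hB.abs_inj1_le hp r hF hFT hx
  simpa [ev] using this

/-- (IA1) for the operators `I⁰`, `I²`, `I³` if the local solvers are bounded. -/
lemma exists_inj_IA1 (hd : 1 ≤ d) {p : ℕ} (hp : 1 ≤ p) {ρ κ : ℝ} (hρ : 0 < ρ) (hκ : 0 < κ)
    (C₂ : ℝ) : ∃ C : ℝ, ∀ (Ω : Set (E d)) (M M' : Mesh d) (S : Method d p) (ℓ : ℕ),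
      Regular ρ κ M → Refines M M' → (∀ mu ∈ skeletonSpace p Ω M,
        bulkNorm M (solU S ℓ M mu) ≤ C₂ * skelNorm M mu) →
      IA1 p Ω M M' (inj0 Ω S ℓ M) C ∧ IA1 p Ω M M' (inj2 S ℓ M) C ∧
        ∀ r : Averaging, IA1 p Ω M M' (inj3 r S ℓ M) C := by
  obtain ⟨C, hC, h⟩ := exists_skelInner_le (d := d) p hd (A := interpConst d p) hρ hκ
  refine ⟨√(C * (1 + C₂ ^ 2)), fun Ω M M' S ℓ hreg hM hS => ?_⟩
  have key : ∀ lam ∈ skeletonSpace p Ω M, ∀ mu : Skel d,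
      (∀ T ∈ M.cells, ∀ B, LocalBound M lam (solU S ℓ M lam) T B → ∀ F ∈ M'.sides,
        hull F ⊆ hull T → ∀ x ∈ hull F, |mu F x| ≤ interpConst d p * B) →
      skelNorm M' mu ≤ √(C * (1 + C₂ ^ 2)) * skelNorm M lam := by
    intro lam hlam mu hmu
    refine skelNorm_le (by positivity) ?_
    have h1 := h Ω M M' hreg hM lam hlam _ (solU_mem S ℓ M lam) mu hmu
    -- Squaring needs only that the bulk norm is nonnegative, so `C₂` may be any real number. The
    -- squared bulk norm contributes `C₂ ^ 2` to the factor `1 + C₂ ^ 2`.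
    have h2 := pow_le_pow_left₀ (bulkNorm_nonneg M _) (hS lam hlam) 2
    rw [bulkNorm, Real.sq_sqrt (Finset.sum_nonneg fun T _ => integral_nonneg fun _ => sq_nonneg _),
      mul_pow, skelNorm_sq] at h2
    refine h1.trans ?_
    rw [mul_assoc]
    refine mul_le_mul_of_nonneg_left ?_ hC
    linarith
  refine ⟨fun lam hlam => key lam hlam _ ?_, fun lam hlam => key lam hlam _ ?_,
    fun r lam hlam => key lam hlam _ ?_⟩
  · exact fun T hT B hB F _ hFT x hx => abs_inj0_le hB hd hp Ω hT hFT hx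
  · exact fun T _ B hB F hF hFT x hx => abs_inj2_le hB hM hp hF hFT hx
  · exact fun T _ B hB F hF hFT x hx => abs_inj3_le hB hM hp r hF hFT hx

end HDG

end

theorem mainTheorem4 (d p : ℕ) (hd : 2 ≤ d) (hp : 1 ≤ p) (ρ κ c : ℝ)
    (hρ : 0 < ρ) (hκ : 0 < κ) (hc : 0 < c) :
    -- the four operators map `M_ℓ` to `M_{ℓ+1}`
    (∀ (L : ℕ) (Ω : Set (HDG.E d)) (M : ℕ → HDG.Mesh d) (S : HDG.Method d p),
      HDG.IsMeshHierarchy Ω L M ρ κ c → ∀ ℓ < L,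
        Set.MapsTo (HDG.inj0 Ω S ℓ (M ℓ))
          (HDG.skeletonSpace p Ω (M ℓ)) (HDG.skeletonSpace p Ω (M (ℓ + 1))) ∧
        Set.MapsTo (HDG.inj2 S ℓ (M ℓ))
          (HDG.skeletonSpace p Ω (M ℓ)) (HDG.skeletonSpace p Ω (M (ℓ + 1))) ∧
        (HDG.VerticesOnSkeleton (M ℓ) (M (ℓ + 1)) → ∀ r : HDG.Averaging,
          Set.MapsTo (HDG.inj1 r (M ℓ))
            (HDG.skeletonSpace p Ω (M ℓ)) (HDG.skeletonSpace p Ω (M (ℓ + 1))) ∧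
          Set.MapsTo (HDG.inj3 r S ℓ (M ℓ))
            (HDG.skeletonSpace p Ω (M ℓ)) (HDG.skeletonSpace p Ω (M (ℓ + 1))))) ∧
    -- (IA1) for the operator `I¹`
    (∃ C : ℝ, ∀ (L : ℕ) (Ω : Set (HDG.E d)) (M : ℕ → HDG.Mesh d),
      HDG.IsMeshHierarchy Ω L M ρ κ c → ∀ ℓ < L,
        HDG.VerticesOnSkeleton (M ℓ) (M (ℓ + 1)) → ∀ r : HDG.Averaging,
          HDG.IA1 p Ω (M ℓ) (M (ℓ + 1)) (HDG.inj1 r (M ℓ)) C) ∧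
    -- (IA1) for the operators `I⁰`, `I²` and `I³` under (LS2)
    (∀ C₂ : ℝ, ∃ C : ℝ, ∀ (L : ℕ) (Ω : Set (HDG.E d)) (M : ℕ → HDG.Mesh d) (S : HDG.Method d p),
      HDG.IsMeshHierarchy Ω L M ρ κ c → HDG.LS2 Ω L M S C₂ → ∀ ℓ < L,
        HDG.IA1 p Ω (M ℓ) (M (ℓ + 1)) (HDG.inj0 Ω S ℓ (M ℓ)) C ∧
        HDG.IA1 p Ω (M ℓ) (M (ℓ + 1)) (HDG.inj2 S ℓ (M ℓ)) C ∧
        (HDG.VerticesOnSkeleton (M ℓ) (M (ℓ + 1)) → ∀ r : HDG.Averaging,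
          HDG.IA1 p Ω (M ℓ) (M (ℓ + 1)) (HDG.inj3 r S ℓ (M ℓ)) C)) ∧
    -- (IA2) for the operator `I¹`
    (∀ (L : ℕ) (Ω : Set (HDG.E d)) (M : ℕ → HDG.Mesh d),
      HDG.IsMeshHierarchy Ω L M ρ κ c → ∀ ℓ < L,
        HDG.VerticesOnSkeleton (M ℓ) (M (ℓ + 1)) → ∀ r : HDG.Averaging,
          HDG.IA2 Ω (M ℓ) (M (ℓ + 1)) (HDG.inj1 r (M ℓ))) ∧
    -- (IA2) for the operators `I⁰`, `I²` and `I³` under (LS4)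
    (∀ (L : ℕ) (Ω : Set (HDG.E d)) (M : ℕ → HDG.Mesh d) (S : HDG.Method d p),
      HDG.IsMeshHierarchy Ω L M ρ κ c → HDG.LS4 Ω L M S → ∀ ℓ < L,
        HDG.IA2 Ω (M ℓ) (M (ℓ + 1)) (HDG.inj0 Ω S ℓ (M ℓ)) ∧
        HDG.IA2 Ω (M ℓ) (M (ℓ + 1)) (HDG.inj2 S ℓ (M ℓ)) ∧
        (HDG.VerticesOnSkeleton (M ℓ) (M (ℓ + 1)) → ∀ r : HDG.Averaging,
          HDG.IA2 Ω (M ℓ) (M (ℓ + 1)) (HDG.inj3 r S ℓ (M ℓ)))) := by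
  have hd1 : 1 ≤ d := by omega
  refine ⟨?_, ?_, ?_, ?_, ?_⟩
  · intro L Ω M S h ℓ hℓ
    have hΩ := h.covers hℓ.le
    have hM := h.refines' hℓ
    exact ⟨HDG.inj0_mapsTo hΩ hM hd1 hp S ℓ, HDG.inj2_mapsTo hΩ hM hd1 S ℓ, fun _ r =>
      ⟨HDG.inj1_mapsTo hΩ hM hd1 hp r, HDG.inj3_mapsTo hΩ hM hd1 r S ℓ⟩⟩
  · obtain ⟨C, hC⟩ := HDG.exists_inj1_IA1 hd1 hp hρ hκ
    exact ⟨C, fun L Ω M h ℓ hℓ _ r => hC Ω _ _ (h.regular hℓ.le) (h.refines' hℓ) r⟩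
  · intro C₂
    obtain ⟨C, hC⟩ := HDG.exists_inj_IA1 hd1 hp hρ hκ C₂
    refine ⟨C, fun L Ω M S h hS ℓ hℓ => ?_⟩
    obtain ⟨h0, h2, h3⟩ := hC Ω _ _ S ℓ (h.regular hℓ.le) (h.refines' hℓ)
      fun mu hmu => (hS ℓ hℓ.le mu hmu).2
    exact ⟨h0, h2, fun _ => h3⟩
  · exact fun L Ω M h ℓ hℓ hv r => HDG.inj1_IA2 (h.refines' hℓ) hd1 hv r
  · intro L Ω M S h hS ℓ hℓ
    have hM := h.refines' hℓ
    have hU : ∀ w ∈ HDG.conformingP1 Ω (M ℓ), ∀ T ∈ (M ℓ).cells, ∀ x ∈ HDG.hull T,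
        HDG.ev (HDG.solU S ℓ (M ℓ) (HDG.trace w) T) x = w x :=
      fun w hw T hT => (hS ℓ hℓ.le w hw T hT).2
    exact ⟨HDG.inj0_IA2 hM hd1 hU hp (h.covers hℓ.le), HDG.inj2_IA2 hM hU,
      fun hv r => HDG.inj3_IA2 hM hd1 hU hp hv r⟩
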